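/- **Setting.** Spinor indices take values $0,1$; $\epsilon_{ab}=\epsilon^{ab}$ is antisymmetric with $\epsilon_{01}=1$ (also for primed indices), $\epsilon_a{}^b$ is the Kronecker symbol, indices are moved by $\kappa^a=\epsilon^{ab}\kappa_b$, $\kappa_b=\kappa^a\epsilon_{ab}$, and a bar denotes spinor complex conjugation (so $\bar b_{aa'}=\overline{b_{a'a}}$, and the reality of $\Phi$ means $\overline{\Phi_{aba'b'}}=\Phi_{a'b'ab}$ for the component values). Let $0<T\le\infty$ and $\tilde{\mathcal N}_p=[0,T)\times SU(2)\ni(\tau,s)$ (for $T=\infty$ this is $\mathbb R^+_0\times SU(2)$), with $\kappa^A{}_a(s)=s^A{}_a$ and null vectors $x_*^\mu(s)=\alpha^\mu_{EE'}\kappa^E{}_0\bar\kappa^{E'}{}_{0'}$, $\alpha^\mu$ being the van der Waerden symbols. Let $Z_u$ be the left invariant vector field generated by $u\in su(2)$, let $h=\frac12\mathrm{diag}(i,-i)$, $u_1=\frac12\begin{pmatrix}0&i\\i&0\end{pmatrix}$, $u_2=\frac12\begin{pmatrix}0&-1\\1&0\end{pmatrix}$, and let $X_\pm=-(Z_{u_2}\pm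 iZ_{u_1})$, $S=-2iZ_h$ act on $\tilde{\mathcal N}_p$ independently of $\tau$. The unknowns are scalars $\Omega,\Pi$ (real), $\Sigma_{aa'}$ (hermitian; it stands for $\nabla_{aa'}\Omega$), $\Phi_{aba'b'}=\Phi_{(ab)(a'b')}$ (real), $\psi_{abcd}=\psi_{(abcd)}$ and, for $aa'\neq11'$, the lifted frame and connection coefficients $$\tilde c_{aa'}=(\epsilon_a{}^0\epsilon_{a'}{}^{0'}+r_{aa'})\partial_\tau+\Big(b_{aa'}-\tfrac1\tau\epsilon_a{}^0\epsilon_{a'}{}^{1'}\Big)X_++\Big(\bar b_{aa'}-\tfrac1\tau\epsilon_a{}^1\epsilon_{a'}{}^{0'}\Big)X_-,$$ $$\tilde\Gamma_{aa'bc}=-\tfrac1\tau\big(\epsilon_a{}^0\epsilon_{a'}{}^{1'}\epsilon_b{}^1\epsilon_c{}^1+\epsilon_a{}^1\epsilon_{a'}{}^{0'}\epsilon_b{}^0\epsilon_c{}^0\big)+\Gamma_{aa'bc},\qquad \Gamma_{aa'bc}=\Gamma_{aa'(bc)},$$ with $\bar r_{aa'}=r_{aa'}$, $b_{00'}=r_{00'}=\Gamma_{00'bc}=0$,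 and $b_{aa'},r_{aa'},\Gamma_{aa'bc}$ of order $O(\tau)$. All of $\Omega,\Pi,\Sigma,\Phi,\psi,b,r,\Gamma$ are smooth on $[0,T)\times SU(2)$. Write $\tilde\Gamma_{aa'}{}^{ee'}{}_{cc'}=\tilde\Gamma_{aa'}{}^e{}_c\,\epsilon_{c'}{}^{e'}+\bar{\tilde\Gamma}_{aa'}{}^{e'}{}_{c'}\,\epsilon_c{}^e$, let $\tilde\nabla_{aa'}$ be the covariant derivative built from $\tilde c_{aa'}$ and $\tilde\Gamma_{aa'bc}$, and put $$t_{bb'aa'}=[\tilde c_{bb'},\tilde c_{aa'}]-(\tilde\Gamma_{bb'}{}^{ee'}{}_{aa'}-\tilde\Gamma_{aa'}{}^{ee'}{}_{bb'})\tilde c_{ee'},$$ $$\rho_{cc'dd'ab}=\tilde c_{cc'}(\tilde\Gamma_{dd'ab})-\tilde c_{dd'}(\tilde\Gamma_{cc'ab})+\tilde\Gamma_{cc'af}\tilde\Gamma_{dd'}{}^f{}_b-\tilde\Gamma_{dd'af}\tilde\Gamma_{cc'}{}^f{}_b-(\tilde\Gamma_{cc'}{}^{ff'}{}_{dd'}-\tilde\Gamma_{dd'}{}^{ff'}{}_{cc'})\tilde\Gamma_{ff'ab}-\Omega\psi_{abcd}\epsilon_{c'd'}-\Phi_{abc'd'}\epsilon_{cd}.$$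 In $t$ and $\rho$ the factors of the transverse quantities $\tilde c_{11'}$, $\tilde\Gamma_{11'ab}$ are required to vanish. *Conformal gauge:* $\Omega=0$, $\Sigma_{aa'}=0$, $\Pi=\Pi_*:=2\eta_{00}$ at $\tau=0$, with $\eta=\mathrm{diag}(1,-1,-1,-1)$; $\Phi_{000'0'}=0$ on $\tilde{\mathcal N}_p$; and vanishing Ricci scalar, which is already used in the equations below. *Transport equations* ($0<\tau<T$): $\tilde c_{aa'}(\Omega)=\Sigma_{aa'}$, $\tilde\nabla_{aa'}\Sigma_{bb'}=-\Omega\Phi_{aba'b'}+\Pi\epsilon_{ab}\epsilon_{a'b'}$ and $\tilde c_{aa'}(\Pi)=-\Sigma^{bb'}\Phi_{aba'b'}$ for $aa'=00'$; $t_{00'\,aa'}=0$ and $\rho_{00'\,dd'\,ab}=0$ for $aa',dd'\ne11'$; $\tilde\nabla_0{}^{c'}\Phi_{bcb'c'}=\psi_{bcd0}\Sigma^d{}_{b'}$; $\tilde\nabla^d{}_{0'}\psi_{abcd}=0$. *Inner constraints* ($0<\tau<T$): the first three equations for $aa'=01',10'$; $t_{01'\,10'}=0$ after removal of the vertical part of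 the commutator, i.e. with $[\tilde c_{01'},\tilde c_{10'}]$ replaced by $[\tilde c_{01'},\tilde c_{10'}]+v\,S$; and, correspondingly, $\rho_{01'\,10'\,ab}-2i\,v\,h_{ab}=0$, where $h_{ab}=h^c{}_b\epsilon_{ca}$ and $-v$ is the coefficient of $S$ in the commutator (so that $v=1/\tau^2$ when $b_{01'}=b_{10'}=0$). *Radiation field:* $\psi_0(\tau,s)=\kappa^A{}_0\kappa^B{}_0\kappa^C{}_0\kappa^D{}_0\,\psi^*_{ABCD}(\tau x_*(s))$, where $\psi^*_{ABCD}=\psi^*_{(ABCD)}$ is an arbitrary smooth spinor field on an open subset of $\mathbb R^4$ that contains all points $\tau x_*(s)$, $0\le\tau<T$, $s\in SU(2)$. **Proposition.** For every such radiation field $\psi_0$, there is one and only one set of fields $\Omega,\Pi,\Sigma_{aa'},\Phi_{aba'b'},\psi_{abcd}$, $b_{aa'},r_{aa'},\Gamma_{aa'bc}$ ($aa'\ne11'$ for the last three) on $\tilde{\mathcal N}_p$ as above which is in the conformal gauge, satisfies the transport equations, and has $\psi_{0000}=\psi_0$. These fields are lifts from the cone (i.e. $\Omega,\Pi$ are functions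 of $\tau x_*(s)$, $\psi_{abcd}(\tau,s)=\psi_{ABCD}(\tau x_*(s))\kappa^A{}_a\cdots\kappa^D{}_d$ for some $\psi_{ABCD}$ on the cone, and similarly for $\Sigma,\Phi$), and satisfy $$\Omega=0,\quad \Pi=\Pi_*,\quad \Sigma_{aa'}=\tau\Pi_*\epsilon_a{}^1\epsilon_{a'}{}^{1'},\quad b_{aa'}=0,\quad r_{aa'}=0,$$ $$\Gamma_{01'bc}=0,\quad\Gamma_{10'00}=\Gamma_{10'01}=0,\quad \Gamma_{10'11}=\frac1\tau\int_0^\tau\tau'\Phi_{110'0'}\,d\tau'=-\frac{\Pi_*}{\tau}\int_0^\tau\!\int_0^{\tau'}\tau''^2\,\bar\psi_0\,d\tau''d\tau',$$ $$\Phi_{000'1'}=\Phi_{010'0'}=\Phi_{010'1'}=0,\quad \Phi_{001'1'}=-\frac{\Pi_*}\tau\int_0^\tau\tau'^2\psi_0\,d\tau',$$ $$\Phi_{011'1'}=-\frac{\Pi_*}\tau\int_0^\tau\tau'^2\psi_{0001}\,d\tau'=\frac{\Pi_*}{\tau^2}\int_0^\tau\!\int_0^{\tau'}\tau''^2X_-\psi_0\,d\tau''d\tau',\qquad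 \psi_{0001}=-\frac1{\tau^4}\int_0^\tau\tau'^3X_-\psi_0\,d\tau'$$ (integral formulas for $\tau>0$). Moreover, these fields satisfy all the inner constraints. -/

import Mathlib

open scoped ContDiff ComplexConjugate

noncomputable section

namespace ConformalCone

/-! ### Spinor algebra

All spinor indices take the values `0, 1` and are modelled by `Fin 2`; primed indices are
modelled by `Fin 2` as well and are told apart by their position. -/

/-- The antisymmetric spinor `ε_{ab} = ε^{ab}` with `ε_{01} = 1`
(the same numerical values serve for primed indices). -/
def eps (a b : Fin 2) : ℂ := if a = 0 ∧ b = 1 then 1 else if a = 1 ∧ b = 0 then -1 else 0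

/-- The Kronecker spinor `ε_a^b`. -/
def kron (a b : Fin 2) : ℂ := if a = b then 1 else 0

/-- The van der Waerden symbols `α^μ_{AA'}`. -/
def vdW (μ : Fin 4) : Matrix (Fin 2) (Fin 2) ℂ :=
  ((1 / Real.sqrt 2 : ℝ) : ℂ) •
    (![!![1, 0; 0, 1], !![0, 1; 1, 0], !![0, -Complex.I; Complex.I, 0], !![1, 0; 0, -1]] μ)

/-- The Minkowski metric `η`; the signature is the one for which
`η_{jk} α^j_{AA'} α^k_{BB'} = ε_{AB} ε_{A'B'}`. -/
def eta : Matrix (Fin 4) (Fin 4) ℝ := Matrix.diagonal ![1, -1, -1, -1]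

/-- The value `Π_* = 2 η_{00}` of `Π` at the vertex in the conformal gauge. -/
def PiStar : ℝ := 2 * eta 0 0

/-! ### The group `SU(2)` and its left invariant vector fields -/

/-- `SU(2)`. -/
abbrev SU2 := Matrix.specialUnitaryGroup (Fin 2) ℂ

/-- The element `(α, -β̄; β, ᾱ)` of `SU(2)`. -/
def mkSU2 (α β : ℂ) (hαβ : α * conj α + β * conj β = 1) : SU2 :=
  ⟨!![α, -conj β; β, conj α], by
    rw [Matrix.mem_specialUnitaryGroup_iff, Matrix.mem_unitaryGroup_iff']
    constructor
    · ext i j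
      fin_cases i <;> fin_cases j <;>
        simp [Matrix.mul_apply, Fin.sum_univ_two, Matrix.star_apply] <;>
        first | ring1 | linear_combination hαβ
    · rw [Matrix.det_fin_two_of]
      linear_combination hαβ⟩

/-- The generator `h` of the Lie algebra of `SU(2)`. -/
def genH : Matrix (Fin 2) (Fin 2) ℂ := (1 / 2 : ℂ) • !![Complex.I, 0; 0, -Complex.I]

/-- The generator `u₁` of the Lie algebra of `SU(2)`. -/
def genU1 : Matrix (Fin 2) (Fin 2) ℂ := (1 / 2 : ℂ) • !![0, Complex.I; Complex.I, 0]

/-- The generator `u₂` of the Lie algebra of `SU(2)`. -/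
def genU2 : Matrix (Fin 2) (Fin 2) ℂ := (1 / 2 : ℂ) • !![0, -1; 1, 0]

/-- The one-parameter subgroup `t ↦ exp (t h) = (e^{it/2}, 0; 0, e^{-it/2})`. -/
def expH (t : ℝ) : SU2 :=
  mkSU2 (Complex.exp (((t / 2 : ℝ) : ℂ) * Complex.I)) 0 (by
    rw [Complex.mul_conj, Complex.normSq_eq_norm_sq, Complex.norm_exp_ofReal_mul_I]
    simp)

/-- The one-parameter subgroup
`t ↦ exp (t u₁) = (cos (t/2), i sin (t/2); i sin (t/2), cos (t/2))`. -/
def expU1 (t : ℝ) : SU2 :=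
  mkSU2 ((Real.cos (t / 2) : ℝ) : ℂ) (Complex.I * ((Real.sin (t / 2) : ℝ) : ℂ)) (by
    rw [map_mul, Complex.conj_ofReal, Complex.conj_ofReal, Complex.conj_I]
    have h := congrArg (fun x : ℝ => (x : ℂ)) (Real.sin_sq_add_cos_sq (t / 2))
    push_cast at h ⊢
    linear_combination h - (Complex.sin (t / 2)) ^ 2 * Complex.I_sq)

/-- The one-parameter subgroup
`t ↦ exp (t u₂) = (cos (t/2), -sin (t/2); sin (t/2), cos (t/2))`. -/
def expU2 (t : ℝ) : SU2 :=
  mkSU2 ((Real.cos (t / 2) : ℝ) : ℂ) ((Real.sin (t / 2) : ℝ) : ℂ) (by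
    rw [Complex.conj_ofReal, Complex.conj_ofReal]
    have h := congrArg (fun x : ℝ => (x : ℂ)) (Real.sin_sq_add_cos_sq (t / 2))
    push_cast at h ⊢
    linear_combination h)

/-- The derivative of `f` along the left invariant vector field generated by the one-parameter
subgroup `γ`. -/
def leftInv (γ : ℝ → SU2) (f : SU2 → ℂ) (s : SU2) : ℂ := deriv (fun t : ℝ => f (s * γ t)) 0

/-- `Z_+ = -(Z_{u₂} + i Z_{u₁})`, acting on complex-valued functions. -/
def Zp (f : SU2 → ℂ) (s : SU2) : ℂ := -(leftInv expU2 f s + Complex.I * leftInv expU1 f s)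

/-- `Z_- = -(Z_{u₂} - i Z_{u₁})`, acting on complex-valued functions. -/
def Zm (f : SU2 → ℂ) (s : SU2) : ℂ := -(leftInv expU2 f s - Complex.I * leftInv expU1 f s)

/-! ### The bundle `ℝ⁺₀ × SU(2)` over the cone -/

/-- Scalar functions of `(τ, s)`. Only their values for `τ` in the range `[0, T)` matter. -/
abbrev Fn := ℝ → SU2 → ℂ

/-- The parameter range `0 ≤ τ < T` along the null generators (`T = ⊤` gives `ℝ⁺₀`). -/
def genRange (T : EReal) : Set ℝ := {τ | 0 ≤ τ ∧ (τ : EReal) < T}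

/-- Two functions agree on `[0, T) × SU(2)`. -/
def EqOnCone (T : EReal) (f g : Fn) : Prop := ∀ τ ∈ genRange T, ∀ s : SU2, f τ s = g τ s

/-- Smoothness on the manifold with boundary `[0, T) × SU(2)`. The group `SU(2)` is identified
with the unit sphere in `ℂ²` by its first column, and a function is smooth if it is the
restriction of a smooth function on an open subset of `ℝ × ℂ²`. -/
def SmoothOnCone (T : EReal) (f : Fn) : Prop :=
  ∃ (W : Set (ℝ × ℂ × ℂ)) (F : ℝ × ℂ × ℂ → ℂ), IsOpen W ∧ ContDiffOn ℝ ∞ F W ∧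
    ∀ τ ∈ genRange T, ∀ s : SU2,
      (τ, s.1 0 0, s.1 1 0) ∈ W ∧ F (τ, s.1 0 0, s.1 1 0) = f τ s

/-- The vector field `∂_τ`. -/
def dτ (f : Fn) : Fn := fun τ s => deriv (fun t : ℝ => f t s) τ

/-- The vector field `X_+`: the extension of `Z_+` by Lie transport along `∂_τ`. -/
def Xp (f : Fn) : Fn := fun τ s => Zp (f τ) s

/-- The vector field `X_-`: the extension of `Z_-` by Lie transport along `∂_τ`. -/
def Xm (f : Fn) : Fn := fun τ s => Zm (f τ) s

/-- The vertical vector field `S = -2 i Z_h`, tangent to the fibres. -/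
def Svert (f : Fn) : Fn := fun τ s => -2 * Complex.I * leftInv expH (f τ) s

/-- The null vector `x_*^μ(s) = α^μ_{EE'} κ^E_0 κ̄^{E'}_{0'}` with `κ^A_a = s^A_a`
(the sum is real since `α^μ` is hermitian). -/
def xstar (s : SU2) (μ : Fin 4) : ℝ :=
  (∑ E, ∑ E', vdW μ E E' * s.1 E 0 * conj (s.1 E' 0)).re

/-- The radiation field `ψ₀(τ,s) = κ^A_0 κ^B_0 κ^C_0 κ^D_0 ψ_{ABCD}(τ x_*(s))` of a spinor
field `ψ_{ABCD}` given in the normal gauge. -/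
def radiationField (ψs : Fin 2 → Fin 2 → Fin 2 → Fin 2 → (Fin 4 → ℝ) → ℂ) : Fn := fun τ s =>
  ∑ A, ∑ B, ∑ C, ∑ D, s.1 A 0 * s.1 B 0 * s.1 C 0 * s.1 D 0 * ψs A B C D (τ • xstar s)

/-- Total symmetry of a quantity with four spinor indices. -/
def Symm4 {α : Type*} (ψ : Fin 2 → Fin 2 → Fin 2 → Fin 2 → α) : Prop :=
  ∀ a b c d, ψ a b c d = ψ b a c d ∧ ψ a b c d = ψ a c b d ∧ ψ a b c d = ψ a b d c

/-! ### The unknowns on the bundle -/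

/-- The unknown fields on `[0, T) × SU(2)`. The order of the arguments is that of the indices:
`Sig a a'` is `Σ_{aa'}`, `Φ a b a' b'` is `Φ_{aba'b'}`, `ψ a b c d` is `ψ_{abcd}`; `b a a'`, `r a a'`
are the coefficients of the regular part of the lifted frame and `Γ a a' b c` is the regular part of
the connection coefficients. The entries of `b`, `r`, `Γ` with `(a, a') = (1, 1)` have no meaning and
are never used. -/
structure Fields where
  Ω : Fn
  Pi : Fn
  Sig : Fin 2 → Fin 2 → Fn
  Φ : Fin 2 → Fin 2 → Fin 2 → Fin 2 → Fn
  ψ : Fin 2 → Fin 2 → Fin 2 → Fin 2 → Fn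
  b : Fin 2 → Fin 2 → Fn
  r : Fin 2 → Fin 2 → Fn
  Γ : Fin 2 → Fin 2 → Fin 2 → Fin 2 → Fn

/-- The index pairs `aa' ≠ 11'`, whose frame vectors are tangent to the cone. -/
def Tangential (a a' : Fin 2) : Prop := ¬ (a = 1 ∧ a' = 1)

instance (a a' : Fin 2) : Decidable (Tangential a a') := inferInstanceAs (Decidable (¬ _))

namespace Fields

variable (F : Fields)

/-- The `∂_τ`-coefficient `ε_a^0 ε_{a'}^{0'} + r_{aa'}` of the lifted frame vector `c̃_{aa'}`. -/
def cT (a a' : Fin 2) : Fn := fun τ s => kron a 0 * kron a' 0 + F.r a a' τ s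

/-- The `X_+`-coefficient `-(1/τ) ε_a^0 ε_{a'}^{1'} + b_{aa'}` of `c̃_{aa'}`. -/
def cP (a a' : Fin 2) : Fn := fun τ s => -(1 / (τ : ℂ)) * (kron a 0 * kron a' 1) + F.b a a' τ s

/-- The `X_-`-coefficient `-(1/τ) ε_a^1 ε_{a'}^{0'} + b̄_{aa'}` of `c̃_{aa'}`; here `b̄_{aa'}` is the
spinor complex conjugate, i.e. the complex conjugate of `b_{a'a}`. -/
def cM (a a' : Fin 2) : Fn := fun τ s =>
  -(1 / (τ : ℂ)) * (kron a 1 * kron a' 0) + conj (F.b a' a τ s)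

/-- The lifted frame vector `c̃_{aa'}`, `aa' ≠ 11'`, as a first order differential operator. -/
def frame (a a' : Fin 2) (f : Fn) : Fn := fun τ s =>
  F.cT a a' τ s * dτ f τ s + F.cP a a' τ s * Xp f τ s + F.cM a a' τ s * Xm f τ s

/-- The lifted connection coefficients `Γ̃_{aa'bc}`, `aa' ≠ 11'`. -/
def Gt (a a' b c : Fin 2) : Fn := fun τ s =>
  -(1 / (τ : ℂ)) * (kron a 0 * kron a' 1 * kron b 1 * kron c 1
    + kron a 1 * kron a' 0 * kron b 0 * kron c 0) + F.Γ a a' b c τ s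

/-- `Γ̃_{aa'}^b_c = ε^{bd} Γ̃_{aa'dc}`. -/
def GtUp (a a' b c : Fin 2) : Fn := fun τ s => ∑ d, eps b d * F.Gt a a' d c τ s

/-- The spinor complex conjugate `Γ̃̄_{aa'}^{b'}_{c'}`, i.e. the complex conjugate of
`Γ̃_{a'a}^b_c`. -/
def GtUpBar (a a' b' c' : Fin 2) : Fn := fun τ s => conj (F.GtUp a' a b' c' τ s)

/-- `Γ̃_{aa'}^{ee'}_{cc'} = Γ̃_{aa'}^e_c ε_{c'}^{e'} + Γ̃̄_{aa'}^{e'}_{c'} ε_c^e`. -/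
def GtVec (a a' e e' c c' : Fin 2) : Fn := fun τ s =>
  F.GtUp a a' e c τ s * kron c' e' + F.GtUpBar a a' e' c' τ s * kron c e

/-- `Σ^{aa'} = ε^{ab} ε^{a'b'} Σ_{bb'}`. -/
def SigUp (a a' : Fin 2) : Fn := fun τ s => ∑ b, ∑ b', eps a b * eps a' b' * F.Sig b b' τ s

/-- `Σ^d_{b'} = ε^{de} Σ_{eb'}`. -/
def SigUp1 (d b' : Fin 2) : Fn := fun τ s => ∑ e, eps d e * F.Sig e b' τ s

/-! #### Covariant derivatives in the direction `c̃_{aa'}`, `aa' ≠ 11'` -/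

/-- `∇̃_{aa'} Σ_{bb'}`. -/
def nablaSig (a a' b b' : Fin 2) : Fn := fun τ s =>
  F.frame a a' (F.Sig b b') τ s
    - ∑ f, F.GtUp a a' f b τ s * F.Sig f b' τ s
    - ∑ f', F.GtUpBar a a' f' b' τ s * F.Sig b f' τ s

/-- `∇̃_{aa'} Φ_{bcb'c'}`. -/
def nablaΦ (a a' b c b' c' : Fin 2) : Fn := fun τ s =>
  F.frame a a' (F.Φ b c b' c') τ s
    - ∑ f, F.GtUp a a' f b τ s * F.Φ f c b' c' τ s
    - ∑ f, F.GtUp a a' f c τ s * F.Φ b f b' c' τ s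
    - ∑ f', F.GtUpBar a a' f' b' τ s * F.Φ b c f' c' τ s
    - ∑ f', F.GtUpBar a a' f' c' τ s * F.Φ b c b' f' τ s

/-- `∇̃_{ee'} ψ_{abcd}`. -/
def nablaψ (e e' a b c d : Fin 2) : Fn := fun τ s =>
  F.frame e e' (F.ψ a b c d) τ s
    - ∑ f, F.GtUp e e' f a τ s * F.ψ f b c d τ s
    - ∑ f, F.GtUp e e' f b τ s * F.ψ a f c d τ s
    - ∑ f, F.GtUp e e' f c τ s * F.ψ a b f d τ s
    - ∑ f, F.GtUp e e' f d τ s * F.ψ a b c f τ s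

/-! #### The components of the equations -/

/-- `∇_{aa'} Ω - Σ_{aa'}`. -/
def omegaEq (a a' : Fin 2) : Fn := fun τ s => F.frame a a' F.Ω τ s - F.Sig a a' τ s

/-- `∇_{aa'} Σ_{bb'} + Ω Φ_{aba'b'} - Π ε_{ab} ε_{a'b'}`. -/
def sigmaEq (a a' b b' : Fin 2) : Fn := fun τ s =>
  F.nablaSig a a' b b' τ s + F.Ω τ s * F.Φ a b a' b' τ s - F.Pi τ s * eps a b * eps a' b'

/-- `∇_{aa'} Π + Σ^{bb'} Φ_{aba'b'}`. -/
def piEq (a a' : Fin 2) : Fn := fun τ s =>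
  F.frame a a' F.Pi τ s + ∑ b, ∑ b', F.SigUp b b' τ s * F.Φ a b a' b' τ s

/-- `∇_0^{c'} Φ_{bcb'c'} - ψ_{bcd0} Σ^d_{b'}`, where `∇_a^{c'} = ε^{c'e'} ∇_{ae'}`. -/
def phiEq (b c b' : Fin 2) : Fn := fun τ s =>
  (∑ c', ∑ e', eps c' e' * F.nablaΦ 0 e' b c b' c' τ s)
    - ∑ d, F.ψ b c d 0 τ s * F.SigUp1 d b' τ s

/-- `∇^d_{0'} ψ_{abcd}`, where `∇^d_{a'} = ε^{de} ∇_{ea'}`. -/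
def psiEq (a b c : Fin 2) : Fn := fun τ s =>
  ∑ d, ∑ e, eps d e * F.nablaψ e 0 a b c d τ s

/-- The coefficient `Γ̃_{bb'}^{ee'}_{aa'} - Γ̃_{aa'}^{ee'}_{bb'}`. -/
def torsCoeff (b b' a a' e e' : Fin 2) : Fn := fun τ s =>
  F.GtVec b b' e e' a a' τ s - F.GtVec a a' e e' b b' τ s

/-- The torsion operator
`[c̃_{bb'}, c̃_{aa'}] - (Γ̃_{bb'}^{ee'}_{aa'} - Γ̃_{aa'}^{ee'}_{bb'}) c̃_{ee'}`, applied to a function,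
with the sum restricted to `ee' ≠ 11'`. (The field `c̃_{11'}` is transverse, so that its factor has
to vanish separately.) -/
def torsionOp (b b' a a' : Fin 2) (f : Fn) : Fn := fun τ s =>
  F.frame b b' (F.frame a a' f) τ s - F.frame a a' (F.frame b b' f) τ s
    - ∑ e, ∑ e', if Tangential e e' then
        F.torsCoeff b b' a a' e e' τ s * F.frame e e' f τ s else 0

/-- The factor of `S` in `-[c̃_{01'}, c̃_{10'}]`, which is supplied by `[X_+, X_-] = -S`
(it is equal to `1/τ²` if `b_{01'} = b_{10'} = 0`). -/
def vertCoeff : Fn := fun τ s =>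
  F.cP 0 1 τ s * F.cM 1 0 τ s - F.cM 0 1 τ s * F.cP 1 0 τ s

/-- The component `cc', dd'`, with both pairs `≠ 11'`, of the Ricci identity:
`c̃_{cc'}(Γ̃_{dd'ab}) - c̃_{dd'}(Γ̃_{cc'ab}) + Γ̃_{cc'af} Γ̃_{dd'}^f_b - Γ̃_{dd'af} Γ̃_{cc'}^f_b
- (Γ̃_{cc'}^{ff'}_{dd'} - Γ̃_{dd'}^{ff'}_{cc'}) Γ̃_{ff'ab} - Ω ψ_{abcd} ε_{c'd'} - Φ_{abc'd'} ε_{cd}`,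
with the sum over `ff'` restricted to `ff' ≠ 11'`; the factor of `Γ̃_{11'ab}` is zero in all equations
below. -/
def ricciEq (c c' d d' a b : Fin 2) : Fn := fun τ s =>
  F.frame c c' (F.Gt d d' a b) τ s - F.frame d d' (F.Gt c c' a b) τ s
    + (∑ f, F.Gt c c' a f τ s * F.GtUp d d' f b τ s)
    - (∑ f, F.Gt d d' a f τ s * F.GtUp c c' f b τ s)
    - (∑ f, ∑ f', if Tangential f f' then
        F.torsCoeff c c' d d' f f' τ s * F.Gt f f' a b τ s else 0)
    - F.Ω τ s * F.ψ a b c d τ s * eps c' d'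
    - F.Φ a b c' d' τ s * eps c d

end Fields

/-- `h_{ab} = h^c_b ε_{ca}`. -/
def hLow (a b : Fin 2) : ℂ := ∑ c, genH c b * eps c a

/-! ### Regularity, gauge, transport equations, inner constraints -/

/-- The algebraic and regularity properties of the fields: smoothness on `[0, T) × SU(2)` of all
fields apart from the explicit singular terms of frame and connection, index symmetries, reality,
and the form of the frame and connection coefficients. (For a smooth function the order relation
`O(|τ|)` says that it vanishes at `τ = 0`.) -/
structure IsRegular (T : EReal) (F : Fields) : Prop where
  smooth_Ω : SmoothOnCone T F.Ω
  smooth_Pi : SmoothOnCone T F.Pi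
  smooth_Sig : ∀ a a', SmoothOnCone T (F.Sig a a')
  smooth_Φ : ∀ a b a' b', SmoothOnCone T (F.Φ a b a' b')
  smooth_ψ : ∀ a b c d, SmoothOnCone T (F.ψ a b c d)
  smooth_b : ∀ a a', Tangential a a' → SmoothOnCone T (F.b a a')
  smooth_r : ∀ a a', Tangential a a' → SmoothOnCone T (F.r a a')
  smooth_Γ : ∀ a a' b c, Tangential a a' → SmoothOnCone T (F.Γ a a' b c)
  real_Ω : ∀ τ ∈ genRange T, ∀ s, conj (F.Ω τ s) = F.Ω τ s
  real_Pi : ∀ τ ∈ genRange T, ∀ s, conj (F.Pi τ s) = F.Pi τ s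
  real_Sig : ∀ τ ∈ genRange T, ∀ s a a', conj (F.Sig a a' τ s) = F.Sig a' a τ s
  real_Φ : ∀ τ ∈ genRange T, ∀ s a b a' b', conj (F.Φ a b a' b' τ s) = F.Φ a' b' a b τ s
  real_r : ∀ τ ∈ genRange T, ∀ s a a', Tangential a a' → conj (F.r a a' τ s) = F.r a' a τ s
  symm_Φ : ∀ τ ∈ genRange T, ∀ s a b a' b',
    F.Φ a b a' b' τ s = F.Φ b a a' b' τ s ∧ F.Φ a b a' b' τ s = F.Φ a b b' a' τ s
  symm_ψ : ∀ τ ∈ genRange T, ∀ s, Symm4 (fun a b c d => F.ψ a b c d τ s)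
  symm_Γ : ∀ τ ∈ genRange T, ∀ s a a' b c, Tangential a a' → F.Γ a a' b c τ s = F.Γ a a' c b τ s
  b_00 : ∀ τ ∈ genRange T, ∀ s, F.b 0 0 τ s = 0
  r_00 : ∀ τ ∈ genRange T, ∀ s, F.r 0 0 τ s = 0
  Γ_00 : ∀ τ ∈ genRange T, ∀ s b c, F.Γ 0 0 b c τ s = 0
  b_vertex : ∀ s a a', Tangential a a' → F.b a a' 0 s = 0
  r_vertex : ∀ s a a', Tangential a a' → F.r a a' 0 s = 0
  Γ_vertex : ∀ s a a' b c, Tangential a a' → F.Γ a a' b c 0 s = 0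

/-- The conformal gauge: `Ω = 0`, `Σ_{aa'} = 0`, `Π = Π_*` over the vertex and `Φ_{000'0'} = 0`
everywhere. (The remaining gauge condition, vanishing Ricci scalar `24 Λ`, has been used to drop the
terms with `Λ` from the field equations.) -/
structure IsConformalGauge (T : EReal) (F : Fields) : Prop where
  Ω_vertex : ∀ s, F.Ω 0 s = 0
  Sig_vertex : ∀ s a a', F.Sig a a' 0 s = 0
  Pi_vertex : ∀ s, F.Pi 0 s = (PiStar : ℂ)
  Φ_null : ∀ τ ∈ genRange T, ∀ s, F.Φ 0 0 0 0 τ s = 0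

/-- The transport equations: the components of the conformal field equations and of the structural
equations that involve the derivative along `c̃_{00'} = ∂_τ` and no transverse derivative. -/
structure TransportEqs (T : EReal) (F : Fields) : Prop where
  omega : ∀ τ ∈ genRange T, 0 < τ → ∀ s, F.omegaEq 0 0 τ s = 0
  sigma : ∀ τ ∈ genRange T, 0 < τ → ∀ s b b', F.sigmaEq 0 0 b b' τ s = 0
  pi : ∀ τ ∈ genRange T, 0 < τ → ∀ s, F.piEq 0 0 τ s = 0
  torsion : ∀ τ ∈ genRange T, 0 < τ → ∀ s a a', Tangential a a' →
    F.torsCoeff 0 0 a a' 1 1 τ s = 0 ∧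
      ∀ f, SmoothOnCone T f → F.torsionOp 0 0 a a' f τ s = 0
  ricci : ∀ τ ∈ genRange T, 0 < τ → ∀ s d d' a b, Tangential d d' →
    F.ricciEq 0 0 d d' a b τ s = 0
  phi : ∀ τ ∈ genRange T, 0 < τ → ∀ s b c b', F.phiEq b c b' τ s = 0
  psi : ∀ τ ∈ genRange T, 0 < τ → ∀ s a b c, F.psiEq a b c τ s = 0

/-- The inner constraints: the components of the equations that involve only derivatives tangent to
the cone in the directions `c̃_{01'}`, `c̃_{10'}`. In the torsion-free condition the vertical part of
the commutator is removed, and the Ricci identity is corrected by the corresponding term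
`-2 i h_{ab} / τ²` coming from the action of `S` on spinor components. -/
structure InnerConstraints (T : EReal) (F : Fields) : Prop where
  omega : ∀ τ ∈ genRange T, 0 < τ → ∀ s, F.omegaEq 0 1 τ s = 0 ∧ F.omegaEq 1 0 τ s = 0
  sigma : ∀ τ ∈ genRange T, 0 < τ → ∀ s b b',
    F.sigmaEq 0 1 b b' τ s = 0 ∧ F.sigmaEq 1 0 b b' τ s = 0
  pi : ∀ τ ∈ genRange T, 0 < τ → ∀ s, F.piEq 0 1 τ s = 0 ∧ F.piEq 1 0 τ s = 0
  torsion : ∀ τ ∈ genRange T, 0 < τ → ∀ s, F.torsCoeff 0 1 1 0 1 1 τ s = 0 ∧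
    ∀ f, SmoothOnCone T f → F.torsionOp 0 1 1 0 f τ s + F.vertCoeff τ s * Svert f τ s = 0
  ricci : ∀ τ ∈ genRange T, 0 < τ → ∀ s a b,
    F.ricciEq 0 1 1 0 a b τ s - 2 * Complex.I * F.vertCoeff τ s * hLow a b = 0

/-- `F` is a solution, with radiation field `ψ₀`, of the transport equations in the conformal
gauge. -/
structure IsTransportSolution (T : EReal) (ψ₀ : Fn) (F : Fields) : Prop where
  regular : IsRegular T F
  gauge : IsConformalGauge T F
  radiation : EqOnCone T (F.ψ 0 0 0 0) ψ₀
  transport : TransportEqs T F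

/-- Two sets of fields coincide on `[0, T) × SU(2)`. -/
structure SameFields (T : EReal) (F G : Fields) : Prop where
  Ω : EqOnCone T F.Ω G.Ω
  Pi : EqOnCone T F.Pi G.Pi
  Sig : ∀ a a', EqOnCone T (F.Sig a a') (G.Sig a a')
  Φ : ∀ a b a' b', EqOnCone T (F.Φ a b a' b') (G.Φ a b a' b')
  ψ : ∀ a b c d, EqOnCone T (F.ψ a b c d) (G.ψ a b c d)
  b : ∀ a a', Tangential a a' → EqOnCone T (F.b a a') (G.b a a')
  r : ∀ a a', Tangential a a' → EqOnCone T (F.r a a') (G.r a a')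
  Γ : ∀ a a' b c, Tangential a a' → EqOnCone T (F.Γ a a' b c) (G.Γ a a' b c)

/-- The curvature fields and scalars are lifts of fields on the cone: they arise from spinor fields
`Ω, Π, Σ_{AA'}, Φ_{ABA'B'}, ψ_{ABCD}` on the cone by pull-back along `(τ, s) ↦ τ x_*(s)` and the frame
transformation `κ^A_a = s^A_a`. -/
structure IsLift (T : EReal) (F : Fields) : Prop where
  Ω : ∃ g : (Fin 4 → ℝ) → ℂ, ∀ τ ∈ genRange T, ∀ s, F.Ω τ s = g (τ • xstar s)
  Pi : ∃ g : (Fin 4 → ℝ) → ℂ, ∀ τ ∈ genRange T, ∀ s, F.Pi τ s = g (τ • xstar s)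
  Sig : ∃ g : Fin 2 → Fin 2 → (Fin 4 → ℝ) → ℂ, ∀ τ ∈ genRange T, ∀ s a a',
    F.Sig a a' τ s = ∑ A, ∑ A', s.1 A a * conj (s.1 A' a') * g A A' (τ • xstar s)
  Φ : ∃ g : Fin 2 → Fin 2 → Fin 2 → Fin 2 → (Fin 4 → ℝ) → ℂ,
    ∀ τ ∈ genRange T, ∀ s a b a' b', F.Φ a b a' b' τ s =
      ∑ A, ∑ B, ∑ A', ∑ B', s.1 A a * s.1 B b * conj (s.1 A' a') * conj (s.1 B' b')
        * g A B A' B' (τ • xstar s)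
  ψ : ∃ g : Fin 2 → Fin 2 → Fin 2 → Fin 2 → (Fin 4 → ℝ) → ℂ,
    ∀ τ ∈ genRange T, ∀ s a b c d, F.ψ a b c d τ s =
      ∑ A, ∑ B, ∑ C, ∑ D, s.1 A a * s.1 B b * s.1 C c * s.1 D d * g A B C D (τ • xstar s)

/-- The explicit expressions for the fields in terms of `Π_*` and the radiation field `ψ₀`. -/
structure ExplicitForm (T : EReal) (ψ₀ : Fn) (F : Fields) : Prop where
  Ω : ∀ τ ∈ genRange T, ∀ s, F.Ω τ s = 0
  Sig : ∀ τ ∈ genRange T, ∀ s a a',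
    F.Sig a a' τ s = (τ : ℂ) * (PiStar : ℂ) * kron a 1 * kron a' 1
  Pi : ∀ τ ∈ genRange T, ∀ s, F.Pi τ s = (PiStar : ℂ)
  b : ∀ τ ∈ genRange T, ∀ s a a', Tangential a a' → F.b a a' τ s = 0
  r : ∀ τ ∈ genRange T, ∀ s a a', Tangential a a' → F.r a a' τ s = 0
  Γ_01 : ∀ τ ∈ genRange T, ∀ s b c, F.Γ 0 1 b c τ s = 0
  Γ_1000 : ∀ τ ∈ genRange T, ∀ s, F.Γ 1 0 0 0 τ s = 0
  Γ_1001 : ∀ τ ∈ genRange T, ∀ s, F.Γ 1 0 0 1 τ s = 0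
  Γ_1011 : ∀ τ ∈ genRange T, 0 < τ → ∀ s, F.Γ 1 0 1 1 τ s =
    -((PiStar : ℂ) / (τ : ℂ)) *
      ∫ τ₁ in (0 : ℝ)..τ, ∫ τ₂ in (0 : ℝ)..τ₁, (τ₂ : ℂ) ^ 2 * conj (ψ₀ τ₂ s)
  Γ_1011' : ∀ τ ∈ genRange T, 0 < τ → ∀ s, F.Γ 1 0 1 1 τ s =
    1 / (τ : ℂ) * ∫ τ₁ in (0 : ℝ)..τ, (τ₁ : ℂ) * F.Φ 1 1 0 0 τ₁ s
  Φ_0001 : ∀ τ ∈ genRange T, ∀ s, F.Φ 0 0 0 1 τ s = 0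
  Φ_0100 : ∀ τ ∈ genRange T, ∀ s, F.Φ 0 1 0 0 τ s = 0
  Φ_0101 : ∀ τ ∈ genRange T, ∀ s, F.Φ 0 1 0 1 τ s = 0
  Φ_0011 : ∀ τ ∈ genRange T, 0 < τ → ∀ s, F.Φ 0 0 1 1 τ s =
    -((PiStar : ℂ) / (τ : ℂ)) * ∫ τ₁ in (0 : ℝ)..τ, (τ₁ : ℂ) ^ 2 * ψ₀ τ₁ s
  Φ_0111 : ∀ τ ∈ genRange T, 0 < τ → ∀ s, F.Φ 0 1 1 1 τ s =
    -((PiStar : ℂ) / (τ : ℂ)) * ∫ τ₁ in (0 : ℝ)..τ, (τ₁ : ℂ) ^ 2 * F.ψ 0 0 0 1 τ₁ s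
  Φ_0111' : ∀ τ ∈ genRange T, 0 < τ → ∀ s, F.Φ 0 1 1 1 τ s =
    (PiStar : ℂ) / (τ : ℂ) ^ 2 *
      ∫ τ₁ in (0 : ℝ)..τ, ∫ τ₂ in (0 : ℝ)..τ₁, (τ₂ : ℂ) ^ 2 * Xm ψ₀ τ₂ s
  ψ_0001 : ∀ τ ∈ genRange T, 0 < τ → ∀ s, F.ψ 0 0 0 1 τ s =
    -(1 / (τ : ℂ) ^ 4) * ∫ τ₁ in (0 : ℝ)..τ, (τ₁ : ℂ) ^ 3 * Xm ψ₀ τ₁ s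

end ConformalCone

end

/-!
# The transport equations on a null cone in the conformal gauge

Along the null generators the transport equations are singular ordinary differential equations with
a regular singular point at the vertex. The proof shows that, for fields that are smooth at `τ = 0`,
they decouple into a hierarchy of linear scalar equations `τ ∂_τ u + (m + 1) u = g` in which `g` is
known from the previous steps.

*Reduction.* Since `Φ_{000'0'} = 0`, the equations for `Ω`, `Σ`, `Π` along `∂_τ` can be integrated and
give `Ω = 0`, `Π = 2` and `Σ_{11'} = 2 τ`. The Ricci identity yields a pair of Riccati equations for
`Γ_{01'00}` and `Γ_{10'00}`, of which zero is the only solution vanishing at the vertex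
(`eq_zero_of_riccati`). After that the equations for the other coefficients of frame and connection are
linear, and all of these coefficients except `Γ_{10'11}` vanish. What remains is
`IsTransportSolution.normalForm`: all fields vanish or are explicit except
`ψ_{0000}, …, ψ_{1111}`, `Φ_{001'1'}`, `Φ_{011'1'}`, `Φ_{111'1'}` and `Γ_{10'11}` (and the components
related to these by symmetry), and these satisfy the hierarchy `RadialSystem`.

*Solution of the hierarchy.* The only solution of `τ ∂_τ u + (m + 1) u = g` that is smooth at
`τ = 0` is `u(τ, s) = ∫₀¹ t^m g(t τ, s) dt` (`RadialODE.eq_radialMean`), which is as smooth as `g`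
(`SmoothOver.radialMean`). Hence the hierarchy has exactly one smooth solution for given
`ψ_{0000}`; this gives uniqueness and the integral formulas, and `RadialSystem.normalForm` with
`NormalForm.transportEqs` gives existence, since a solution of the hierarchy satisfies all transport
equations. The existence part and the inner constraints use relations which are not part of the
hierarchy (`RadialSystem.q_eq`, `RadialSystem.tau_mul_q`, `RadialSystem.conj_Q`). They hold because both
sides solve the same radial equation, as `X_±` commute with `∂_τ`.

*Lift property.* Two points `(τ, s)`, `τ > 0`, lie over the same point of the cone if and only if they
differ by the right action of `diag(u, ū)`. This action multiplies `ψ_{0000}` by `u⁴`, the operators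
`X_∓` change the exponent by `∓ 2`, and radial means do not change it, so that each component transforms
as its indices require (`RadialSystem.equivariant`). Over the vertex, `Φ` vanishes, and the recursion
`ψ_{k+1} = -X_- ψ_k / (4 - k)` reproduces the components of the constant spinor `ψ_{ABCD}(0)`, because
`X_- κ_0 = -κ_1` and `X_- κ_1 = 0`.

Smoothness is handled by restriction from open subsets of `ℝ × ℂ²`: a left invariant vector field on
`SU(2)` extends to a real linear vector field there (`rightMul`).
-/

noncomputable section

namespace ConformalCone

open Set Filter Topology MeasureTheory

/-! ### Smooth dependence of integrals on parameters -/

section Parametric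

variable {E G : Type} [NormedAddCommGroup E] [NormedSpace ℝ E]
  [NormedAddCommGroup G] [NormedSpace ℝ G]

/-- The parameters `x` for which the whole segment `{x} × [0, 1]` lies in `V`. -/
def tubeCore (V : Set (E × ℝ)) : Set E := {x | ∀ t ∈ Icc (0 : ℝ) 1, (x, t) ∈ V}

omit [NormedSpace ℝ E] in
lemma isOpen_tubeCore {V : Set (E × ℝ)} (hV : IsOpen V) : IsOpen (tubeCore V) := by
  rw [isOpen_iff_mem_nhds]
  intro x hx
  have := isCompact_Icc.eventually_forall_of_forall_eventually (x₀ := x)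
    (K := Icc (0 : ℝ) 1) (P := fun x t => (x, t) ∈ V)
    (fun t ht => by simpa using hV.mem_nhds (hx t ht))
  exact this

/-- Differentiation under the integral sign over `[0, 1]`. -/
lemma hasFDerivAt_integral_tubeCore {V : Set (E × ℝ)} (hV : IsOpen V) {φ : E × ℝ → G}
    (hφ : ContDiffOn ℝ ∞ φ V) {x₀ : E} (hx₀ : x₀ ∈ tubeCore V) :
    HasFDerivAt (fun x => ∫ t in (0 : ℝ)..1, φ (x, t))
      (∫ t in (0 : ℝ)..1, (fderiv ℝ φ (x₀, t)).comp (ContinuousLinearMap.inl ℝ E ℝ)) x₀ := by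
  set φ' : E × ℝ → (E →L[ℝ] G) := fun p =>
    (fderiv ℝ φ p).comp (ContinuousLinearMap.inl ℝ E ℝ) with hφ'
  have hφ'c : ContinuousOn φ' V :=
    (hφ.continuousOn_fderiv_of_isOpen hV (by simp)).clm_comp continuousOn_const
  have hslice : ∀ {x}, x ∈ tubeCore V → ∀ {H : Type} [NormedAddCommGroup H] (g : E × ℝ → H),
      ContinuousOn g V → ContinuousOn (fun t : ℝ => g (x, t)) (Icc 0 1) := by
    intro x hx H _ g hg
    exact hg.comp (by fun_prop) (fun t ht => hx t ht)
  obtain ⟨C, hC⟩ := isCompact_Icc.exists_bound_of_continuousOn (hslice hx₀ φ' hφ'c)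
  have hnear : ∀ᶠ x in 𝓝 x₀, ∀ t ∈ Icc (0 : ℝ) 1, (x, t) ∈ V ∧ ‖φ' (x, t)‖ < C + 1 := by
    refine isCompact_Icc.eventually_forall_of_forall_eventually
      (P := fun x t => (x, t) ∈ V ∧ ‖φ' (x, t)‖ < C + 1) (fun t ht => ?_)
    have h1 : V ∈ 𝓝 (x₀, t) := hV.mem_nhds (hx₀ t ht)
    have h2 : ContinuousAt φ' (x₀, t) := hφ'c.continuousAt h1
    have h3 := h2.norm.eventually_lt_const (lt_of_le_of_lt (hC t ht) (lt_add_one C))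
    exact (Filter.Eventually.and h1 h3)
  obtain ⟨N, hN, hNn⟩ := hnear.exists_mem
  have hN' : ∀ x ∈ N, x ∈ tubeCore V := fun x hx t ht => (hNn x hx t ht).1
  have hI : uIoc (0 : ℝ) 1 ⊆ Icc 0 1 := by
    rw [uIoc_of_le zero_le_one]; exact Ioc_subset_Icc_self
  have hmeas : ∀ {x}, x ∈ tubeCore V → ∀ {H : Type} [NormedAddCommGroup H] (g : E × ℝ → H),
      ContinuousOn g V → IntervalIntegrable (fun t : ℝ => g (x, t)) volume 0 1 := by
    intro x hx H _ g hg
    refine ContinuousOn.intervalIntegrable ?_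
    rw [uIcc_of_le zero_le_one]
    exact hslice hx g hg
  refine intervalIntegral.hasFDerivAt_integral_of_dominated_of_fderiv_le
    (F := fun x t => φ (x, t)) (F' := fun x t => φ' (x, t)) (bound := fun _ => C + 1) (𝕜 := ℝ)
    hN ?_ ?_ ?_ ?_ ?_ ?_
  · filter_upwards [hN] with x hx
    have := (hmeas (hN' x hx) φ hφ.continuousOn).aestronglyMeasurable
    rwa [uIoc_of_le zero_le_one]
  · exact hmeas hx₀ φ hφ.continuousOn
  · have := (hmeas hx₀ φ' hφ'c).aestronglyMeasurable
    rwa [uIoc_of_le zero_le_one]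
  · exact ae_of_all _ fun t ht x hx => (hNn x hx t (hI ht)).2.le
  · exact intervalIntegrable_const
  · refine ae_of_all _ fun t ht x hx => ?_
    have h1 : V ∈ 𝓝 (x, t) := hV.mem_nhds (hNn x hx t (hI ht)).1
    have h2 : HasFDerivAt φ (fderiv ℝ φ (x, t)) (x, t) :=
      ((hφ.contDiffAt h1).differentiableAt (by simp)).hasFDerivAt
    exact h2.comp x (hasFDerivAt_prodMk_left x t)

/-- An integral over `[0, 1]` depends smoothly on parameters if the integrand does. -/
lemma contDiffOn_integral_tubeCore {V : Set (E × ℝ)} (hV : IsOpen V) {φ : E × ℝ → G}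
    (hφ : ContDiffOn ℝ ∞ φ V) :
    ContDiffOn ℝ ∞ (fun x => ∫ t in (0 : ℝ)..1, φ (x, t)) (tubeCore V) := by
  rw [contDiffOn_infty]
  intro n
  induction n generalizing G with
  | zero =>
    refine contDiffOn_zero.2 fun x hx => ?_
    exact (hasFDerivAt_integral_tubeCore hV hφ hx).continuousAt.continuousWithinAt
  | succ n ih =>
    refine (contDiffOn_succ_iff_fderiv_of_isOpen (isOpen_tubeCore hV)).2 ⟨fun x hx =>
      (hasFDerivAt_integral_tubeCore hV hφ hx).differentiableAt.differentiableWithinAt,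
      fun h => absurd h (by exact_mod_cast WithTop.natCast_ne_top n), ?_⟩
    refine ContDiffOn.congr (ih (G := E →L[ℝ] G)
      (φ := fun p => (fderiv ℝ φ p).comp (ContinuousLinearMap.inl ℝ E ℝ)) ?_)
      (fun x hx => (hasFDerivAt_integral_tubeCore hV hφ hx).fderiv)
    exact (hφ.fderiv_of_isOpen hV (by simp)).clm_comp contDiffOn_const

end Parametric

/-! ### Smooth functions and vector fields on the bundle -/

lemma SU2.star_eq_adjugate (s : SU2) : star s.1 = s.1.adjugate := by
  have h := Matrix.mem_specialUnitaryGroup_iff.1 s.2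
  have h2 := (Matrix.mem_unitaryGroup_iff').1 h.1
  have h3 : s.1 * s.1.adjugate = 1 := by rw [Matrix.mul_adjugate, h.2, one_smul]
  calc star s.1 = star s.1 * (s.1 * s.1.adjugate) := by rw [h3, mul_one]
    _ = s.1.adjugate := by rw [← mul_assoc, h2, one_mul]

lemma SU2.entry_01 (s : SU2) : s.1 0 1 = -conj (s.1 1 0) := by
  have h4 := congrFun (congrFun (SU2.star_eq_adjugate s) 0) 1
  simp [Matrix.adjugate_fin_two, Matrix.star_apply] at h4
  rw [h4, neg_neg]

lemma SU2.entry_11 (s : SU2) : s.1 1 1 = conj (s.1 0 0) := by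
  have h4 := congrFun (congrFun (SU2.star_eq_adjugate s) 0) 0
  simp [Matrix.adjugate_fin_two, Matrix.star_apply] at h4
  exact h4.symm

lemma SU2.normSq_col (s : SU2) : s.1 0 0 * conj (s.1 0 0) + s.1 1 0 * conj (s.1 1 0) = 1 := by
  have h := (Matrix.mem_specialUnitaryGroup_iff.1 s.2).2
  rw [Matrix.det_fin_two, SU2.entry_01, SU2.entry_11] at h
  linear_combination h

/-- The point of `ℝ × ℂ²` that represents `(τ, s)`: `s` is identified with its first column. -/
def conePt (τ : ℝ) (s : SU2) : ℝ × ℂ × ℂ := (τ, s.1 0 0, s.1 1 0)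

/-- `F`, defined and smooth on the open set `W` of `ℝ × ℂ²`, extends the function `f` of `(τ, s)`,
`τ ∈ R`. -/
structure Extends (R : Set ℝ) (f : Fn) (W : Set (ℝ × ℂ × ℂ)) (F : ℝ × ℂ × ℂ → ℂ) : Prop where
  isOpen : IsOpen W
  smooth : ContDiffOn ℝ ∞ F W
  mem : ∀ τ ∈ R, ∀ s, conePt τ s ∈ W
  eq : ∀ τ ∈ R, ∀ s, F (conePt τ s) = f τ s

/-- Smoothness of a function of `(τ, s)`, `τ ∈ R`. -/
def SmoothOver (R : Set ℝ) (f : Fn) : Prop := ∃ W F, Extends R f W F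

lemma smoothOnCone_iff {T : EReal} {f : Fn} : SmoothOnCone T f ↔ SmoothOver (genRange T) f := by
  constructor
  · rintro ⟨W, F, hW, hF, h⟩
    exact ⟨W, F, hW, hF, fun τ hτ s => (h τ hτ s).1, fun τ hτ s => (h τ hτ s).2⟩
  · rintro ⟨W, F, hW, hF, h1, h2⟩
    exact ⟨W, F, hW, hF, fun τ hτ s => ⟨h1 τ hτ s, h2 τ hτ s⟩⟩

/-- The open parameter range `0 < τ < T`. -/
def posRange (T : EReal) : Set ℝ := {τ | 0 < τ ∧ (τ : EReal) < T}

lemma posRange_subset (T : EReal) : posRange T ⊆ genRange T := fun _ h => ⟨h.1.le, h.2⟩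

lemma isOpen_posRange (T : EReal) : IsOpen (posRange T) :=
  (isOpen_lt continuous_const continuous_id).inter
    (isOpen_lt continuous_coe_real_ereal continuous_const)

lemma genRange_of_le {T : EReal} {τ σ : ℝ} (hτ : τ ∈ genRange T) (h0 : 0 ≤ σ) (h : σ ≤ τ) :
    σ ∈ genRange T := ⟨h0, lt_of_le_of_lt (EReal.coe_le_coe_iff.2 h) hτ.2⟩

lemma zero_mem_genRange {T : EReal} (hT : 0 < T) : (0 : ℝ) ∈ genRange T := ⟨le_rfl, by simpa using hT⟩

lemma SmoothOver.mono {R R' : Set ℝ} {f : Fn} (h : SmoothOver R f) (hR : R' ⊆ R) :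
    SmoothOver R' f := by
  obtain ⟨W, F, hW, hF, h1, h2⟩ := h
  exact ⟨W, F, hW, hF, fun τ hτ => h1 τ (hR hτ), fun τ hτ => h2 τ (hR hτ)⟩

lemma SmoothOver.congr {R : Set ℝ} {f g : Fn} (h : SmoothOver R f)
    (hfg : ∀ τ ∈ R, ∀ s, g τ s = f τ s) : SmoothOver R g := by
  obtain ⟨W, F, hW, hF, h1, h2⟩ := h
  exact ⟨W, F, hW, hF, h1, fun τ hτ s => (h2 τ hτ s).trans (hfg τ hτ s).symm⟩

section Algebra

variable {R : Set ℝ} {f g : Fn}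

lemma SmoothOver.of_contDiff {F : ℝ × ℂ × ℂ → ℂ} (hF : ContDiff ℝ ∞ F)
    (h : ∀ τ s, F (conePt τ s) = f τ s) : SmoothOver R f :=
  ⟨univ, F, isOpen_univ, hF.contDiffOn, fun _ _ _ => mem_univ _, fun τ _ s => h τ s⟩

lemma SmoothOver.const (R : Set ℝ) (c : ℂ) : SmoothOver R (fun _ _ => c) :=
  .of_contDiff contDiff_const fun _ _ => rfl

lemma SmoothOver.tau (R : Set ℝ) : SmoothOver R (fun τ _ => (τ : ℂ)) :=
  .of_contDiff (F := fun p => (p.1 : ℂ)) (Complex.ofRealCLM.contDiff.comp contDiff_fst)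
    fun _ _ => rfl

lemma SmoothOver.col0 (R : Set ℝ) (A : Fin 2) : SmoothOver R (fun _ s => s.1 A 0) := by
  fin_cases A
  · exact .of_contDiff (F := fun p => p.2.1) (by fun_prop) fun _ _ => rfl
  · exact .of_contDiff (F := fun p => p.2.2) (by fun_prop) fun _ _ => rfl

lemma SmoothOver.add (hf : SmoothOver R f) (hg : SmoothOver R g) :
    SmoothOver R (fun τ s => f τ s + g τ s) := by
  obtain ⟨W, F, hW, hF, h1, h2⟩ := hf
  obtain ⟨W', F', hW', hF', h1', h2'⟩ := hg
  exact ⟨W ∩ W', fun p => F p + F' p, hW.inter hW',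
    (hF.mono inter_subset_left).add (hF'.mono inter_subset_right),
    fun τ hτ s => ⟨h1 τ hτ s, h1' τ hτ s⟩, fun τ hτ s => by simp [h2 τ hτ s, h2' τ hτ s]⟩

lemma SmoothOver.mul (hf : SmoothOver R f) (hg : SmoothOver R g) :
    SmoothOver R (fun τ s => f τ s * g τ s) := by
  obtain ⟨W, F, hW, hF, h1, h2⟩ := hf
  obtain ⟨W', F', hW', hF', h1', h2'⟩ := hg
  exact ⟨W ∩ W', fun p => F p * F' p, hW.inter hW',
    (hF.mono inter_subset_left).mul (hF'.mono inter_subset_right),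
    fun τ hτ s => ⟨h1 τ hτ s, h1' τ hτ s⟩, fun τ hτ s => by simp [h2 τ hτ s, h2' τ hτ s]⟩

lemma SmoothOver.neg (hf : SmoothOver R f) : SmoothOver R (fun τ s => -f τ s) := by
  simpa using (SmoothOver.const R (-1)).mul hf

lemma SmoothOver.sub (hf : SmoothOver R f) (hg : SmoothOver R g) :
    SmoothOver R (fun τ s => f τ s - g τ s) := by
  simpa [sub_eq_add_neg] using hf.add hg.neg

lemma SmoothOver.pow (hf : SmoothOver R f) (n : ℕ) : SmoothOver R (fun τ s => f τ s ^ n) := by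
  induction n with
  | zero => simpa using SmoothOver.const R 1
  | succ n ih => simpa [pow_succ] using ih.mul hf

lemma SmoothOver.conj (hf : SmoothOver R f) : SmoothOver R (fun τ s => conj (f τ s)) := by
  obtain ⟨W, F, hW, hF, h1, h2⟩ := hf
  exact ⟨W, fun p => Complex.conjCLE (F p), hW,
    Complex.conjCLE.toContinuousLinearMap.contDiff.comp_contDiffOn hF, h1,
    fun τ hτ s => by simp [h2 τ hτ s]⟩

lemma SmoothOver.sum {ι : Type*} (I : Finset ι) {f : ι → Fn} (hf : ∀ i ∈ I, SmoothOver R (f i)) :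
    SmoothOver R (fun τ s => ∑ i ∈ I, f i τ s) := by
  classical
  induction I using Finset.induction_on with
  | empty => simpa using SmoothOver.const R 0
  | insert i I hi ih =>
    simp only [Finset.sum_insert hi]
    exact (hf i (by simp)).add (ih fun j hj => hf j (by simp [hj]))

lemma SmoothOver.col1 (R : Set ℝ) (A : Fin 2) : SmoothOver R (fun _ s => s.1 A 1) := by
  fin_cases A
  · exact ((SmoothOver.col0 R 1).conj.neg).congr fun _ _ s => SU2.entry_01 s
  · exact (SmoothOver.col0 R 0).conj.congr fun _ _ s => SU2.entry_11 s

end Algebra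

/-! ### Derivatives along left invariant vector fields -/

/-- The real linear map on `ℝ × ℂ²` that extends the vector field `s ↦ s u` on `SU(2)`, where `(p, q)`
is the first column of `u ∈ su(2)`; the component along `∂_τ` is zero. -/
def rightMul (p q : ℂ) : (ℝ × ℂ × ℂ) →L[ℝ] (ℝ × ℂ × ℂ) :=
  (0 : (ℝ × ℂ × ℂ) →L[ℝ] ℝ).prod
    ((p • (ContinuousLinearMap.fst ℝ ℂ ℂ).comp (ContinuousLinearMap.snd ℝ ℝ (ℂ × ℂ))
      - q • (Complex.conjCLE : ℂ →L[ℝ] ℂ).comp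
        ((ContinuousLinearMap.snd ℝ ℂ ℂ).comp (ContinuousLinearMap.snd ℝ ℝ (ℂ × ℂ)))).prod
     (p • (ContinuousLinearMap.snd ℝ ℂ ℂ).comp (ContinuousLinearMap.snd ℝ ℝ (ℂ × ℂ))
      + q • (Complex.conjCLE : ℂ →L[ℝ] ℂ).comp
        ((ContinuousLinearMap.fst ℝ ℂ ℂ).comp (ContinuousLinearMap.snd ℝ ℝ (ℂ × ℂ)))))

@[simp] lemma rightMul_apply (p q : ℂ) (x : ℝ × ℂ × ℂ) :
    rightMul p q x = (0, p * x.2.1 - q * conj x.2.2, p * x.2.2 + q * conj x.2.1) := rfl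

/-- A curve in `SU(2)` through the unit element whose first column has velocity `(p, q)` there. -/
structure HasVelocity (γ : ℝ → SU2) (p q : ℂ) : Prop where
  zero : γ 0 = 1
  deriv0 : HasDerivAt (fun t => (γ t).1 0 0) p 0
  deriv1 : HasDerivAt (fun t => (γ t).1 1 0) q 0

lemma hasVelocity_expH : HasVelocity expH (Complex.I / 2) 0 where
  zero := by ext i j; fin_cases i <;> fin_cases j <;> simp [expH, mkSU2]
  deriv0 := by
    have h : HasDerivAt (fun t : ℝ => Complex.exp (((t / 2 : ℝ) : ℂ) * Complex.I))
        (Complex.exp (((0 / 2 : ℝ) : ℂ) * Complex.I) * (((1 / 2 : ℝ) : ℂ) * Complex.I)) 0 :=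
      HasDerivAt.cexp ((((hasDerivAt_id (0 : ℝ)).div_const 2).ofReal_comp).mul_const _)
    refine h.congr_deriv ?_
    simp
    ring
  deriv1 := by simpa [expH, mkSU2] using hasDerivAt_const (0 : ℝ) (0 : ℂ)

lemma hasDerivAt_cos_half : HasDerivAt (fun t : ℝ => ((Real.cos (t / 2) : ℝ) : ℂ)) 0 0 := by
  have h := (((hasDerivAt_id (0 : ℝ)).div_const 2).cos).ofReal_comp
  simpa using h

lemma hasDerivAt_sin_half : HasDerivAt (fun t : ℝ => ((Real.sin (t / 2) : ℝ) : ℂ)) (1 / 2) 0 := by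
  have h := (((hasDerivAt_id (0 : ℝ)).div_const 2).sin).ofReal_comp
  simpa using h

lemma hasVelocity_expU1 : HasVelocity expU1 0 (Complex.I / 2) where
  zero := by ext i j; fin_cases i <;> fin_cases j <;> simp [expU1, mkSU2]
  deriv0 := hasDerivAt_cos_half
  deriv1 := by
    exact (hasDerivAt_sin_half.const_mul Complex.I).congr_deriv (by ring)

lemma hasVelocity_expU2 : HasVelocity expU2 0 (1 / 2) where
  zero := by ext i j; fin_cases i <;> fin_cases j <;> simp [expU2, mkSU2]
  deriv0 := hasDerivAt_cos_half
  deriv1 := hasDerivAt_sin_half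

lemma HasVelocity.hasDerivAt_conePt {γ : ℝ → SU2} {p q : ℂ} (h : HasVelocity γ p q) (τ : ℝ)
    (s : SU2) : HasDerivAt (fun t => conePt τ (s * γ t)) (rightMul p q (conePt τ s)) 0 := by
  have h0 : ∀ t, (s * γ t).1 0 0 = s.1 0 0 * (γ t).1 0 0 + s.1 0 1 * (γ t).1 1 0 := fun t => by
    simp [Matrix.mul_apply, Fin.sum_univ_two]
  have h1 : ∀ t, (s * γ t).1 1 0 = s.1 1 0 * (γ t).1 0 0 + s.1 1 1 * (γ t).1 1 0 := fun t => by
    simp [Matrix.mul_apply, Fin.sum_univ_two]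
  refine (hasDerivAt_const _ _).prodMk (HasDerivAt.prodMk ?_ ?_)
  · simp only [h0]
    refine ((h.deriv0.const_mul _).add (h.deriv1.const_mul _)).congr_deriv ?_
    rw [SU2.entry_01]
    change _ = p * s.1 0 0 - q * conj (s.1 1 0)
    ring
  · simp only [h1]
    refine ((h.deriv0.const_mul _).add (h.deriv1.const_mul _)).congr_deriv ?_
    rw [SU2.entry_11]
    change _ = p * s.1 1 0 + q * conj (s.1 0 0)
    ring

section Deriv

variable {R : Set ℝ} {f : Fn} {W : Set (ℝ × ℂ × ℂ)} {F : ℝ × ℂ × ℂ → ℂ}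

lemma Extends.hasFDerivAt (h : Extends R f W F) {x} (hx : x ∈ W) :
    HasFDerivAt F (fderiv ℝ F x) x :=
  ((h.smooth.contDiffAt (h.isOpen.mem_nhds hx)).differentiableAt (by simp)).hasFDerivAt

lemma Extends.hasDerivAt_leftInv (h : Extends R f W F) {γ : ℝ → SU2} {p q : ℂ}
    (hγ : HasVelocity γ p q) {τ : ℝ} (hτ : τ ∈ R) (s : SU2) :
    HasDerivAt (fun t => f τ (s * γ t)) (fderiv ℝ F (conePt τ s) (rightMul p q (conePt τ s))) 0 := by
  have h1 : HasFDerivAt F (fderiv ℝ F (conePt τ s)) (conePt τ (s * γ 0)) := by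
    rw [hγ.zero, mul_one]; exact h.hasFDerivAt (h.mem τ hτ s)
  have := h1.comp_hasDerivAt (0 : ℝ) (hγ.hasDerivAt_conePt τ s)
  refine this.congr_of_eventuallyEq (Eventually.of_forall fun t => ?_)
  exact (h.eq τ hτ (s * γ t)).symm

lemma Extends.leftInv_eq (h : Extends R f W F) {γ : ℝ → SU2} {p q : ℂ}
    (hγ : HasVelocity γ p q) {τ : ℝ} (hτ : τ ∈ R) (s : SU2) :
    leftInv γ (f τ) s = fderiv ℝ F (conePt τ s) (rightMul p q (conePt τ s)) :=
  (h.hasDerivAt_leftInv hγ hτ s).deriv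

lemma Extends.leftInv (h : Extends R f W F) {γ : ℝ → SU2} {p q : ℂ} (hγ : HasVelocity γ p q) :
    Extends R (fun τ => leftInv γ (f τ)) W (fun x => fderiv ℝ F x (rightMul p q x)) where
  isOpen := h.isOpen
  smooth := (h.smooth.fderiv_of_isOpen h.isOpen (by simp)).clm_apply
    (rightMul p q).contDiff.contDiffOn
  mem := h.mem
  eq τ hτ s := (h.leftInv_eq hγ hτ s).symm

lemma Extends.hasDerivAt (h : Extends R f W F) {τ : ℝ} (hτ : R ∈ 𝓝 τ) (s : SU2) :
    HasDerivAt (fun t => f t s) (fderiv ℝ F (conePt τ s) (1, 0, 0)) τ := by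
  have h1 : HasDerivAt (fun t => conePt t s) (1, 0, 0) τ :=
    (hasDerivAt_id τ).prodMk ((hasDerivAt_const _ _).prodMk (hasDerivAt_const _ _))
  have := (h.hasFDerivAt (h.mem τ (mem_of_mem_nhds hτ) s)).comp_hasDerivAt τ h1
  refine this.congr_of_eventuallyEq ?_
  filter_upwards [hτ] with t ht
  exact (h.eq t ht s).symm

lemma Extends.dτ (h : Extends R f W F) (hR : IsOpen R) :
    Extends R (dτ f) W (fun x => fderiv ℝ F x (1, 0, 0)) where
  isOpen := h.isOpen
  smooth := (h.smooth.fderiv_of_isOpen h.isOpen (by simp)).clm_apply contDiffOn_const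
  mem := h.mem
  eq τ hτ s := (h.hasDerivAt (hR.mem_nhds hτ) s).deriv.symm

end Deriv

section LeftInv

variable {R : Set ℝ} {f g : Fn} {γ : ℝ → SU2} {p q : ℂ} {τ : ℝ}

lemma SmoothOver.differentiableAt_leftInv (hf : SmoothOver R f) (hγ : HasVelocity γ p q)
    (hτ : τ ∈ R) (s : SU2) : DifferentiableAt ℝ (fun t => f τ (s * γ t)) 0 := by
  obtain ⟨W, F, h⟩ := hf
  exact (h.hasDerivAt_leftInv hγ hτ s).differentiableAt

lemma SmoothOver.leftInv (hf : SmoothOver R f) (hγ : HasVelocity γ p q) :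
    SmoothOver R (fun τ => leftInv γ (f τ)) := by
  obtain ⟨W, F, h⟩ := hf
  exact ⟨W, _, h.leftInv hγ⟩

lemma leftInv_add (hf : SmoothOver R f) (hg : SmoothOver R g) (hγ : HasVelocity γ p q)
    (hτ : τ ∈ R) (s : SU2) : leftInv γ (fun s => f τ s + g τ s) s =
      leftInv γ (f τ) s + leftInv γ (g τ) s :=
  deriv_fun_add (hf.differentiableAt_leftInv hγ hτ s) (hg.differentiableAt_leftInv hγ hτ s)

lemma leftInv_mul (hf : SmoothOver R f) (hg : SmoothOver R g) (hγ : HasVelocity γ p q)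
    (hτ : τ ∈ R) (s : SU2) : leftInv γ (fun s => f τ s * g τ s) s =
      leftInv γ (f τ) s * g τ s + f τ s * leftInv γ (g τ) s := by
  have := deriv_fun_mul (hf.differentiableAt_leftInv hγ hτ s)
    (hg.differentiableAt_leftInv hγ hτ s)
  simpa [leftInv, hγ.zero] using this

lemma leftInv_const_mul (γ : ℝ → SU2) (c : ℂ) (f : SU2 → ℂ) (s : SU2) :
    leftInv γ (fun s => c * f s) s = c * leftInv γ f s :=
  deriv_const_mul_field _

lemma leftInv_conj (γ : ℝ → SU2) (f : SU2 → ℂ) (s : SU2) :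
    leftInv γ (fun s => conj (f s)) s = conj (leftInv γ f s) := by
  have := deriv.star (𝕜 := ℝ) (f := fun t => f (s * γ t)) (x := 0)
  simpa [leftInv] using this

lemma Xp_congr (h : ∀ s, f τ s = g τ s) (s : SU2) : Xp f τ s = Xp g τ s := by
  simp only [Xp, show f τ = g τ from funext h]

lemma Xm_congr (h : ∀ s, f τ s = g τ s) (s : SU2) : Xm f τ s = Xm g τ s := by
  simp only [Xm, show f τ = g τ from funext h]

lemma Xp_const_mul (a : ℝ → ℂ) (f : Fn) (τ : ℝ) (s : SU2) :
    Xp (fun τ s => a τ * f τ s) τ s = a τ * Xp f τ s := by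
  simp only [Xp, Zp, leftInv_const_mul]; ring

lemma Xm_const_mul (a : ℝ → ℂ) (f : Fn) (τ : ℝ) (s : SU2) :
    Xm (fun τ s => a τ * f τ s) τ s = a τ * Xm f τ s := by
  simp only [Xm, Zm, leftInv_const_mul]; ring

lemma Xp_fn_tau (a : ℝ → ℂ) (τ : ℝ) (s : SU2) : Xp (fun τ _ => a τ) τ s = 0 := by
  simp [Xp, Zp, ConformalCone.leftInv]

lemma Xm_fn_tau (a : ℝ → ℂ) (τ : ℝ) (s : SU2) : Xm (fun τ _ => a τ) τ s = 0 := by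
  simp [Xm, Zm, ConformalCone.leftInv]

lemma Xp_add (hf : SmoothOver R f) (hg : SmoothOver R g) (hτ : τ ∈ R) (s : SU2) :
    Xp (fun τ s => f τ s + g τ s) τ s = Xp f τ s + Xp g τ s := by
  simp only [Xp, Zp, leftInv_add hf hg hasVelocity_expU1 hτ,
    leftInv_add hf hg hasVelocity_expU2 hτ]; ring

lemma Xm_add (hf : SmoothOver R f) (hg : SmoothOver R g) (hτ : τ ∈ R) (s : SU2) :
    Xm (fun τ s => f τ s + g τ s) τ s = Xm f τ s + Xm g τ s := by
  simp only [Xm, Zm, leftInv_add hf hg hasVelocity_expU1 hτ,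
    leftInv_add hf hg hasVelocity_expU2 hτ]; ring

lemma Xm_mul (hf : SmoothOver R f) (hg : SmoothOver R g) (hτ : τ ∈ R) (s : SU2) :
    Xm (fun τ s => f τ s * g τ s) τ s = Xm f τ s * g τ s + f τ s * Xm g τ s := by
  simp only [Xm, Zm, leftInv_mul hf hg hasVelocity_expU1 hτ,
    leftInv_mul hf hg hasVelocity_expU2 hτ]; ring

lemma Xp_conj (f : Fn) (τ : ℝ) (s : SU2) :
    Xp (fun τ s => conj (f τ s)) τ s = conj (Xm f τ s) := by
  simp only [Xp, Zp, Xm, Zm, leftInv_conj, map_neg, map_sub, map_mul, Complex.conj_I]; ring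

lemma Xm_conj (f : Fn) (τ : ℝ) (s : SU2) :
    Xm (fun τ s => conj (f τ s)) τ s = conj (Xp f τ s) := by
  simp only [Xp, Zp, Xm, Zm, leftInv_conj, map_neg, map_add, map_mul, Complex.conj_I]; ring

lemma SmoothOver.Xp (hf : SmoothOver R f) : SmoothOver R (Xp f) :=
  ((hf.leftInv hasVelocity_expU2).add
    ((SmoothOver.const R Complex.I).mul (hf.leftInv hasVelocity_expU1))).neg

lemma SmoothOver.Xm (hf : SmoothOver R f) : SmoothOver R (Xm f) :=
  ((hf.leftInv hasVelocity_expU2).sub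
    ((SmoothOver.const R Complex.I).mul (hf.leftInv hasVelocity_expU1))).neg

lemma SmoothOver.dτ (hf : SmoothOver R f) (hR : IsOpen R) : SmoothOver R (dτ f) := by
  obtain ⟨W, F, h⟩ := hf
  exact ⟨W, _, h.dτ hR⟩

lemma SmoothOver.hasDerivAt (hf : SmoothOver R f) (hR : R ∈ 𝓝 τ) (s : SU2) :
    HasDerivAt (fun t => f t s) (ConformalCone.dτ f τ s) τ := by
  obtain ⟨W, F, h⟩ := hf
  exact (h.hasDerivAt hR s).differentiableAt.hasDerivAt

lemma SmoothOver.continuousOn (hf : SmoothOver R f) (s : SU2) :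
    ContinuousOn (fun t => f t s) R := by
  obtain ⟨W, F, h⟩ := hf
  have h1 : ContinuousOn (fun t => F (conePt t s)) R :=
    h.smooth.continuousOn.comp (by unfold conePt; fun_prop) fun t ht => h.mem t ht s
  exact h1.congr fun t ht => (h.eq t ht s).symm

end LeftInv

/-! ### Commutators -/

section Commutators

variable {R : Set ℝ} {f : Fn} {τ : ℝ}

lemma Extends.fderiv_fderiv_symm {W : Set (ℝ × ℂ × ℂ)} {F : ℝ × ℂ × ℂ → ℂ}
    (h : Extends R f W F) {x : ℝ × ℂ × ℂ} (hx : x ∈ W) (u v : ℝ × ℂ × ℂ) :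
    fderiv ℝ (fderiv ℝ F) x u v = fderiv ℝ (fderiv ℝ F) x v u := by
  have h1 : ContDiffAt ℝ ∞ F x := h.smooth.contDiffAt (h.isOpen.mem_nhds hx)
  exact h1.isSymmSndFDerivAt (by simpa using (WithTop.coe_le_coe.2 (le_top : (2 : ℕ∞) ≤ ⊤))) u v

lemma Extends.fderiv_apply_linear {W : Set (ℝ × ℂ × ℂ)} {F : ℝ × ℂ × ℂ → ℂ}
    (h : Extends R f W F) {x : ℝ × ℂ × ℂ} (hx : x ∈ W)
    (V : (ℝ × ℂ × ℂ) →L[ℝ] (ℝ × ℂ × ℂ)) (u : ℝ × ℂ × ℂ) :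
    fderiv ℝ (fun y => fderiv ℝ F y (V y)) x u =
      fderiv ℝ (fderiv ℝ F) x u (V x) + fderiv ℝ F x (V u) := by
  have h1 : DifferentiableAt ℝ (fderiv ℝ F) x :=
    ((h.smooth.fderiv_of_isOpen h.isOpen (m := ∞) (by simp)).contDiffAt
      (h.isOpen.mem_nhds hx)).differentiableAt (by simp)
  rw [fderiv_clm_apply h1 V.differentiableAt]
  simp [add_comm]

lemma Extends.fderiv_apply_const {W : Set (ℝ × ℂ × ℂ)} {F : ℝ × ℂ × ℂ → ℂ}
    (h : Extends R f W F) {x : ℝ × ℂ × ℂ} (hx : x ∈ W) (v u : ℝ × ℂ × ℂ) :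
    fderiv ℝ (fun y => fderiv ℝ F y v) x u = fderiv ℝ (fderiv ℝ F) x u v := by
  have h1 : DifferentiableAt ℝ (fderiv ℝ F) x :=
    ((h.smooth.fderiv_of_isOpen h.isOpen (m := ∞) (by simp)).contDiffAt
      (h.isOpen.mem_nhds hx)).differentiableAt (by simp)
  rw [fderiv_clm_apply h1 (differentiableAt_const v)]
  simp

/-- Left invariant vector fields commute with `∂_τ`. -/
lemma leftInv_dτ (hf : SmoothOver R f) (hR : IsOpen R) {γ : ℝ → SU2} {p q : ℂ}
    (hγ : HasVelocity γ p q) (hτ : τ ∈ R) (s : SU2) :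
    leftInv γ (dτ f τ) s = dτ (fun τ => leftInv γ (f τ)) τ s := by
  obtain ⟨W, F, h⟩ := hf
  have hx := h.mem τ hτ s
  rw [(h.dτ hR).leftInv_eq hγ hτ s, ← ((h.leftInv hγ).dτ hR).eq τ hτ s,
    h.fderiv_apply_const hx, h.fderiv_apply_linear hx, h.fderiv_fderiv_symm hx]
  have h0 : rightMul p q (1, 0, 0) = 0 := by simp [Prod.ext_iff]
  rw [h0, map_zero, add_zero]

lemma Xp_dτ (hf : SmoothOver R f) (hR : IsOpen R) (hτ : τ ∈ R) (s : SU2) :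
    Xp (dτ f) τ s = dτ (Xp f) τ s := by
  have h1 := (hf.leftInv hasVelocity_expU1).hasDerivAt (hR.mem_nhds hτ) s
  have h2 := (hf.leftInv hasVelocity_expU2).hasDerivAt (hR.mem_nhds hτ) s
  have h3 := ((h2.add (h1.const_mul Complex.I)).neg).deriv
  rw [← leftInv_dτ hf hR hasVelocity_expU1 hτ, ← leftInv_dτ hf hR hasVelocity_expU2 hτ] at h3
  exact h3.symm

lemma Xm_dτ (hf : SmoothOver R f) (hR : IsOpen R) (hτ : τ ∈ R) (s : SU2) :
    Xm (dτ f) τ s = dτ (Xm f) τ s := by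
  have h1 := (hf.leftInv hasVelocity_expU1).hasDerivAt (hR.mem_nhds hτ) s
  have h2 := (hf.leftInv hasVelocity_expU2).hasDerivAt (hR.mem_nhds hτ) s
  have h3 := ((h2.sub (h1.const_mul Complex.I)).neg).deriv
  rw [← leftInv_dτ hf hR hasVelocity_expU1 hτ, ← leftInv_dτ hf hR hasVelocity_expU2 hτ] at h3
  exact h3.symm

/-- The commutation relation `[Z_{u₁}, Z_{u₂}] = Z_h`. -/
lemma leftInv_commutator (hf : SmoothOver R f) (hτ : τ ∈ R) (s : SU2) :
    leftInv expU1 (leftInv expU2 (f τ)) s - leftInv expU2 (leftInv expU1 (f τ)) s =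
      leftInv expH (f τ) s := by
  obtain ⟨W, F, h⟩ := hf
  have hx := h.mem τ hτ s
  rw [(h.leftInv hasVelocity_expU2).leftInv_eq hasVelocity_expU1 hτ s,
    (h.leftInv hasVelocity_expU1).leftInv_eq hasVelocity_expU2 hτ s,
    h.leftInv_eq hasVelocity_expH hτ s,
    h.fderiv_apply_linear hx, h.fderiv_apply_linear hx, h.fderiv_fderiv_symm hx,
    add_sub_add_left_eq_sub, ← map_sub]
  congr 1
  ext <;> simp [map_ofNat] <;> ring

/-- The commutation relation `[X₊, X₋] = -S`. -/
lemma Xp_Xm_commutator (hf : SmoothOver R f) (hτ : τ ∈ R) (s : SU2) :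
    Xp (Xm f) τ s - Xm (Xp f) τ s = -Svert f τ s := by
  have e1 := hf.leftInv hasVelocity_expU1
  have e2 := hf.leftInv hasVelocity_expU2
  have hm : Xm f = fun τ s => (-1) * leftInv expU2 (f τ) s + Complex.I * leftInv expU1 (f τ) s := by
    funext τ s; simp only [Xm, Zm]; ring
  have hp : Xp f = fun τ s => (-1) * leftInv expU2 (f τ) s + (-Complex.I) * leftInv expU1 (f τ) s := by
    funext τ s; simp only [Xp, Zp]; ring
  have c1 := SmoothOver.const R (-1)
  have c2 := SmoothOver.const R Complex.I
  have c3 := SmoothOver.const R (-Complex.I)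
  rw [hm, hp, Xp_add (c1.mul e2) (c2.mul e1) hτ, Xm_add (c1.mul e2) (c3.mul e1) hτ]
  simp only [Xp, Xm, Zp, Zm, leftInv_const_mul, Svert]
  linear_combination (2 * Complex.I) * leftInv_commutator hf hτ s

end Commutators

/-! ### Singular transport equations along the null generators -/

/-- The equation `τ ∂_τ u + (m + 1) u = g`, i.e. `∂_τ (τ^{m+1} u) = τ^m g`, for `0 < τ < T`. -/
def RadialODE (T : EReal) (m : ℕ) (u g : Fn) : Prop :=
  ∀ τ ∈ posRange T, ∀ s, (τ : ℂ) * dτ u τ s + ((m : ℂ) + 1) * u τ s = g τ s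

/-- The solution `∫₀¹ t^m g(t τ, s) dt` of `τ ∂_τ u + (m + 1) u = g` that is regular at `τ = 0`. -/
def radialMean (m : ℕ) (g : Fn) : Fn := fun τ s => ∫ t in (0 : ℝ)..1, (t : ℂ) ^ m * g (t * τ) s

section Radial

variable {T : EReal} {m : ℕ} {u v g g' : Fn} {τ : ℝ}

lemma hasDerivAt_tau : HasDerivAt (fun t : ℝ => (t : ℂ)) 1 τ := (hasDerivAt_id τ).ofReal_comp

lemma hasDerivAt_tau_pow_succ (m : ℕ) (τ : ℝ) :
    HasDerivAt (fun t : ℝ => (t : ℂ) ^ (m + 1)) (((m : ℂ) + 1) * (τ : ℂ) ^ m) τ :=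
  (hasDerivAt_tau.pow (m + 1)).congr_deriv (by simp)

lemma mem_posRange_nhds (hτ : τ ∈ posRange T) : posRange T ∈ 𝓝 τ :=
  (isOpen_posRange T).mem_nhds hτ

lemma posRange_of_mem_Ioc (hτ : τ ∈ genRange T) {σ : ℝ} (hσ : σ ∈ Ioc 0 τ) : σ ∈ posRange T :=
  ⟨hσ.1, (genRange_of_le hτ hσ.1.le hσ.2).2⟩

lemma Icc_subset_genRange (hτ : τ ∈ genRange T) : Icc 0 τ ⊆ genRange T :=
  fun _ h => genRange_of_le hτ h.1 h.2

lemma SmoothOver.radialMean (hg : SmoothOver (genRange T) g) (m : ℕ) :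
    SmoothOver (genRange T) (radialMean m g) := by
  obtain ⟨W, F, h⟩ := hg
  set σ : (ℝ × ℂ × ℂ) × ℝ → ℝ × ℂ × ℂ := fun p => (p.2 * p.1.1, p.1.2) with hσ
  have hσd : ContDiff ℝ ∞ σ := by
    have h1 : ContDiff ℝ ∞ (fun p : (ℝ × ℂ × ℂ) × ℝ => p.2 * p.1.1) := by fun_prop
    exact h1.prodMk (by fun_prop)
  have hV : IsOpen (σ ⁻¹' W) := h.isOpen.preimage hσd.continuous
  have hφ : ContDiffOn ℝ ∞ (fun p : (ℝ × ℂ × ℂ) × ℝ => (p.2 : ℂ) ^ m * F (σ p)) (σ ⁻¹' W) := by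
    refine ContDiffOn.mul ?_ (h.smooth.comp hσd.contDiffOn (fun p hp => hp))
    exact ((Complex.ofRealCLM.contDiff.comp contDiff_snd).pow m).contDiffOn
  refine ⟨tubeCore (σ ⁻¹' W), _, isOpen_tubeCore hV, contDiffOn_integral_tubeCore hV hφ, ?_, ?_⟩
  · intro τ hτ s t ht
    exact h.mem _ (genRange_of_le hτ (mul_nonneg ht.1 hτ.1)
      (mul_le_of_le_one_left hτ.1 ht.2)) s
  · intro τ hτ s
    refine intervalIntegral.integral_congr fun t ht => ?_
    rw [uIcc_of_le zero_le_one] at ht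
    exact congrArg (fun z => (t : ℂ) ^ m * z) (h.eq _ (genRange_of_le hτ (mul_nonneg ht.1 hτ.1)
      (mul_le_of_le_one_left hτ.1 ht.2)) s)

lemma radialMean_zero (m : ℕ) (g : Fn) (s : SU2) : radialMean m g 0 s = g 0 s / (m + 1) := by
  have h : ∫ t in (0 : ℝ)..1, (t : ℂ) ^ m = 1 / (m + 1) := by
    have := integral_pow (a := 0) (b := 1) m
    have h2 := congrArg (fun x : ℝ => (x : ℂ)) this
    simp only [← intervalIntegral.integral_ofReal] at h2
    push_cast at h2
    simpa using h2
  simp only [radialMean, mul_zero]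
  rw [intervalIntegral.integral_mul_const, h]
  ring

lemma pow_mul_radialMean (m : ℕ) (g : Fn) (τ : ℝ) (s : SU2) :
    (τ : ℂ) ^ (m + 1) * radialMean m g τ s = ∫ t in (0 : ℝ)..τ, (t : ℂ) ^ m * g t s := by
  have h := intervalIntegral.smul_integral_comp_mul_right
    (f := fun t : ℝ => (t : ℂ) ^ m * g t s) (a := 0) (b := 1) τ
  rw [zero_mul, one_mul] at h
  rw [← h, radialMean, ← intervalIntegral.integral_const_mul, ← intervalIntegral.integral_smul]
  refine intervalIntegral.integral_congr fun t _ => ?_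
  simp
  ring

lemma RadialODE.hasDerivAt (h : RadialODE T m u g) (hu : SmoothOver (genRange T) u)
    (hτ : τ ∈ posRange T) (s : SU2) :
    HasDerivAt (fun t : ℝ => (t : ℂ) ^ (m + 1) * u t s) ((τ : ℂ) ^ m * g τ s) τ := by
  have h1 := (hu.mono (posRange_subset T)).hasDerivAt (mem_posRange_nhds hτ) s
  have h2 := hasDerivAt_tau_pow_succ m τ
  refine (h2.mul h1).congr_deriv ?_
  rw [← h τ hτ s]
  ring

lemma SmoothOver.continuousOn_pow_mul (hg : SmoothOver (genRange T) g) (m : ℕ)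
    (hτ : τ ∈ genRange T) (s : SU2) :
    ContinuousOn (fun t : ℝ => (t : ℂ) ^ m * g t s) (Icc 0 τ) :=
  ContinuousOn.mul (by fun_prop) ((hg.continuousOn s).mono (Icc_subset_genRange hτ))

/-- A regular solution of `∂_τ (τ^{m+1} u) = τ^m g` is determined by `g`. -/
lemma RadialODE.integral_eq (h : RadialODE T m u g) (hu : SmoothOver (genRange T) u)
    (hg : SmoothOver (genRange T) g) (hτ : τ ∈ genRange T) (s : SU2) :
    (τ : ℂ) ^ (m + 1) * u τ s = ∫ t in (0 : ℝ)..τ, (t : ℂ) ^ m * g t s := by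
  have h1 := intervalIntegral.integral_eq_sub_of_hasDerivAt_of_le hτ.1
    (hu.continuousOn_pow_mul (m + 1) hτ s)
    (fun t ht => h.hasDerivAt hu (posRange_of_mem_Ioc hτ ⟨ht.1, ht.2.le⟩) s)
    (ContinuousOn.intervalIntegrable
      (by rw [uIcc_of_le hτ.1]; exact hg.continuousOn_pow_mul m hτ s))
  rw [h1]
  simp

/-- Two smooth functions on `[0, T) × SU(2)` that agree for `τ > 0` agree. -/
lemma eqOnCone_of_pos (hT : 0 < T) (hu : SmoothOver (genRange T) u)
    (hv : SmoothOver (genRange T) v) (h : ∀ τ ∈ posRange T, ∀ s, u τ s = v τ s) :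
    EqOnCone T u v := by
  intro τ hτ s
  rcases hτ.1.eq_or_lt with h0 | h0
  · obtain ⟨ε, hε0, hεT⟩ : ∃ ε : ℝ, 0 < ε ∧ (ε : EReal) < T := by
      obtain ⟨x, hx0, hx1⟩ := EReal.exists_rat_btwn_of_lt hT
      exact ⟨x, by exact_mod_cast hx0, hx1⟩
    have hεm : ε ∈ genRange T := ⟨hε0.le, hεT⟩
    have hsub : Ioc 0 ε ⊆ genRange T := fun t ht => genRange_of_le hεm ht.1.le ht.2
    have hmem : (0 : ℝ) ∈ closure (Ioc 0 ε) := by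
      rw [closure_Ioc hε0.ne]; exact ⟨le_rfl, hε0.le⟩
    have hne : (𝓝[Ioc 0 ε] (0 : ℝ)).NeBot := mem_closure_iff_nhdsWithin_neBot.1 hmem
    have hu1 := ((hu.continuousOn s) 0 (zero_mem_genRange hT)).mono hsub
    have hv1 := ((hv.continuousOn s) 0 (zero_mem_genRange hT)).mono hsub
    rw [← h0]
    refine tendsto_nhds_unique hu1.tendsto (hv1.tendsto.congr' ?_)
    filter_upwards [self_mem_nhdsWithin] with t ht
    exact (h t (posRange_of_mem_Ioc hεm ht) s).symm
  · exact h τ ⟨h0, hτ.2⟩ s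

lemma RadialODE.eq_radialMean (hT : 0 < T) (h : RadialODE T m u g)
    (hu : SmoothOver (genRange T) u) (hg : SmoothOver (genRange T) g) :
    EqOnCone T u (radialMean m g) := by
  refine eqOnCone_of_pos hT hu (hg.radialMean m) fun τ hτ s => ?_
  have h1 := h.integral_eq hu hg (posRange_subset T hτ) s
  rw [← pow_mul_radialMean] at h1
  exact mul_left_cancel₀ (pow_ne_zero _ (by exact_mod_cast hτ.1.ne')) h1

lemma radialODE_radialMean (hg : SmoothOver (genRange T) g) (m : ℕ) :
    RadialODE T m (radialMean m g) g := by
  intro τ hτ s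
  have hτ0 : (τ : ℂ) ≠ 0 := by exact_mod_cast hτ.1.ne'
  have h1 := ((hg.radialMean m).mono (posRange_subset T)).hasDerivAt (mem_posRange_nhds hτ) s
  have h2 := hasDerivAt_tau_pow_succ m τ
  have h3 := h2.mul h1
  have hc : ContinuousOn (fun t : ℝ => (t : ℂ) ^ m * g t s) (posRange T) :=
    ContinuousOn.mul (by fun_prop) ((hg.continuousOn s).mono (posRange_subset T))
  have h4 : HasDerivAt (fun x : ℝ => ∫ t in (0 : ℝ)..x, (t : ℂ) ^ m * g t s)
      ((τ : ℂ) ^ m * g τ s) τ := by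
    refine intervalIntegral.integral_hasDerivAt_right ?_ ?_ (hc.continuousAt (mem_posRange_nhds hτ))
    · refine ContinuousOn.intervalIntegrable ?_
      rw [uIcc_of_le hτ.1.le]
      exact hg.continuousOn_pow_mul m (posRange_subset T hτ) s
    · exact hc.stronglyMeasurableAtFilter (isOpen_posRange T) τ hτ
  have h5 := h3.unique (h4.congr_of_eventuallyEq
    (Eventually.of_forall fun t => pow_mul_radialMean m g t s))
  refine mul_left_cancel₀ (pow_ne_zero m hτ0) ?_
  rw [← h5]
  ring

lemma RadialODE.eqOnCone (hT : 0 < T) (h : RadialODE T m u g) (h' : RadialODE T m v g')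
    (hu : SmoothOver (genRange T) u) (hv : SmoothOver (genRange T) v)
    (hg : SmoothOver (genRange T) g) (hgg : EqOnCone T g g') : EqOnCone T u v := by
  have h'' : RadialODE T m v g := fun τ hτ s =>
    (h' τ hτ s).trans (hgg τ (posRange_subset T hτ) s).symm
  intro τ hτ s
  rw [h.eq_radialMean hT hu hg τ hτ s, h''.eq_radialMean hT hv hg τ hτ s]

lemma RadialODE.eq_zero (hT : 0 < T) (h : RadialODE T m u fun _ _ => 0)
    (hu : SmoothOver (genRange T) u) : ∀ τ ∈ genRange T, ∀ s, u τ s = 0 := by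
  intro τ hτ s
  rw [h.eq_radialMean hT hu (SmoothOver.const _ 0) τ hτ s]
  simp [radialMean]

lemma eq_vertex_of_dτ_eq_zero (hu : SmoothOver (genRange T) u)
    (h : ∀ τ ∈ posRange T, ∀ s, dτ u τ s = 0) : ∀ τ ∈ genRange T, ∀ s, u τ s = u 0 s := by
  intro τ hτ s
  have h1 := intervalIntegral.integral_eq_sub_of_hasDerivAt_of_le (f' := fun _ => (0 : ℂ)) hτ.1
    ((hu.continuousOn s).mono (Icc_subset_genRange hτ))
    (fun t ht => by
      have ht' := posRange_of_mem_Ioc hτ ⟨ht.1, ht.2.le⟩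
      rw [← h t ht' s]
      exact (hu.mono (posRange_subset T)).hasDerivAt (mem_posRange_nhds ht') s)
    intervalIntegrable_const
  rw [intervalIntegral.integral_zero] at h1
  exact sub_eq_zero.1 h1.symm

lemma RadialODE.Xm (h : RadialODE T m u g) (hu : SmoothOver (genRange T) u) :
    RadialODE T m (Xm u) (Xm g) := by
  intro τ hτ s
  have hu' := hu.mono (posRange_subset T)
  have h1 := Xm_add (f := fun τ s => (τ : ℂ) * dτ u τ s) (g := fun τ s => ((m : ℂ) + 1) * u τ s)
    ((SmoothOver.tau _).mul (hu'.dτ (isOpen_posRange T))) ((SmoothOver.const _ _).mul hu') hτ s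
  rw [Xm_congr (fun s => h τ hτ s), Xm_const_mul (fun τ => (τ : ℂ)),
    Xm_const_mul (fun _ => ((m : ℂ) + 1)), Xm_dτ hu' (isOpen_posRange T) hτ] at h1
  exact h1.symm

lemma dτ_conj (hu : SmoothOver (genRange T) u) (hτ : τ ∈ posRange T) (s : SU2) :
    dτ (fun τ s => conj (u τ s)) τ s = conj (dτ u τ s) := by
  have h1 := (hu.mono (posRange_subset T)).hasDerivAt (mem_posRange_nhds hτ) s
  exact (Complex.conjCLE.toContinuousLinearMap.hasFDerivAt.comp_hasDerivAt τ h1).deriv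

lemma RadialODE.conj (h : RadialODE T m u g) (hu : SmoothOver (genRange T) u) :
    RadialODE T m (fun τ s => conj (u τ s)) (fun τ s => conj (g τ s)) := by
  intro τ hτ s
  have h1 := congrArg (starRingEnd ℂ) (h τ hτ s)
  rw [dτ_conj hu hτ]
  simpa using h1

lemma RadialODE.Xp (h : RadialODE T m u g) (hu : SmoothOver (genRange T) u) :
    RadialODE T m (Xp u) (Xp g) := by
  have h1 := ((h.conj hu).Xm hu.conj).conj hu.conj.Xm
  simpa only [Xm_conj, Complex.conj_conj] using h1

end Radial

/-! ### The hierarchy of radial equations -/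

/-- The hierarchy to which the transport equations reduce: `ψ₀, …, ψ₄` stand for the components
`ψ_{0000}, ψ_{0001}, …, ψ_{1111}`, and `P`, `q`, `γ`, `Q` for `Φ_{001'1'}`, `Φ_{011'1'}`, `Γ_{10'11}` and
`Φ_{111'1'}`. The factor `2` is `Π_*`. Given `ψ₀`, the right hand sides involve only unknowns that are
determined by earlier equations, in the order `P, γ, ψ₁, ψ₂, ψ₃, ψ₄, q, Q`. -/
structure RadialSystem (T : EReal) (ψ₀ ψ₁ ψ₂ ψ₃ ψ₄ P q γ Q : Fn) : Prop where
  smooth_ψ₀ : SmoothOver (genRange T) ψ₀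
  smooth_ψ₁ : SmoothOver (genRange T) ψ₁
  smooth_ψ₂ : SmoothOver (genRange T) ψ₂
  smooth_ψ₃ : SmoothOver (genRange T) ψ₃
  smooth_ψ₄ : SmoothOver (genRange T) ψ₄
  smooth_P : SmoothOver (genRange T) P
  smooth_q : SmoothOver (genRange T) q
  smooth_γ : SmoothOver (genRange T) γ
  smooth_Q : SmoothOver (genRange T) Q
  ode_P : RadialODE T 0 P fun τ s => -2 * (τ : ℂ) ^ 2 * ψ₀ τ s
  ode_γ : RadialODE T 0 γ fun τ s => τ * conj (P τ s)
  ode_ψ₁ : RadialODE T 3 ψ₁ fun τ s => -Xm ψ₀ τ s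
  ode_ψ₂ : RadialODE T 2 ψ₂ fun τ s => -Xm ψ₁ τ s - τ * γ τ s * ψ₀ τ s
  ode_ψ₃ : RadialODE T 1 ψ₃ fun τ s => -Xm ψ₂ τ s - 2 * (τ * γ τ s * ψ₁ τ s)
  ode_ψ₄ : RadialODE T 0 ψ₄ fun τ s => -Xm ψ₃ τ s - 3 * (τ * γ τ s * ψ₂ τ s)
  ode_q : RadialODE T 0 q fun τ s => -2 * (τ : ℂ) ^ 2 * ψ₁ τ s
  ode_Q : RadialODE T 0 Q fun τ s =>
    -Xp (fun τ s => conj (q τ s)) τ s - τ * conj (γ τ s) * conj (P τ s) - 2 * (τ : ℂ) ^ 2 * ψ₂ τ s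

section

variable {T : EReal} {R : Set ℝ}

lemma SmoothOver.rhs_tau_sq {f : Fn} (hf : SmoothOver R f) :
    SmoothOver R (fun τ s => -2 * (τ : ℂ) ^ 2 * f τ s) :=
  ((SmoothOver.const R (-2)).mul ((SmoothOver.tau R).pow 2)).mul hf

lemma smooth_rhs_ψ {f g h : Fn} (hf : SmoothOver R f) (hg : SmoothOver R g)
    (hh : SmoothOver R h) (c : ℂ) :
    SmoothOver R (fun τ s => -Xm f τ s - c * (τ * g τ s * h τ s)) :=
  hf.Xm.neg.sub ((SmoothOver.const R c).mul (((SmoothOver.tau R).mul hg).mul hh))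

lemma smooth_rhs_Q {q γ P ψ : Fn} (hq : SmoothOver R q) (hγ : SmoothOver R γ)
    (hP : SmoothOver R P) (hψ : SmoothOver R ψ) :
    SmoothOver R (fun τ s => -Xp (fun τ s => conj (q τ s)) τ s
      - τ * conj (γ τ s) * conj (P τ s) - 2 * (τ : ℂ) ^ 2 * ψ τ s) :=
  (hq.conj.Xp.neg.sub (((SmoothOver.tau R).mul hγ.conj).mul hP.conj)).sub
    (((SmoothOver.const R 2).mul ((SmoothOver.tau R).pow 2)).mul hψ)

lemma exists_radialSystem {ψ₀ : Fn} (h₀ : SmoothOver (genRange T) ψ₀) :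
    ∃ ψ₁ ψ₂ ψ₃ ψ₄ P q γ Q, RadialSystem T ψ₀ ψ₁ ψ₂ ψ₃ ψ₄ P q γ Q := by
  have solve : ∀ (m : ℕ) {g : Fn}, SmoothOver (genRange T) g →
      ∃ u, SmoothOver (genRange T) u ∧ RadialODE T m u g := fun m g hg =>
    ⟨radialMean m g, hg.radialMean m, radialODE_radialMean hg m⟩
  obtain ⟨P, hP, oP⟩ := solve 0 h₀.rhs_tau_sq
  obtain ⟨γ, hγ, oγ⟩ := solve 0 ((SmoothOver.tau _).mul hP.conj)
  obtain ⟨ψ₁, h₁, o₁⟩ := solve 3 h₀.Xm.neg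
  obtain ⟨ψ₂, h₂, o₂⟩ := solve 2 (smooth_rhs_ψ h₁ hγ h₀ 1)
  obtain ⟨ψ₃, h₃, o₃⟩ := solve 1 (smooth_rhs_ψ h₂ hγ h₁ 2)
  obtain ⟨ψ₄, h₄, o₄⟩ := solve 0 (smooth_rhs_ψ h₃ hγ h₂ 3)
  obtain ⟨q, hq, oq⟩ := solve 0 h₁.rhs_tau_sq
  obtain ⟨Q, hQ, oQ⟩ := solve 0 (smooth_rhs_Q hq hγ hP h₂)
  simp only [one_mul] at o₂
  exact ⟨ψ₁, ψ₂, ψ₃, ψ₄, P, q, γ, Q, h₀, h₁, h₂, h₃, h₄, hP, hq, hγ, hQ, oP, oγ, o₁, o₂, o₃, o₄, oq, oQ⟩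

namespace RadialSystem

variable {ψ₀ ψ₁ ψ₂ ψ₃ ψ₄ P q γ Q : Fn}

/-- Uniqueness for the hierarchy: each unknown is the regular solution of its radial equation, whose
right hand side is already known. -/
lemma unique (hT : 0 < T) {ψ₀' ψ₁' ψ₂' ψ₃' ψ₄' P' q' γ' Q' : Fn}
    (h : RadialSystem T ψ₀ ψ₁ ψ₂ ψ₃ ψ₄ P q γ Q)
    (h' : RadialSystem T ψ₀' ψ₁' ψ₂' ψ₃' ψ₄' P' q' γ' Q') (e₀ : EqOnCone T ψ₀ ψ₀') :
    EqOnCone T ψ₁ ψ₁' ∧ EqOnCone T ψ₂ ψ₂' ∧ EqOnCone T ψ₃ ψ₃' ∧ EqOnCone T ψ₄ ψ₄' ∧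
      EqOnCone T P P' ∧ EqOnCone T q q' ∧ EqOnCone T γ γ' ∧ EqOnCone T Q Q' := by
  have eP : EqOnCone T P P' := h.ode_P.eqOnCone hT h'.ode_P h.smooth_P h'.smooth_P
    h.smooth_ψ₀.rhs_tau_sq fun τ hτ s => by rw [e₀ τ hτ s]
  have eγ : EqOnCone T γ γ' := h.ode_γ.eqOnCone hT h'.ode_γ h.smooth_γ h'.smooth_γ
    ((SmoothOver.tau _).mul h.smooth_P.conj) fun τ hτ s => by rw [eP τ hτ s]
  have e₁ : EqOnCone T ψ₁ ψ₁' := h.ode_ψ₁.eqOnCone hT h'.ode_ψ₁ h.smooth_ψ₁ h'.smooth_ψ₁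
    h.smooth_ψ₀.Xm.neg fun τ hτ s => by rw [Xm_congr (e₀ τ hτ)]
  have e₂ : EqOnCone T ψ₂ ψ₂' := h.ode_ψ₂.eqOnCone hT h'.ode_ψ₂ h.smooth_ψ₂ h'.smooth_ψ₂
    (by simpa using smooth_rhs_ψ h.smooth_ψ₁ h.smooth_γ h.smooth_ψ₀ 1)
    fun τ hτ s => by rw [Xm_congr (e₁ τ hτ), eγ τ hτ s, e₀ τ hτ s]
  have e₃ : EqOnCone T ψ₃ ψ₃' := h.ode_ψ₃.eqOnCone hT h'.ode_ψ₃ h.smooth_ψ₃ h'.smooth_ψ₃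
    (smooth_rhs_ψ h.smooth_ψ₂ h.smooth_γ h.smooth_ψ₁ 2)
    fun τ hτ s => by rw [Xm_congr (e₂ τ hτ), eγ τ hτ s, e₁ τ hτ s]
  have e₄ : EqOnCone T ψ₄ ψ₄' := h.ode_ψ₄.eqOnCone hT h'.ode_ψ₄ h.smooth_ψ₄ h'.smooth_ψ₄
    (smooth_rhs_ψ h.smooth_ψ₃ h.smooth_γ h.smooth_ψ₂ 3)
    fun τ hτ s => by rw [Xm_congr (e₃ τ hτ), eγ τ hτ s, e₂ τ hτ s]
  have eq : EqOnCone T q q' := h.ode_q.eqOnCone hT h'.ode_q h.smooth_q h'.smooth_q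
    h.smooth_ψ₁.rhs_tau_sq fun τ hτ s => by rw [e₁ τ hτ s]
  have eQ : EqOnCone T Q Q' := h.ode_Q.eqOnCone hT h'.ode_Q h.smooth_Q h'.smooth_Q
    (smooth_rhs_Q h.smooth_q h.smooth_γ h.smooth_P h.smooth_ψ₂)
    fun τ hτ s => by simp only [Xp_conj, Xm_congr (eq τ hτ), eγ τ hτ s, eP τ hτ s, e₂ τ hτ s]
  exact ⟨e₁, e₂, e₃, e₄, eP, eq, eγ, eQ⟩

variable (h : RadialSystem T ψ₀ ψ₁ ψ₂ ψ₃ ψ₄ P q γ Q) (hT : 0 < T)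
include h hT

lemma γ_vertex (s : SU2) : γ 0 s = 0 := by
  rw [h.ode_γ.eq_radialMean hT h.smooth_γ ((SmoothOver.tau _).mul h.smooth_P.conj) 0
    (zero_mem_genRange hT) s, radialMean_zero]
  simp

omit hT in
lemma ode_Xm_P : RadialODE T 0 (Xm P) fun τ s => -2 * (τ : ℂ) ^ 2 * Xm ψ₀ τ s := by
  have h1 := h.ode_P.Xm h.smooth_P
  intro τ hτ s
  rw [h1 τ hτ s, Xm_const_mul (fun τ => -2 * (τ : ℂ) ^ 2)]

/-- Both sides satisfy the same radial equation, since `X₋` commutes with `∂_τ`. -/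
lemma q_eq : ∀ τ ∈ genRange T, ∀ s, q τ s = 2 * (τ : ℂ) ^ 2 * ψ₁ τ s - Xm P τ s := by
  have hsm : SmoothOver (genRange T) (fun τ s => q τ s - 2 * (τ : ℂ) ^ 2 * ψ₁ τ s + Xm P τ s) :=
    (h.smooth_q.sub (((SmoothOver.const _ 2).mul ((SmoothOver.tau _).pow 2)).mul
      h.smooth_ψ₁)).add h.smooth_P.Xm
  have hode : RadialODE T 0 (fun τ s => q τ s - 2 * (τ : ℂ) ^ 2 * ψ₁ τ s + Xm P τ s)
      fun _ _ => 0 := by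
    intro τ hτ s
    have hn := mem_posRange_nhds hτ
    have d1 := (h.smooth_q.mono (posRange_subset T)).hasDerivAt hn s
    have d2 := (h.smooth_ψ₁.mono (posRange_subset T)).hasDerivAt hn s
    have d3 := (h.smooth_P.Xm.mono (posRange_subset T)).hasDerivAt hn s
    have d := ((d1.sub (((hasDerivAt_tau_pow_succ 1 τ).const_mul 2).mul d2)).add d3).deriv
    have e : dτ (fun τ s => q τ s - 2 * (τ : ℂ) ^ 2 * ψ₁ τ s + Xm P τ s) τ s = _ := d
    rw [e]
    have o1 := h.ode_q τ hτ s
    have o2 := h.ode_ψ₁ τ hτ s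
    have o3 := h.ode_Xm_P τ hτ s
    push_cast at o1 o2 o3 ⊢
    linear_combination o1 - 2 * (τ : ℂ) ^ 2 * o2 + o3
  intro τ hτ s
  have := hode.eq_zero hT hsm τ hτ s
  linear_combination this

lemma ode_q' : RadialODE T 1 q fun τ s => -Xm P τ s := by
  intro τ hτ s
  have o1 := h.ode_q τ hτ s
  have o2 := h.q_eq hT τ (posRange_subset T hτ) s
  push_cast at o1 ⊢
  linear_combination o1 + o2

/-- As for `q_eq`, both sides satisfy the same radial equation. -/
lemma tau_mul_q : ∀ τ ∈ genRange T, ∀ s, τ * q τ s = -conj (Xp γ τ s) := by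
  have hsm : SmoothOver (genRange T) (fun τ s => τ * q τ s + conj (Xp γ τ s)) :=
    ((SmoothOver.tau _).mul h.smooth_q).add h.smooth_γ.Xp.conj
  have oγ := (h.ode_γ.Xp h.smooth_γ).conj h.smooth_γ.Xp
  have hode : RadialODE T 0 (fun τ s => τ * q τ s + conj (Xp γ τ s)) fun _ _ => 0 := by
    intro τ hτ s
    have hn := mem_posRange_nhds hτ
    have d1 := (h.smooth_q.mono (posRange_subset T)).hasDerivAt hn s
    have d2 := (h.smooth_γ.Xp.conj.mono (posRange_subset T)).hasDerivAt hn s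
    have d := ((hasDerivAt_tau.mul d1).add d2).deriv
    have e : dτ (fun τ s => τ * q τ s + conj (Xp γ τ s)) τ s = _ := d
    rw [e]
    have o1 := h.ode_q τ hτ s
    have o2 := oγ τ hτ s
    have o3 := h.q_eq hT τ (posRange_subset T hτ) s
    simp only [Xp_const_mul (fun τ => (τ : ℂ)) (fun τ s => conj (P τ s)), Xp_conj, map_mul,
      Complex.conj_conj, Complex.conj_ofReal] at o2
    push_cast at o1 o2 ⊢
    linear_combination (τ : ℂ) * o1 + o2 + (τ : ℂ) * o3
  intro τ hτ s
  have := hode.eq_zero hT hsm τ hτ s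
  linear_combination this

/-- The component `Φ_{111'1'}` is real. With `Y = τ (2 τ² ψ₂ - X₋ q) - τ² γ P`, the right hand side of
the equation for `Q` differs from `-Y / τ` by a real function, and `∂_τ Y = -τ² |P|²` is real. -/
lemma conj_Q : ∀ τ ∈ genRange T, ∀ s, conj (Q τ s) = Q τ s := by
  set Y : Fn := fun τ s => τ * (2 * (τ : ℂ) ^ 2 * ψ₂ τ s - Xm q τ s)
    - (τ * γ τ s) * (τ * P τ s) with hY
  have sY : SmoothOver (genRange T) Y :=
    ((SmoothOver.tau _).mul ((((SmoothOver.const _ 2).mul ((SmoothOver.tau _).pow 2)).mul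
      h.smooth_ψ₂).sub h.smooth_q.Xm)).sub
      (((SmoothOver.tau _).mul h.smooth_γ).mul ((SmoothOver.tau _).mul h.smooth_P))
  have dY : ∀ τ ∈ posRange T, ∀ s, dτ Y τ s = -((τ : ℂ) ^ 2 * (P τ s * conj (P τ s))) := by
    intro τ hτ s
    have hn := mem_posRange_nhds hτ
    have d1 := (h.smooth_ψ₂.mono (posRange_subset T)).hasDerivAt hn s
    have d2 := (h.smooth_q.Xm.mono (posRange_subset T)).hasDerivAt hn s
    have d3 := (h.smooth_γ.mono (posRange_subset T)).hasDerivAt hn s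
    have d4 := (h.smooth_P.mono (posRange_subset T)).hasDerivAt hn s
    have d := ((hasDerivAt_tau.mul ((((hasDerivAt_tau_pow_succ 1 τ).const_mul 2).mul d1).sub
      d2)).sub ((hasDerivAt_tau.mul d3).mul (hasDerivAt_tau.mul d4))).deriv
    have e : dτ Y τ s = _ := d
    rw [e]
    simp only [Pi.mul_apply, Pi.sub_apply]
    have o1 := h.ode_ψ₂ τ hτ s
    have o2 := (h.ode_q.Xm h.smooth_q) τ hτ s
    have o3 := h.ode_γ τ hτ s
    have o4 := h.ode_P τ hτ s
    rw [Xm_const_mul (fun τ => -2 * (τ : ℂ) ^ 2)] at o2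
    push_cast at o1 o2 o3 o4 ⊢
    linear_combination 2 * (τ : ℂ) ^ 2 * o1 - o2 - (τ * P τ s) * o3 - (τ * γ τ s) * o4
  have realY : ∀ τ ∈ genRange T, ∀ s, Y τ s - conj (Y τ s) = 0 := by
    intro τ hτ s
    rw [eq_vertex_of_dτ_eq_zero (sY.sub sY.conj) ?_ τ hτ s]
    · simp [hY]
    · intro τ hτ s
      have d1 := (sY.mono (posRange_subset T)).hasDerivAt (mem_posRange_nhds hτ) s
      have d2 := (sY.conj.mono (posRange_subset T)).hasDerivAt (mem_posRange_nhds hτ) s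
      have e : dτ (fun τ s => Y τ s - conj (Y τ s)) τ s = _ := (d1.sub d2).deriv
      rw [e, dτ_conj sY hτ, dY τ hτ s]
      simp
      ring
  have sN := smooth_rhs_Q h.smooth_q h.smooth_γ h.smooth_P h.smooth_ψ₂
  refine (h.ode_Q.conj h.smooth_Q).eqOnCone hT h.ode_Q h.smooth_Q.conj h.smooth_Q sN.conj ?_
  refine eqOnCone_of_pos hT sN.conj sN fun τ hτ s => ?_
  have hτ0 : (τ : ℂ) ≠ 0 := by exact_mod_cast hτ.1.ne'
  refine mul_left_cancel₀ hτ0 ?_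
  have e := realY τ (posRange_subset T hτ) s
  simp only [hY, Xp_conj, map_sub, map_mul, map_neg, map_pow, Complex.conj_conj,
    Complex.conj_ofReal, map_ofNat] at e ⊢
  linear_combination e

end RadialSystem

end

/-! ### Reduction of the transport equations -/

section

variable {T : EReal} {u v : Fn} {τ : ℝ}

lemma dτ_congr (h : EqOnCone T u v) (hτ : τ ∈ posRange T) (s : SU2) : dτ u τ s = dτ v τ s := by
  refine Filter.EventuallyEq.deriv_eq ?_
  filter_upwards [mem_posRange_nhds hτ] with t ht
  exact h t (posRange_subset T ht) s

lemma Fields.frame_congr (F : Fields) (h : EqOnCone T u v) (hτ : τ ∈ posRange T) (a a' : Fin 2)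
    (s : SU2) : F.frame a a' u τ s = F.frame a a' v τ s := by
  simp only [Fields.frame, dτ_congr h hτ, Xp_congr (h τ (posRange_subset T hτ)),
    Xm_congr (h τ (posRange_subset T hτ))]

lemma Fields.frame_const (F : Fields) (a a' : Fin 2) (s : SU2) (c : ℂ) :
    F.frame a a' (fun _ _ => c) τ s = 0 := by
  have h1 := Xp_fn_tau (fun _ => c) τ s
  have h2 := Xm_fn_tau (fun _ => c) τ s
  simp only [Fields.frame, h1, h2]
  simp [dτ]

/-- The equations for the two connection coefficients with a singular quadratic source admit only the
trivial regular solution: Gronwall's inequality for `|x|² + |y|²`, in which the singular terms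
`-2x/τ`, `-2y/τ` have the favourable sign. -/
lemma eq_zero_of_riccati {x y : Fn} (hx : SmoothOver (genRange T) x)
    (hy : SmoothOver (genRange T) y) (hx0 : ∀ s, x 0 s = 0) (hy0 : ∀ s, y 0 s = 0)
    (ox : RadialODE T 1 x fun τ s => τ * (x τ s * (conj (y τ s) + y τ s)))
    (oy : RadialODE T 1 y fun τ s => τ * (y τ s ^ 2 + x τ s * conj (x τ s))) :
    ∀ τ ∈ genRange T, ∀ s, x τ s = 0 ∧ y τ s = 0 := by
  intro τ hτ s
  obtain ⟨M, hM⟩ := isCompact_Icc.exists_bound_of_continuousOn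
    ((hy.continuousOn s).mono (Icc_subset_genRange hτ))
  have hM0 : 0 ≤ M := (norm_nonneg _).trans (hM 0 ⟨le_rfl, hτ.1⟩)
  set N : ℝ → ℝ := fun t => ‖x t s‖ ^ 2 + ‖y t s‖ ^ 2 with hN
  have hNc : ContinuousOn N (Icc 0 τ) :=
    (((hx.continuousOn s).mono (Icc_subset_genRange hτ)).norm.pow 2).add
      (((hy.continuousOn s).mono (Icc_subset_genRange hτ)).norm.pow 2)
  have key : ∀ t ∈ Ioo 0 τ, ∃ N', HasDerivAt N N' t ∧ N' ≤ 6 * M * N t := by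
    intro t ht
    have ht' : t ∈ posRange T := posRange_of_mem_Ioc hτ ⟨ht.1, ht.2.le⟩
    have ht0 : (t : ℂ) ≠ 0 := by exact_mod_cast ht.1.ne'
    have d1 := (hx.mono (posRange_subset T)).hasDerivAt (mem_posRange_nhds ht') s
    have d2 := (hy.mono (posRange_subset T)).hasDerivAt (mem_posRange_nhds ht') s
    have e1 : dτ x t s = (-2 / t + 2 * (y t s).re : ℝ) • x t s := by
      have := ox t ht' s
      beta_reduce at this
      have hre : conj (y t s) + y t s = ((2 * (y t s).re : ℝ) : ℂ) := by
        rw [add_comm, Complex.add_conj]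
      rw [hre] at this
      refine mul_left_cancel₀ ht0 ?_
      rw [Complex.real_smul]
      push_cast at this ⊢
      have h2 : (t : ℂ) * ((-2 / t + 2 * ((y t s).re : ℂ)) * x t s) =
        -2 * x t s + t * (2 * ((y t s).re : ℂ)) * x t s := by field_simp
      rw [h2]
      linear_combination this
    have e2 : dτ y t s = (-2 / t : ℝ) • y t s + (y t s ^ 2 + x t s * conj (x t s)) := by
      have := oy t ht' s
      beta_reduce at this
      refine mul_left_cancel₀ ht0 ?_
      rw [Complex.real_smul]
      push_cast at this ⊢
      have h2 : (t : ℂ) * ((-2 / t) * y t s + (y t s ^ 2 + x t s * conj (x t s))) =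
        -2 * y t s + t * (y t s ^ 2 + x t s * conj (x t s)) := by field_simp
      rw [h2]
      linear_combination this
    refine ⟨_, d1.norm_sq.add d2.norm_sq, ?_⟩
    have hyM := hM t ⟨ht.1.le, ht.2.le⟩
    have b1 : inner ℝ (x t s) (dτ x t s) ≤ 2 * M * ‖x t s‖ ^ 2 := by
      rw [e1, inner_smul_right, real_inner_self_eq_norm_sq]
      have h3 : (y t s).re ≤ M := (Complex.re_le_norm _).trans hyM
      have h4 : -2 / t ≤ 0 := div_nonpos_of_nonpos_of_nonneg (by norm_num) ht.1.le
      exact mul_le_mul_of_nonneg_right (by linarith) (sq_nonneg _)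
    have b2 : inner ℝ (y t s) (dτ y t s) ≤ M * N t := by
      rw [e2, inner_add_right, inner_smul_right, real_inner_self_eq_norm_sq]
      have h4 : -2 / t * ‖y t s‖ ^ 2 ≤ 0 := mul_nonpos_of_nonpos_of_nonneg
        (div_nonpos_of_nonpos_of_nonneg (by norm_num) ht.1.le) (sq_nonneg _)
      have h5 : ‖y t s ^ 2 + x t s * conj (x t s)‖ ≤ N t := by
        refine (norm_add_le _ _).trans (le_of_eq ?_)
        simp only [norm_pow, norm_mul, RCLike.norm_conj, hN]
        ring
      have h6 := (real_inner_le_norm (y t s) (y t s ^ 2 + x t s * conj (x t s))).trans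
        (mul_le_mul hyM h5 (norm_nonneg _) hM0)
      linarith
    have b3 : 2 * M * ‖x t s‖ ^ 2 ≤ 2 * M * N t := by
      refine mul_le_mul_of_nonneg_left ?_ (by positivity)
      simp only [hN]
      nlinarith [sq_nonneg ‖y t s‖]
    linarith
  set E : ℝ → ℝ := fun t => Real.exp (-(6 * M) * t) * N t with hE
  have hEd : ∀ t ∈ Ioo 0 τ, ∃ E', HasDerivAt E E' t ∧ E' ≤ 0 := by
    intro t ht
    obtain ⟨N', h1, h2⟩ := key t ht
    refine ⟨_, (((hasDerivAt_id t).const_mul (-(6 * M))).exp).mul h1, ?_⟩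
    have := mul_nonneg (Real.exp_pos (-(6 * M) * t)).le (sub_nonneg.2 h2)
    simp only [id]
    linarith
  have hanti : AntitoneOn E (Icc 0 τ) := by
    refine antitoneOn_of_deriv_nonpos (convex_Icc 0 τ)
      (ContinuousOn.mul (by fun_prop) hNc) ?_ ?_
    · rw [interior_Icc]
      intro t ht
      obtain ⟨E', h1, -⟩ := hEd t ht
      exact h1.differentiableAt.differentiableWithinAt
    · rw [interior_Icc]
      intro t ht
      obtain ⟨E', h1, h2⟩ := hEd t ht
      rwa [h1.deriv]
  have hle := hanti (left_mem_Icc.2 hτ.1) (right_mem_Icc.2 hτ.1) hτ.1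
  have hN0 : N τ ≤ 0 := by
    have h0 : E 0 = 0 := by simp [hE, hN, hx0, hy0]
    rw [h0] at hle
    exact nonpos_of_mul_nonpos_right hle (Real.exp_pos _)
  have h1 := sq_nonneg ‖x τ s‖
  have h2 := sq_nonneg ‖y τ s‖
  simp only [hN] at hN0
  have h3 : ‖x τ s‖ ^ 2 = 0 := by linarith
  have h4 : ‖y τ s‖ ^ 2 = 0 := by linarith
  exact ⟨by simpa using h3, by simpa using h4⟩

end

namespace IsRegular

variable {T : EReal} {F : Fields} (h : IsRegular T F) {τ : ℝ}
include h

lemma frame_00 (hτ : τ ∈ genRange T) (f : Fn) (s : SU2) : F.frame 0 0 f τ s = dτ f τ s := by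
  simp [Fields.frame, Fields.cT, Fields.cP, Fields.cM, kron, h.b_00 τ hτ, h.r_00 τ hτ]

lemma Gt_00 (hτ : τ ∈ genRange T) (b c : Fin 2) (s : SU2) : F.Gt 0 0 b c τ s = 0 := by
  simp [Fields.Gt, kron, h.Γ_00 τ hτ]

lemma GtUp_00 (hτ : τ ∈ genRange T) (b c : Fin 2) (s : SU2) : F.GtUp 0 0 b c τ s = 0 := by
  simp [Fields.GtUp, h.Gt_00 hτ]

lemma GtUpBar_00 (hτ : τ ∈ genRange T) (b c : Fin 2) (s : SU2) : F.GtUpBar 0 0 b c τ s = 0 := by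
  simp [Fields.GtUpBar, h.GtUp_00 hτ]

lemma dτ_Gt (hτ : τ ∈ posRange T) (a a' b c : Fin 2) (haa : Tangential a a') (s : SU2) :
    dτ (F.Gt a a' b c) τ s = 1 / (τ : ℂ) ^ 2 * (kron a 0 * kron a' 1 * kron b 1 * kron c 1
      + kron a 1 * kron a' 0 * kron b 0 * kron c 0) + dτ (F.Γ a a' b c) τ s := by
  have hτ0 : (τ : ℂ) ≠ 0 := by exact_mod_cast hτ.1.ne'
  have d1 := ((smoothOnCone_iff.1 (h.smooth_Γ a a' b c haa)).mono
    (posRange_subset T)).hasDerivAt (mem_posRange_nhds hτ) s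
  have d2 := ((hasDerivAt_tau (τ := τ)).fun_inv hτ0).neg
  have d3 := ((d2.mul_const (kron a 0 * kron a' 1 * kron b 1 * kron c 1
      + kron a 1 * kron a' 0 * kron b 0 * kron c 0)).add d1)
  have e : dτ (F.Gt a a' b c) τ s = _ :=
    (d3.congr_of_eventuallyEq (f₁ := fun t => F.Gt a a' b c t s)
      (Eventually.of_forall fun t => by simp [Fields.Gt])).deriv
  rw [e]
  ring

lemma torsCoeff_00 (hτ : τ ∈ genRange T) (a a' e e' : Fin 2) (s : SU2) :
    F.torsCoeff 0 0 a a' e e' τ s =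
      -(F.GtUp a a' e 0 τ s * kron 0 e' + conj (F.GtUp a' a e' 0 τ s) * kron 0 e) := by
  simp [Fields.torsCoeff, Fields.GtVec, h.GtUp_00 hτ, h.GtUpBar_00 hτ]
  simp [Fields.GtUpBar]

/-- The components of the Ricci identity that contain the derivative along the generators. -/
lemma ricciEq_00 (hτ : τ ∈ posRange T) (d d' a b : Fin 2) (s : SU2) :
    F.ricciEq 0 0 d d' a b τ s = dτ (F.Gt d d' a b) τ s + (∑ f, ∑ f', if Tangential f f' then
        (F.GtUp d d' f 0 τ s * kron 0 f' + conj (F.GtUp d' d f' 0 τ s) * kron 0 f)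
          * F.Gt f f' a b τ s else 0) - F.Ω τ s * F.ψ a b 0 d τ s * eps 0 d'
        - F.Φ a b 0 d' τ s * eps 0 d := by
  have hτ' := posRange_subset T hτ
  have hz : F.frame d d' (F.Gt 0 0 a b) τ s = 0 := by
    rw [F.frame_congr (v := fun _ _ => 0) (fun τ hτ s => h.Gt_00 hτ a b s) hτ]
    exact F.frame_const _ _ _ _
  simp only [Fields.ricciEq, hz, h.frame_00 hτ', h.Gt_00 hτ', h.GtUp_00 hτ', h.torsCoeff_00 hτ']
  simp [Fin.sum_univ_two, Tangential]
  ring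

end IsRegular

/-! ### Integration of the equations for `Ω`, `Σ`, `Π` -/

namespace IsTransportSolution

variable {T : EReal} {ψ₀ : Fn} {F : Fields} (h : IsTransportSolution T ψ₀ F) {τ : ℝ}
include h

lemma sig_deriv (hτ : τ ∈ posRange T) (b b' : Fin 2) (s : SU2) :
    dτ (F.Sig b b') τ s = -(F.Ω τ s * F.Φ 0 b 0 b' τ s) + F.Pi τ s * eps 0 b * eps 0 b' := by
  have hτ' := posRange_subset T hτ
  have e := h.transport.sigma τ hτ' hτ.1 s b b'
  simp only [Fields.sigmaEq, Fields.nablaSig, h.regular.frame_00 hτ', h.regular.GtUp_00 hτ', h.regular.GtUpBar_00 hτ',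
    zero_mul, Finset.sum_const_zero, sub_zero] at e
  linear_combination e

lemma Sig_00 : ∀ τ ∈ genRange T, ∀ s, F.Sig 0 0 τ s = 0 := by
  intro τ hτ s
  rw [eq_vertex_of_dτ_eq_zero (smoothOnCone_iff.1 (h.regular.smooth_Sig 0 0)) ?_ τ hτ s,
    h.gauge.Sig_vertex]
  intro τ hτ s
  rw [h.sig_deriv hτ, h.gauge.Φ_null τ (posRange_subset T hτ)]
  simp [eps]

lemma Ω_eq : ∀ τ ∈ genRange T, ∀ s, F.Ω τ s = 0 := by
  intro τ hτ s
  rw [eq_vertex_of_dτ_eq_zero (smoothOnCone_iff.1 h.regular.smooth_Ω) ?_ τ hτ s,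
    h.gauge.Ω_vertex]
  intro τ hτ s
  have e := h.transport.omega τ (posRange_subset T hτ) hτ.1 s
  simpa [Fields.omegaEq, h.regular.frame_00 (posRange_subset T hτ), h.Sig_00 τ (posRange_subset T hτ)] using e

lemma Sig_eq_zero (b b' : Fin 2) (hb : eps 0 b * eps 0 b' = 0) :
    ∀ τ ∈ genRange T, ∀ s, F.Sig b b' τ s = 0 := by
  intro τ hτ s
  rw [eq_vertex_of_dτ_eq_zero (smoothOnCone_iff.1 (h.regular.smooth_Sig b b')) ?_ τ hτ s,
    h.gauge.Sig_vertex]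
  intro τ hτ s
  rw [h.sig_deriv hτ, h.Ω_eq τ (posRange_subset T hτ), mul_assoc, hb]
  simp

lemma Pi_eq : ∀ τ ∈ genRange T, ∀ s, F.Pi τ s = 2 := by
  intro τ hτ s
  rw [eq_vertex_of_dτ_eq_zero (smoothOnCone_iff.1 h.regular.smooth_Pi) ?_ τ hτ s,
    h.gauge.Pi_vertex]
  · simp [PiStar, eta]
  intro τ hτ s
  have hτ' := posRange_subset T hτ
  have e := h.transport.pi τ hτ' hτ.1 s
  simpa [Fields.piEq, h.regular.frame_00 hτ', Fields.SigUp, Fin.sum_univ_two, eps, h.gauge.Φ_null τ hτ',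
    h.Sig_eq_zero 0 1 (by simp [eps]) τ hτ', h.Sig_eq_zero 1 0 (by simp [eps]) τ hτ',
    h.Sig_00 τ hτ'] using e

lemma Sig_eq (a a' : Fin 2) : ∀ τ ∈ genRange T, ∀ s,
    F.Sig a a' τ s = τ * 2 * kron a 1 * kron a' 1 := by
  intro τ hτ s
  by_cases hb : eps 0 a * eps 0 a' = 0
  · rw [h.Sig_eq_zero a a' hb τ hτ]
    fin_cases a <;> fin_cases a' <;> simp [eps, kron] at hb ⊢
  · obtain ⟨rfl, rfl⟩ : a = 1 ∧ a' = 1 := by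
      fin_cases a <;> fin_cases a' <;> simp [eps] at hb ⊢
    have sS := smoothOnCone_iff.1 (h.regular.smooth_Sig 1 1)
    have st : SmoothOver (genRange T) (fun τ _ => (τ : ℂ) * 2) :=
      (SmoothOver.tau _).mul (SmoothOver.const _ 2)
    have e := eq_vertex_of_dτ_eq_zero (sS.sub st) ?_ τ hτ s
    · rw [h.gauge.Sig_vertex] at e
      simp [kron] at e ⊢
      linear_combination e
    intro τ hτ s
    have d := ((sS.mono (posRange_subset T)).hasDerivAt (mem_posRange_nhds hτ) s).sub
      (hasDerivAt_tau.mul_const 2)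
    have e : dτ (fun τ s => F.Sig 1 1 τ s - (τ : ℂ) * 2) τ s = _ := d.deriv
    rw [e, h.sig_deriv hτ, h.Ω_eq τ (posRange_subset T hτ), h.Pi_eq τ (posRange_subset T hτ)]
    simp [eps]

lemma ricci_00 (hτ : τ ∈ posRange T) (d d' a b : Fin 2) (hdd : Tangential d d') (s : SU2) :
    dτ (F.Gt d d' a b) τ s + (∑ f, ∑ f', if Tangential f f' then
        (F.GtUp d d' f 0 τ s * kron 0 f' + conj (F.GtUp d' d f' 0 τ s) * kron 0 f)
          * F.Gt f f' a b τ s else 0) - F.Φ a b 0 d' τ s * eps 0 d = 0 := by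
  have hτ' := posRange_subset T hτ
  have e := h.transport.ricci τ hτ' hτ.1 s d d' a b hdd
  rw [h.regular.ricciEq_00 hτ, h.Ω_eq τ hτ'] at e
  linear_combination e

lemma ricci_01 (hτ : τ ∈ posRange T) (a b : Fin 2) (s : SU2) :
    τ * dτ (F.Gt 0 1 a b) τ s = (-1 + τ * conj (F.Γ 1 0 0 0 τ s)) * F.Gt 0 1 a b τ s
      + τ * (F.Γ 0 1 0 0 τ s * F.Gt 1 0 a b τ s) := by
  have hτ0 : (τ : ℂ) ≠ 0 := by exact_mod_cast hτ.1.ne'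
  have hτ' := posRange_subset T hτ
  have e := h.ricci_00 hτ 0 1 a b (by simp [Tangential]) s
  simp [Fin.sum_univ_two, Tangential, kron, eps, Fields.GtUp, h.regular.Gt_00 hτ'] at e
  have g1 : F.Gt 0 1 0 0 τ s = F.Γ 0 1 0 0 τ s := by simp [Fields.Gt, kron]
  have g2 : F.Gt 1 0 0 0 τ s = -(1 / τ) + F.Γ 1 0 0 0 τ s := by simp [Fields.Gt, kron]
  rw [g1, g2] at e
  simp at e
  field_simp at e
  linear_combination e

lemma ricci_10 (hτ : τ ∈ posRange T) (a b : Fin 2) (s : SU2) :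
    τ * dτ (F.Gt 1 0 a b) τ s = (-1 + τ * F.Γ 1 0 0 0 τ s) * F.Gt 1 0 a b τ s
      + τ * (conj (F.Γ 0 1 0 0 τ s) * F.Gt 0 1 a b τ s) + τ * F.Φ a b 0 0 τ s := by
  have hτ0 : (τ : ℂ) ≠ 0 := by exact_mod_cast hτ.1.ne'
  have hτ' := posRange_subset T hτ
  have e := h.ricci_00 hτ 1 0 a b (by simp [Tangential]) s
  simp [Fin.sum_univ_two, Tangential, kron, eps, Fields.GtUp, h.regular.Gt_00 hτ'] at e
  have g1 : F.Gt 0 1 0 0 τ s = F.Γ 0 1 0 0 τ s := by simp [Fields.Gt, kron]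
  have g2 : F.Gt 1 0 0 0 τ s = -(1 / τ) + F.Γ 1 0 0 0 τ s := by simp [Fields.Gt, kron]
  rw [g1, g2] at e
  field_simp at e
  linear_combination e

end IsTransportSolution

/-! ### Derivatives of the frame vectors `κ` -/

section Columns

variable {γ : ℝ → SU2} {p q : ℂ} (hγ : HasVelocity γ p q) (A : Fin 2) (s : SU2)
include hγ

lemma HasVelocity.leftInv_col0 :
    leftInv γ (fun s => s.1 A 0) s = s.1 A 0 * p + s.1 A 1 * q := by
  have h0 : ∀ t, (s * γ t).1 A 0 = s.1 A 0 * (γ t).1 0 0 + s.1 A 1 * (γ t).1 1 0 := fun t => by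
    simp [Matrix.mul_apply, Fin.sum_univ_two]
  simp only [leftInv, h0]
  exact ((hγ.deriv0.const_mul _).add (hγ.deriv1.const_mul _)).deriv

lemma HasVelocity.leftInv_col1 :
    leftInv γ (fun s => s.1 A 1) s = s.1 A 1 * conj p - s.1 A 0 * conj q := by
  have h0 : ∀ t, (s * γ t).1 A 1 =
      s.1 A 1 * conj ((γ t).1 0 0) - s.1 A 0 * conj ((γ t).1 1 0) := fun t => by
    rw [← SU2.entry_11, ← neg_neg (conj ((γ t).1 1 0)), ← SU2.entry_01]
    simp [Matrix.mul_apply, Fin.sum_univ_two]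
    ring
  have c0 := Complex.conjCLE.toContinuousLinearMap.hasFDerivAt.comp_hasDerivAt 0 hγ.deriv0
  have c1 := Complex.conjCLE.toContinuousLinearMap.hasFDerivAt.comp_hasDerivAt 0 hγ.deriv1
  simp only [leftInv, h0]
  exact ((c0.const_mul _).sub (c1.const_mul _)).deriv

end Columns

lemma Xm_col0 (A : Fin 2) (τ : ℝ) (s : SU2) : Xm (fun _ s => s.1 A 0) τ s = -s.1 A 1 := by
  simp only [Xm, Zm, hasVelocity_expU1.leftInv_col0, hasVelocity_expU2.leftInv_col0]
  linear_combination (1 / 2 * s.1 A 1) * Complex.I_sq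

lemma Xp_col1 (A : Fin 2) (τ : ℝ) (s : SU2) : Xp (fun _ s => s.1 A 1) τ s = s.1 A 0 := by
  simp only [Xp, Zp, hasVelocity_expU1.leftInv_col1, hasVelocity_expU2.leftInv_col1]
  simp [map_ofNat]
  linear_combination (-(1 / 2) * s.1 A 0) * Complex.I_sq

lemma Xm_col1 (A : Fin 2) (τ : ℝ) (s : SU2) : Xm (fun _ s => s.1 A 1) τ s = 0 := by
  simp only [Xm, Zm, hasVelocity_expU1.leftInv_col1, hasVelocity_expU2.leftInv_col1]
  simp [map_ofNat]
  linear_combination (1 / 2 * s.1 A 0) * Complex.I_sq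

lemma SU2.exists_col0_ne_zero (s : SU2) : ∃ A, s.1 A 0 ≠ 0 := by
  by_contra! hs
  have := SU2.normSq_col s
  simp [hs] at this

/-! ### Frame and connection coefficients -/

/-- The conclusions on frame, connection, `Ω`, `Π` and `Σ`: frame and connection coefficients coincide
with their singular parts, except for `Γ_{10'11}`. -/
structure NormalFrame (T : EReal) (F : Fields) : Prop extends IsRegular T F where
  Ω_eq : ∀ τ ∈ genRange T, ∀ s, F.Ω τ s = 0
  Pi_eq : ∀ τ ∈ genRange T, ∀ s, F.Pi τ s = 2
  Sig_eq : ∀ a a', ∀ τ ∈ genRange T, ∀ s, F.Sig a a' τ s = τ * 2 * kron a 1 * kron a' 1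
  b_01 : ∀ τ ∈ genRange T, ∀ s, F.b 0 1 τ s = 0
  b_10 : ∀ τ ∈ genRange T, ∀ s, F.b 1 0 τ s = 0
  r_01 : ∀ τ ∈ genRange T, ∀ s, F.r 0 1 τ s = 0
  r_10 : ∀ τ ∈ genRange T, ∀ s, F.r 1 0 τ s = 0
  Γ_01 : ∀ τ ∈ genRange T, ∀ s b c, F.Γ 0 1 b c τ s = 0
  Γ_1000 : ∀ τ ∈ genRange T, ∀ s, F.Γ 1 0 0 0 τ s = 0
  Γ_1001 : ∀ τ ∈ genRange T, ∀ s, F.Γ 1 0 0 1 τ s = 0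

namespace IsTransportSolution

variable {T : EReal} {ψ₀ : Fn} {F : Fields} (h : IsTransportSolution T ψ₀ F) (hT : 0 < T) {τ : ℝ}
include h

lemma smooth_Γ' (a a' b c : Fin 2) (ha : Tangential a a') :
    SmoothOver (genRange T) (F.Γ a a' b c) := smoothOnCone_iff.1 (h.regular.smooth_Γ a a' b c ha)

lemma Γ_riccati : ∀ τ ∈ genRange T, ∀ s, F.Γ 0 1 0 0 τ s = 0 ∧ F.Γ 1 0 0 0 τ s = 0 := by
  have t01 : Tangential 0 1 := by simp [Tangential]
  have t10 : Tangential 1 0 := by simp [Tangential]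
  refine eq_zero_of_riccati (h.smooth_Γ' 0 1 0 0 t01) (h.smooth_Γ' 1 0 0 0 t10)
    (fun s => h.regular.Γ_vertex s 0 1 0 0 t01) (fun s => h.regular.Γ_vertex s 1 0 0 0 t10) ?_ ?_
  · intro τ hτ s
    have hτ0 : (τ : ℂ) ≠ 0 := by exact_mod_cast hτ.1.ne'
    have e := h.ricci_01 hτ 0 0 s
    rw [h.regular.dτ_Gt hτ 0 1 0 0 t01] at e
    simp [Fields.Gt, kron] at e
    field_simp at e
    push_cast
    linear_combination e
  · intro τ hτ s
    have hτ0 : (τ : ℂ) ≠ 0 := by exact_mod_cast hτ.1.ne'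
    have e := h.ricci_10 hτ 0 0 s
    rw [h.regular.dτ_Gt hτ 1 0 0 0 t10, h.gauge.Φ_null τ (posRange_subset T hτ)] at e
    simp [Fields.Gt, kron] at e
    field_simp at e
    push_cast
    refine mul_left_cancel₀ hτ0 ?_
    linear_combination e

include hT

lemma Γ_01 : ∀ τ ∈ genRange T, ∀ s b c, F.Γ 0 1 b c τ s = 0 := by
  have t01 : Tangential 0 1 := by simp [Tangential]
  intro τ hτ s b c
  refine RadialODE.eq_zero (m := 0) hT ?_ (h.smooth_Γ' 0 1 b c t01) τ hτ s
  intro τ hτ s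
  have hτ0 : (τ : ℂ) ≠ 0 := by exact_mod_cast hτ.1.ne'
  have e := h.ricci_01 hτ b c s
  obtain ⟨e1, e2⟩ := h.Γ_riccati τ (posRange_subset T hτ) s
  rw [h.regular.dτ_Gt hτ 0 1 b c t01, e1, e2] at e
  simp only [Fields.Gt, map_zero, mul_zero, zero_mul, add_zero] at e
  have hK : ∀ K : ℂ, (τ : ℂ) * (1 / τ ^ 2 * K) = 1 / τ * K := fun K => by field_simp
  rw [mul_add, hK] at e
  push_cast
  linear_combination e

omit hT in
/-- The torsion-free condition applied to the functions `κ^A_1`, which determine the coefficient of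
`X₊`. -/
lemma torsion_cP (hτ : τ ∈ posRange T) (a a' : Fin 2) (ha : Tangential a a') (s : SU2) :
    dτ (F.cP a a') τ s - ∑ e, ∑ e', (if Tangential e e' then
      F.torsCoeff 0 0 a a' e e' τ s * F.cP e e' τ s else 0) = 0 := by
  have hτ' := posRange_subset T hτ
  obtain ⟨A, hA⟩ := SU2.exists_col0_ne_zero s
  have e := (h.transport.torsion τ hτ' hτ.1 s a a' ha).2 (fun _ s => s.1 A 1)
    (smoothOnCone_iff.2 (SmoothOver.col1 _ A))
  have hfr : ∀ c c', F.frame c c' (fun _ s => s.1 A 1) = fun τ s => F.cP c c' τ s * s.1 A 0 := by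
    intro c c'
    funext τ s
    simp [Fields.frame, Xp_col1, Xm_col1, dτ]
  have h0 : F.frame a a' (fun τ s => F.cP 0 0 τ s * s.1 A 0) τ s = 0 := by
    rw [F.frame_congr (v := fun _ _ => 0) (fun τ hτ s => ?_) hτ, F.frame_const]
    simp [Fields.cP, kron, h.regular.b_00 τ hτ]
  have h1 : dτ (fun τ s => F.cP a a' τ s * s.1 A 0) τ s = dτ (F.cP a a') τ s * s.1 A 0 :=
    deriv_mul_const_field _
  simp only [Fields.torsionOp, h0, h.regular.frame_00 hτ', hfr, h1] at e
  refine mul_right_cancel₀ hA ?_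
  rw [zero_mul]
  refine Eq.trans ?_ e
  simp [Fin.sum_univ_two, Tangential]
  ring

omit hT in
/-- The torsion-free condition applied to the function `τ`. -/
lemma torsion_cT (hτ : τ ∈ posRange T) (a a' : Fin 2) (ha : Tangential a a') (s : SU2) :
    dτ (F.cT a a') τ s - ∑ e, ∑ e', (if Tangential e e' then
      F.torsCoeff 0 0 a a' e e' τ s * F.cT e e' τ s else 0) = 0 := by
  have hτ' := posRange_subset T hτ
  have e := (h.transport.torsion τ hτ' hτ.1 s a a' ha).2 (fun τ _ => (τ : ℂ))
    (smoothOnCone_iff.2 (SmoothOver.tau _))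
  have hd : ∀ τ s, dτ (fun τ _ => (τ : ℂ)) τ s = 1 := fun τ s => hasDerivAt_tau.deriv
  have hfr : ∀ c c', F.frame c c' (fun τ _ => (τ : ℂ)) = F.cT c c' := by
    intro c c'
    funext τ s
    simp [Fields.frame, Xp_fn_tau (fun τ => (τ : ℂ)), Xm_fn_tau (fun τ => (τ : ℂ)), hd]
  have h0 : F.frame a a' (F.cT 0 0) τ s = 0 := by
    rw [F.frame_congr (u := F.cT 0 0) (v := fun _ _ => 1) (fun τ hτ s => ?_) hτ,
      F.frame_const]
    simp [Fields.cT, kron, h.regular.r_00 τ hτ]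
  simp only [Fields.torsionOp, hfr, h0, h.regular.frame_00 hτ'] at e
  simpa using e

omit hT in
lemma dτ_cP (hτ : τ ∈ posRange T) (a a' : Fin 2) (ha : Tangential a a') (s : SU2) :
    dτ (F.cP a a') τ s = 1 / (τ : ℂ) ^ 2 * (kron a 0 * kron a' 1) + dτ (F.b a a') τ s := by
  have hτ0 : (τ : ℂ) ≠ 0 := by exact_mod_cast hτ.1.ne'
  have d1 := ((smoothOnCone_iff.1 (h.regular.smooth_b a a' ha)).mono
    (posRange_subset T)).hasDerivAt (mem_posRange_nhds hτ) s
  have d2 := ((hasDerivAt_tau (τ := τ)).fun_inv hτ0).neg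
  have d3 := ((d2.mul_const (kron a 0 * kron a' 1)).add d1)
  have e : dτ (F.cP a a') τ s = _ :=
    (d3.congr_of_eventuallyEq (f₁ := fun t => F.cP a a' t s)
      (Eventually.of_forall fun t => by simp [Fields.cP])).deriv
  rw [e]
  ring

omit hT in
lemma dτ_cT (hτ : τ ∈ posRange T) (a a' : Fin 2) (ha : Tangential a a') (s : SU2) :
    dτ (F.cT a a') τ s = dτ (F.r a a') τ s := by
  have d1 := ((smoothOnCone_iff.1 (h.regular.smooth_r a a' ha)).mono
    (posRange_subset T)).hasDerivAt (mem_posRange_nhds hτ) s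
  have e : dτ (F.cT a a') τ s = _ := (d1.const_add (kron a 0 * kron a' 0)).deriv
  exact e

lemma GtUp_01 (hτ : τ ∈ genRange T) (b c : Fin 2) (s : SU2) :
    F.GtUp 0 1 b c τ s = -(1 / (τ : ℂ)) * (kron b 0 * kron c 1) := by
  fin_cases b <;> fin_cases c <;>
    simp [Fields.GtUp, eps, Fields.Gt, kron, h.Γ_01 hT τ hτ]

omit hT in
lemma GtUp_10_0 (hτ : τ ∈ genRange T) (b : Fin 2) (s : SU2) :
    F.GtUp 1 0 b 0 τ s = 1 / (τ : ℂ) * kron b 1 + kron b 0 * F.Γ 1 0 0 1 τ s := by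
  have := h.regular.symm_Γ τ hτ s 1 0 1 0 (by simp [Tangential])
  fin_cases b <;>
    simp [Fields.GtUp, eps, Fields.Gt, kron, (h.Γ_riccati τ hτ s).2, this]

lemma b_01 : ∀ τ ∈ genRange T, ∀ s, F.b 0 1 τ s = 0 := by
  have t01 : Tangential 0 1 := by simp [Tangential]
  refine RadialODE.eq_zero (m := 0) hT ?_ (smoothOnCone_iff.1 (h.regular.smooth_b 0 1 t01))
  intro τ hτ s
  have hτ0 : (τ : ℂ) ≠ 0 := by exact_mod_cast hτ.1.ne'
  have hτ' := posRange_subset T hτ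
  have e := h.torsion_cP hτ 0 1 t01 s
  rw [h.dτ_cP hτ 0 1 t01] at e
  simp [Fin.sum_univ_two, Tangential, h.regular.torsCoeff_00 hτ', h.GtUp_01 hT hτ', h.GtUp_10_0 hτ',
    Fields.cP, kron, h.regular.b_00 τ hτ'] at e
  field_simp at e
  push_cast
  refine mul_left_cancel₀ hτ0 ?_
  linear_combination e

lemma b_10 : ∀ τ ∈ genRange T, ∀ s, F.b 1 0 τ s = 0 := by
  have t10 : Tangential 1 0 := by simp [Tangential]
  refine RadialODE.eq_zero (m := 0) hT ?_ (smoothOnCone_iff.1 (h.regular.smooth_b 1 0 t10))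
  intro τ hτ s
  have hτ0 : (τ : ℂ) ≠ 0 := by exact_mod_cast hτ.1.ne'
  have hτ' := posRange_subset T hτ
  have e := h.torsion_cP hτ 1 0 t10 s
  rw [h.dτ_cP hτ 1 0 t10] at e
  simp [Fin.sum_univ_two, Tangential, h.regular.torsCoeff_00 hτ', h.GtUp_01 hT hτ', h.GtUp_10_0 hτ',
    Fields.cP, kron, h.regular.b_00 τ hτ'] at e
  field_simp at e
  push_cast
  linear_combination e

omit hT in
/-- `∇̃_0^{c'} Φ_{bcb'c'} = ψ_{bcd0} Σ^d_{b'}`, solved for the derivative along the generators. -/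
lemma phi_deriv (hτ : τ ∈ posRange T) (b c b' : Fin 2) (s : SU2) :
    dτ (F.Φ b c b' 1) τ s =
      F.nablaΦ 0 1 b c b' 0 τ s - 2 * τ * F.ψ b c 0 0 τ s * kron b' 1 := by
  have hτ' := posRange_subset T hτ
  have e := h.transport.phi τ hτ' hτ.1 s b c b'
  have h1 : F.nablaΦ 0 0 b c b' 1 τ s = dτ (F.Φ b c b' 1) τ s := by
    simp [Fields.nablaΦ, h.regular.frame_00 hτ', h.regular.GtUp_00 hτ', h.regular.GtUpBar_00 hτ']
  simp [Fields.phiEq, Fin.sum_univ_two, eps, h1, Fields.SigUp1, h.Sig_eq _ _ τ hτ', kron] at e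
  simp only [kron]
  split_ifs at e ⊢ <;> linear_combination -e

lemma Φ_0001 : ∀ τ ∈ genRange T, ∀ s, F.Φ 0 0 0 1 τ s = 0 := by
  refine RadialODE.eq_zero (m := 1) hT ?_ (smoothOnCone_iff.1 (h.regular.smooth_Φ 0 0 0 1))
  intro τ hτ s
  have hτ0 : (τ : ℂ) ≠ 0 := by exact_mod_cast hτ.1.ne'
  have hτ' := posRange_subset T hτ
  have hz : F.frame 0 1 (F.Φ 0 0 0 0) τ s = 0 := by
    rw [F.frame_congr (v := fun _ _ => 0) h.gauge.Φ_null hτ, F.frame_const]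
  rw [h.phi_deriv hτ]
  simp [Fields.nablaΦ, hz, Fin.sum_univ_two, Fields.GtUpBar, h.GtUp_01 hT hτ', h.GtUp_10_0 hτ',
    kron, h.gauge.Φ_null τ hτ', (h.regular.symm_Φ τ hτ' s 0 0 1 0).2]
  field_simp
  ring

lemma Φ_0100 : ∀ τ ∈ genRange T, ∀ s, F.Φ 0 1 0 0 τ s = 0 := by
  intro τ hτ s
  rw [← h.regular.real_Φ τ hτ s 0 0 0 1, h.Φ_0001 hT τ hτ, map_zero]

lemma Γ_1001 : ∀ τ ∈ genRange T, ∀ s, F.Γ 1 0 0 1 τ s = 0 := by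
  have t10 : Tangential 1 0 := by simp [Tangential]
  refine RadialODE.eq_zero (m := 0) hT ?_ (h.smooth_Γ' 1 0 0 1 t10)
  intro τ hτ s
  have e := h.ricci_10 hτ 0 1 s
  obtain ⟨e1, e2⟩ := h.Γ_riccati τ (posRange_subset T hτ) s
  rw [h.regular.dτ_Gt hτ 1 0 0 1 t10, e1, e2, h.Φ_0100 hT τ (posRange_subset T hτ)] at e
  simp [Fields.Gt, kron] at e
  push_cast
  linear_combination e

lemma r_01 : ∀ τ ∈ genRange T, ∀ s, F.r 0 1 τ s = 0 := by
  have t01 : Tangential 0 1 := by simp [Tangential]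
  refine RadialODE.eq_zero (m := 0) hT ?_ (smoothOnCone_iff.1 (h.regular.smooth_r 0 1 t01))
  intro τ hτ s
  have hτ0 : (τ : ℂ) ≠ 0 := by exact_mod_cast hτ.1.ne'
  have hτ' := posRange_subset T hτ
  have e := h.torsion_cT hτ 0 1 t01 s
  rw [h.dτ_cT hτ 0 1 t01] at e
  simp [Fin.sum_univ_two, Tangential, h.regular.torsCoeff_00 hτ', h.GtUp_01 hT hτ', h.GtUp_10_0 hτ',
    Fields.cT, kron,
    h.Γ_1001 hT τ hτ'] at e
  field_simp at e
  push_cast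
  linear_combination e

lemma normalFrame : NormalFrame T F where
  toIsRegular := h.regular
  Ω_eq := h.Ω_eq
  Pi_eq := h.Pi_eq
  Sig_eq := h.Sig_eq
  b_01 := h.b_01 hT
  b_10 := h.b_10 hT
  r_01 := h.r_01 hT
  r_10 τ hτ s := by
    rw [← h.regular.real_r τ hτ s 0 1 (by simp [Tangential]), h.r_01 hT τ hτ, map_zero]
  Γ_01 := h.Γ_01 hT
  Γ_1000 τ hτ s := (h.Γ_riccati τ hτ s).2
  Γ_1001 := h.Γ_1001 hT

end IsTransportSolution

/-! ### The equations for the curvature components -/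

/-- A totally symmetric object with four indices from its five components, which are labelled by the
number of indices equal to `1`. -/
def symmComp {α : Type*} (x₀ x₁ x₂ x₃ x₄ : α) (a b c d : Fin 2) : α :=
  match a.val + b.val + c.val + d.val with
  | 0 => x₀
  | 1 => x₁
  | 2 => x₂
  | 3 => x₃
  | _ => x₄

lemma Symm4.eq_symmComp {α : Type*} {f : Fin 2 → Fin 2 → Fin 2 → Fin 2 → α} (hf : Symm4 f)
    (a b c d : Fin 2) :
    f a b c d = symmComp (f 0 0 0 0) (f 0 0 0 1) (f 0 0 1 1) (f 0 1 1 1) (f 1 1 1 1) a b c d := by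
  have h1 : ∀ a b c d, f a b c d = f b a c d := fun a b c d => (hf a b c d).1
  have h2 : ∀ a b c d, f a b c d = f a c b d := fun a b c d => (hf a b c d).2.1
  have h3 : ∀ a b c d, f a b c d = f a b d c := fun a b c d => (hf a b c d).2.2
  fin_cases a <;> fin_cases b <;> fin_cases c <;> fin_cases d <;> try rfl
  · exact h3 0 0 1 0
  · exact (h2 0 1 0 0).trans (h3 0 0 1 0)
  · exact h2 0 1 0 1
  · exact (h3 0 1 1 0).trans (h2 0 1 0 1)
  · exact (h1 1 0 0 0).trans ((h2 0 1 0 0).trans (h3 0 0 1 0))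
  · exact (h1 1 0 0 1).trans (h2 0 1 0 1)
  · exact (h1 1 0 1 0).trans ((h3 0 1 1 0).trans (h2 0 1 0 1))
  · exact h1 1 0 1 1
  · exact (h2 1 1 0 0).trans ((h1 1 0 1 0).trans ((h3 0 1 1 0).trans (h2 0 1 0 1)))
  · exact (h2 1 1 0 1).trans (h1 1 0 1 1)
  · exact (h3 1 1 1 0).trans ((h2 1 1 0 1).trans (h1 1 0 1 1))

/-- The components `Φ_{aba'b'}` of the trace-free Ricci spinor in terms of the components that do not
vanish, `Φ_{001'1'} = P`, `Φ_{011'1'} = q`, `Φ_{111'1'} = Q` and their complex conjugates; the arguments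
`n`, `m` are the numbers of unprimed and of primed indices equal to `1`. -/
def phiComp (P q Q : Fn) (n m : ℕ) : Fn :=
  match n, m with
  | 0, 2 => P
  | 2, 0 => fun τ s => conj (P τ s)
  | 1, 2 => q
  | 2, 1 => fun τ s => conj (q τ s)
  | 2, 2 => Q
  | _, _ => fun _ _ => 0

namespace NormalFrame

variable {T : EReal} {F : Fields} (h : NormalFrame T F) {τ : ℝ} (hτ : τ ∈ genRange T)
include h hτ

lemma frame_01 (f : Fn) (s : SU2) : F.frame 0 1 f τ s = -(1 / (τ : ℂ)) * Xp f τ s := by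
  simp [Fields.frame, Fields.cT, Fields.cP, Fields.cM, kron, h.b_01 τ hτ, h.b_10 τ hτ, h.r_01 τ hτ]

lemma frame_10 (f : Fn) (s : SU2) : F.frame 1 0 f τ s = -(1 / (τ : ℂ)) * Xm f τ s := by
  simp [Fields.frame, Fields.cT, Fields.cP, Fields.cM, kron, h.b_01 τ hτ, h.b_10 τ hτ, h.r_10 τ hτ]

lemma Gt_01 (b c : Fin 2) (s : SU2) :
    F.Gt 0 1 b c τ s = -(1 / (τ : ℂ)) * (kron b 1 * kron c 1) := by
  simp [Fields.Gt, kron, h.Γ_01 τ hτ]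

lemma Gt_10 (b c : Fin 2) (s : SU2) :
    F.Gt 1 0 b c τ s = -(1 / (τ : ℂ)) * (kron b 0 * kron c 0)
      + F.Γ 1 0 1 1 τ s * (kron b 1 * kron c 1) := by
  have := h.symm_Γ τ hτ s 1 0 1 0 (by simp [Tangential])
  fin_cases b <;> fin_cases c <;> simp [Fields.Gt, kron, h.Γ_1000 τ hτ, h.Γ_1001 τ hτ, this]

lemma GtUp_01 (b c : Fin 2) (s : SU2) :
    F.GtUp 0 1 b c τ s = -(1 / (τ : ℂ)) * (kron b 0 * kron c 1) := by
  fin_cases b <;> fin_cases c <;> simp [Fields.GtUp, eps, kron, h.Gt_01 hτ]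

lemma GtUp_10 (b c : Fin 2) (s : SU2) :
    F.GtUp 1 0 b c τ s = 1 / (τ : ℂ) * (kron b 1 * kron c 0)
      + F.Γ 1 0 1 1 τ s * (kron b 0 * kron c 1) := by
  fin_cases b <;> fin_cases c <;> simp [Fields.GtUp, eps, kron, h.Gt_10 hτ]

lemma phiEq_mul (hτ0 : 0 < τ) (b c b' : Fin 2) (s : SU2) :
    τ * F.phiEq b c b' τ s = -(τ * dτ (F.Φ b c b' 1) τ s) - Xp (F.Φ b c b' 0) τ s
      + kron b 1 * F.Φ 0 c b' 0 τ s + kron c 1 * F.Φ b 0 b' 0 τ s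
      - kron b' 1 * (τ * conj (F.Γ 1 0 1 1 τ s) * F.Φ b c 0 0 τ s)
      - kron b' 0 * F.Φ b c 1 0 τ s - F.Φ b c b' 1 τ s
      - 2 * (τ : ℂ) ^ 2 * F.ψ b c 0 0 τ s * kron b' 1 := by
  have hτc : (τ : ℂ) ≠ 0 := by exact_mod_cast hτ0.ne'
  simp only [Fields.phiEq, Fin.sum_univ_two, Fields.nablaΦ, Fields.GtUpBar, h.GtUp_01 hτ,
    h.GtUp_10 hτ, h.GtUp_00 hτ, h.frame_01 hτ, h.frame_00 hτ, Fields.SigUp1, h.Sig_eq _ _ τ hτ]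
  fin_cases b <;> fin_cases c <;> fin_cases b' <;> simp [eps, kron] <;> field_simp <;> ring

lemma psiEq_mul (hτ0 : 0 < τ) (a b c : Fin 2) (s : SU2) :
    τ * F.psiEq a b c τ s = -(τ * dτ (F.ψ a b c 1) τ s) - Xm (F.ψ a b c 0) τ s
      - (kron a 0 * F.ψ 1 b c 0 τ s + kron b 0 * F.ψ a 1 c 0 τ s + kron c 0 * F.ψ a b 1 0 τ s
        + F.ψ a b c 1 τ s)
      - τ * F.Γ 1 0 1 1 τ s * (kron a 1 * F.ψ 0 b c 0 τ s + kron b 1 * F.ψ a 0 c 0 τ s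
        + kron c 1 * F.ψ a b 0 0 τ s) := by
  have hτc : (τ : ℂ) ≠ 0 := by exact_mod_cast hτ0.ne'
  simp only [Fields.psiEq, Fin.sum_univ_two, Fields.nablaψ, h.GtUp_10 hτ, h.GtUp_00 hτ,
    h.frame_10 hτ, h.frame_00 hτ]
  fin_cases a <;> fin_cases b <;> fin_cases c <;> simp [eps, kron] <;> field_simp <;> ring

end NormalFrame

/-- The form to which the transport equations in the conformal gauge can be brought: the algebraic
conclusions on the fields together with the hierarchy of radial equations. -/
structure NormalForm (T : EReal) (F : Fields) : Prop extends NormalFrame T F where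
  Φ_0000 : ∀ τ ∈ genRange T, ∀ s, F.Φ 0 0 0 0 τ s = 0
  Φ_0001 : ∀ τ ∈ genRange T, ∀ s, F.Φ 0 0 0 1 τ s = 0
  Φ_0101 : ∀ τ ∈ genRange T, ∀ s, F.Φ 0 1 0 1 τ s = 0
  system : RadialSystem T (F.ψ 0 0 0 0) (F.ψ 0 0 0 1) (F.ψ 0 0 1 1) (F.ψ 0 1 1 1) (F.ψ 1 1 1 1)
    (F.Φ 0 0 1 1) (F.Φ 0 1 1 1) (F.Γ 1 0 1 1) (F.Φ 1 1 1 1)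

lemma Xp_eq_zero {f : Fn} {τ : ℝ} (h : ∀ s, f τ s = 0) (s : SU2) : Xp f τ s = 0 := by
  rw [Xp_congr (g := fun _ _ => 0) h, Xp_fn_tau (fun _ => 0)]

lemma IsTransportSolution.normalForm {T : EReal} (hT : 0 < T) {ψ₀ : Fn} {F : Fields}
    (h : IsTransportSolution T ψ₀ F) : NormalForm T F := by
  have n := h.normalFrame hT
  have sΦ : ∀ a b a' b', SmoothOver (genRange T) (F.Φ a b a' b') := fun a b a' b' =>
    smoothOnCone_iff.1 (n.smooth_Φ a b a' b')
  have sψ : ∀ a b c d, SmoothOver (genRange T) (F.ψ a b c d) := fun a b c d =>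
    smoothOnCone_iff.1 (n.smooth_ψ a b c d)
  have Φ0000 := h.gauge.Φ_null
  have Φ0001 := h.Φ_0001 hT
  have Φ0100 := h.Φ_0100 hT
  have Φ0010 : ∀ τ ∈ genRange T, ∀ s, F.Φ 0 0 1 0 τ s = 0 := fun τ hτ s => by
    rw [(n.symm_Φ τ hτ s 0 0 1 0).2, Φ0001 τ hτ]
  have ephi : ∀ τ ∈ posRange T, ∀ s b c b', _ := fun τ hτ s b c b' =>
    n.phiEq_mul (posRange_subset T hτ) hτ.1 b c b' s
  have epsi : ∀ τ ∈ posRange T, ∀ s a b c, _ := fun τ hτ s a b c =>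
    n.psiEq_mul (posRange_subset T hτ) hτ.1 a b c s
  have Φ0101 : ∀ τ ∈ genRange T, ∀ s, F.Φ 0 1 0 1 τ s = 0 := by
    refine RadialODE.eq_zero (m := 1) hT ?_ (sΦ 0 1 0 1)
    intro τ hτ s
    have hτ' := posRange_subset T hτ
    have e := ephi τ hτ s 0 1 0
    rw [h.transport.phi τ hτ' hτ.1, Xp_eq_zero (Φ0100 τ hτ'), Φ0000 τ hτ',
      (n.symm_Φ τ hτ' s 0 1 1 0).2] at e
    simp [kron] at e
    push_cast
    linear_combination e
  have Φ0110 : ∀ τ ∈ genRange T, ∀ s, F.Φ 0 1 1 0 τ s = 0 := fun τ hτ s => by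
    rw [(n.symm_Φ τ hτ s 0 1 1 0).2, Φ0101 τ hτ]
  refine ⟨n, Φ0000, Φ0001, Φ0101, sψ _ _ _ _, sψ _ _ _ _, sψ _ _ _ _, sψ _ _ _ _, sψ _ _ _ _,
    sΦ _ _ _ _, sΦ _ _ _ _, smoothOnCone_iff.1 (n.smooth_Γ 1 0 1 1 (by simp [Tangential])),
    sΦ _ _ _ _, ?_, ?_, ?_, ?_, ?_, ?_, ?_, ?_⟩
  · intro τ hτ s
    have hτ' := posRange_subset T hτ
    have e := ephi τ hτ s 0 0 1
    rw [h.transport.phi τ hτ' hτ.1, Xp_eq_zero (Φ0010 τ hτ'), Φ0000 τ hτ'] at e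
    simp [kron] at e
    push_cast
    linear_combination e
  · intro τ hτ s
    have hτc : (τ : ℂ) ≠ 0 := by exact_mod_cast hτ.1.ne'
    have hτ' := posRange_subset T hτ
    have e := h.ricci_10 hτ 1 1 s
    rw [n.dτ_Gt hτ 1 0 1 1 (by simp [Tangential]), ← n.real_Φ τ hτ' s 0 0 1 1,
      n.Γ_1000 τ hτ', n.Γ_01 τ hτ'] at e
    simp [Fields.Gt, kron] at e
    push_cast
    linear_combination e
  · intro τ hτ s
    have hτ' := posRange_subset T hτ
    have e := epsi τ hτ s 0 0 0
    rw [h.transport.psi τ hτ' hτ.1, (n.symm_ψ τ hτ' s).eq_symmComp 1 0 0 0,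
      (n.symm_ψ τ hτ' s).eq_symmComp 0 1 0 0, (n.symm_ψ τ hτ' s).eq_symmComp 0 0 1 0] at e
    simp [kron, symmComp] at e
    push_cast
    linear_combination e
  · intro τ hτ s
    have hτ' := posRange_subset T hτ
    have e := epsi τ hτ s 0 0 1
    rw [h.transport.psi τ hτ' hτ.1, Xm_congr (g := F.ψ 0 0 0 1) (fun s =>
      (n.symm_ψ τ hτ' s 0 0 1 0).2.2), (n.symm_ψ τ hτ' s).eq_symmComp 1 0 1 0,
      (n.symm_ψ τ hτ' s).eq_symmComp 0 1 1 0] at e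
    simp [kron, symmComp] at e
    push_cast
    linear_combination e
  · intro τ hτ s
    have hτ' := posRange_subset T hτ
    have e := epsi τ hτ s 0 1 1
    rw [h.transport.psi τ hτ' hτ.1, Xm_congr (g := F.ψ 0 0 1 1) (fun s =>
      (n.symm_ψ τ hτ' s).eq_symmComp 0 1 1 0), (n.symm_ψ τ hτ' s).eq_symmComp 1 1 1 0,
      (n.symm_ψ τ hτ' s).eq_symmComp 0 0 1 0, (n.symm_ψ τ hτ' s).eq_symmComp 0 1 0 0] at e
    simp [kron, symmComp] at e
    push_cast
    linear_combination e
  · intro τ hτ s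
    have hτ' := posRange_subset T hτ
    have e := epsi τ hτ s 1 1 1
    rw [h.transport.psi τ hτ' hτ.1, Xm_congr (g := F.ψ 0 1 1 1) (fun s =>
      (n.symm_ψ τ hτ' s).eq_symmComp 1 1 1 0), (n.symm_ψ τ hτ' s).eq_symmComp 0 1 1 0,
      (n.symm_ψ τ hτ' s).eq_symmComp 1 0 1 0, (n.symm_ψ τ hτ' s).eq_symmComp 1 1 0 0] at e
    simp [kron, symmComp] at e
    push_cast
    linear_combination e
  · intro τ hτ s
    have hτ' := posRange_subset T hτ
    have e := ephi τ hτ s 0 1 1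
    rw [h.transport.phi τ hτ' hτ.1, Xp_eq_zero (Φ0110 τ hτ'), Φ0100 τ hτ', Φ0010 τ hτ',
      (n.symm_ψ τ hτ' s).eq_symmComp 0 1 0 0] at e
    simp [kron, symmComp] at e
    push_cast
    linear_combination e
  · intro τ hτ s
    have hτ' := posRange_subset T hτ
    have e := ephi τ hτ s 1 1 1
    have hc : ∀ s, F.Φ 1 1 1 0 τ s = conj (F.Φ 0 1 1 1 τ s) := fun s => by
      rw [n.real_Φ τ hτ', (n.symm_Φ τ hτ' s 1 1 1 0).2]
    rw [h.transport.phi τ hτ' hτ.1, Xp_congr (g := fun τ s => conj (F.Φ 0 1 1 1 τ s)) hc,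
      Φ0110 τ hτ', (n.symm_Φ τ hτ' s 1 0 1 0).1, Φ0110 τ hτ', ← n.real_Φ τ hτ' s 0 0 1 1,
      (n.symm_ψ τ hτ' s).eq_symmComp 1 1 0 0] at e
    simp [kron, symmComp] at e
    push_cast
    linear_combination e

lemma Xm_eq_zero {f : Fn} {τ : ℝ} (h : ∀ s, f τ s = 0) (s : SU2) : Xm f τ s = 0 := by
  rw [Xm_congr (g := fun _ _ => 0) h, Xm_fn_tau (fun _ => 0)]

lemma dτ_const (c : ℂ) (τ : ℝ) (s : SU2) : dτ (fun _ _ => c) τ s = 0 := deriv_const _ _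

lemma dτ_inv_mul {T : EReal} {τ : ℝ} {f : Fn} (hf : SmoothOver (genRange T) f) (hτ : τ ∈ posRange T) (s : SU2) :
    dτ (fun τ s => -(1 / (τ : ℂ)) * f τ s) τ s =
      1 / (τ : ℂ) ^ 2 * f τ s - 1 / (τ : ℂ) * dτ f τ s := by
  have hτ0 : (τ : ℂ) ≠ 0 := by exact_mod_cast hτ.1.ne'
  have d1 := (hf.mono (posRange_subset T)).hasDerivAt (mem_posRange_nhds hτ) s
  have d2 := (((hasDerivAt_tau (τ := τ)).fun_inv hτ0).neg).mul d1
  have e : dτ (fun τ s => -(1 / (τ : ℂ)) * f τ s) τ s = _ :=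
    (d2.congr_of_eventuallyEq (f₁ := fun t : ℝ => -(1 / (t : ℂ)) * f t s)
      (Eventually.of_forall fun t => by simp)).deriv
  rw [e, Pi.neg_apply]
  ring

/-! ### The normal form implies the transport equations -/

namespace NormalForm

variable {T : EReal} {F : Fields} (h : NormalForm T F)
include h

lemma Φ_eq (a b a' b' : Fin 2) : EqOnCone T (F.Φ a b a' b')
    (phiComp (F.Φ 0 0 1 1) (F.Φ 0 1 1 1) (F.Φ 1 1 1 1) (a.val + b.val) (a'.val + b'.val)) := by
  intro τ hτ s
  have e1 : ∀ x y, F.Φ 1 0 x y τ s = F.Φ 0 1 x y τ s := fun x y => (h.symm_Φ τ hτ s 1 0 x y).1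
  have e2 : ∀ x y, F.Φ x y 1 0 τ s = F.Φ x y 0 1 τ s := fun x y => (h.symm_Φ τ hτ s x y 1 0).2
  have e3 : F.Φ 0 1 0 0 τ s = 0 := by
    rw [← h.real_Φ τ hτ s 0 0 0 1, h.Φ_0001 τ hτ, map_zero]
  have e4 := (h.real_Φ τ hτ s 0 0 1 1).symm
  have e5 := (h.real_Φ τ hτ s 0 1 1 1).symm
  fin_cases a <;> fin_cases b <;> fin_cases a' <;> fin_cases b' <;>
    simp [phiComp, e1, e2, e3, e4, e5, h.Φ_0000 τ hτ, h.Φ_0001 τ hτ, h.Φ_0101 τ hτ]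

lemma ψ_eq {τ : ℝ} (hτ : τ ∈ genRange T) (s : SU2) (a b c d : Fin 2) : F.ψ a b c d τ s =
    symmComp (F.ψ 0 0 0 0) (F.ψ 0 0 0 1) (F.ψ 0 0 1 1) (F.ψ 0 1 1 1) (F.ψ 1 1 1 1) a b c d τ s := by
  rw [(h.symm_ψ τ hτ s).eq_symmComp a b c d]
  fin_cases a <;> fin_cases b <;> fin_cases c <;> fin_cases d <;> rfl

variable {τ : ℝ}

lemma omegaEq_00 (hτ : τ ∈ posRange T) (s : SU2) : F.omegaEq 0 0 τ s = 0 := by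
  have hτ' := posRange_subset T hτ
  have hΩ : EqOnCone T F.Ω (fun _ _ => 0) := h.Ω_eq
  simp [Fields.omegaEq, h.frame_00 hτ', dτ_congr hΩ hτ, dτ_const, h.Sig_eq _ _ τ hτ', kron]

lemma sigmaEq_00 (hτ : τ ∈ posRange T) (b b' : Fin 2) (s : SU2) :
    F.sigmaEq 0 0 b b' τ s = 0 := by
  have hτ' := posRange_subset T hτ
  have hd : dτ (F.Sig b b') τ s = 2 * kron b 1 * kron b' 1 := by
    rw [dτ_congr (h.Sig_eq b b') hτ]
    exact ((((hasDerivAt_tau.mul_const 2).mul_const (kron b 1)).mul_const (kron b' 1)).congr_deriv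
      (by ring)).deriv
  simp only [Fields.sigmaEq, Fields.nablaSig, h.frame_00 hτ', hd, h.GtUp_00 hτ', h.GtUpBar_00 hτ',
    h.Ω_eq τ hτ', h.Pi_eq τ hτ']
  fin_cases b <;> fin_cases b' <;> simp [kron, eps]

lemma piEq_00 (hτ : τ ∈ posRange T) (s : SU2) : F.piEq 0 0 τ s = 0 := by
  have hτ' := posRange_subset T hτ
  have hPi : EqOnCone T F.Pi (fun _ _ => 2) := h.Pi_eq
  simp [Fields.piEq, h.frame_00 hτ', dτ_congr hPi hτ, dτ_const, Fields.SigUp,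
    h.Sig_eq _ _ τ hτ', kron, eps, h.Φ_0000 τ hτ']

lemma torsionOp_00 (hτ : τ ∈ posRange T) (a a' : Fin 2) (ha : Tangential a a') (f : Fn)
    (hf : SmoothOnCone T f) (s : SU2) : F.torsionOp 0 0 a a' f τ s = 0 := by
  have hτ' := posRange_subset T hτ
  have hf' := smoothOnCone_iff.1 hf
  have hfp := hf'.mono (posRange_subset T)
  have f00 : EqOnCone T (F.frame 0 0 f) (dτ f) := fun τ hτ s => h.frame_00 hτ f s
  have f01 : EqOnCone T (F.frame 0 1 f) (fun τ s => -(1 / (τ : ℂ)) * Xp f τ s) :=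
    fun τ hτ s => h.frame_01 hτ f s
  have f10 : EqOnCone T (F.frame 1 0 f) (fun τ s => -(1 / (τ : ℂ)) * Xm f τ s) :=
    fun τ hτ s => h.frame_10 hτ f s
  have d01 := (dτ_congr f01 hτ s).trans (dτ_inv_mul hf'.Xp hτ s)
  have d10 := (dτ_congr f10 hτ s).trans (dτ_inv_mul hf'.Xm hτ s)
  rw [Fields.torsionOp, F.frame_congr f00 hτ, h.frame_00 hτ']
  simp only [h.torsCoeff_00 hτ']
  fin_cases a <;> fin_cases a'
  · simp [Tangential, h.GtUp_00 hτ', dτ_congr f00 hτ, h.frame_00 hτ']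
  · simp [Fin.sum_univ_two, Tangential, h.GtUp_01 hτ', h.GtUp_10 hτ', kron, h.frame_01 hτ',
      d01, Xp_dτ hfp (isOpen_posRange T) hτ]
    ring
  · simp [Fin.sum_univ_two, Tangential, h.GtUp_01 hτ', h.GtUp_10 hτ', kron, h.frame_10 hτ',
      d10, Xm_dτ hfp (isOpen_posRange T) hτ]
    ring
  · simp [Tangential] at ha

lemma ricciEq_eq_zero (hτ : τ ∈ posRange T) (d d' a b : Fin 2) (hd : Tangential d d') (s : SU2) :
    F.ricciEq 0 0 d d' a b τ s = 0 := by
  have hτ' := posRange_subset T hτ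
  have hτc : (τ : ℂ) ≠ 0 := by exact_mod_cast hτ.1.ne'
  rw [h.ricciEq_00 hτ, h.Ω_eq τ hτ', h.Φ_eq a b 0 d' τ hτ']
  fin_cases d <;> fin_cases d'
  · have : EqOnCone T (F.Gt 0 0 a b) (fun _ _ => 0) := fun τ hτ s => h.Gt_00 hτ a b s
    simp [Tangential, h.GtUp_00 hτ', dτ_congr this hτ, dτ_const, eps]
  · have hΓ : EqOnCone T (F.Γ 0 1 a b) (fun _ _ => 0) := fun τ hτ s => h.Γ_01 τ hτ s a b
    simp [Fin.sum_univ_two, Tangential, h.GtUp_01 hτ', h.GtUp_10 hτ',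
      h.dτ_Gt hτ 0 1 a b (by simp [Tangential]), dτ_congr hΓ hτ, dτ_const, eps, h.Gt_01 hτ', kron]
    split_ifs <;> field_simp <;> ring
  · have hΓ : ∀ τ ∈ genRange T, ∀ s, F.Γ 1 0 a b τ s = F.Γ 1 0 1 1 τ s * (kron a 1 * kron b 1) := by
      intro τ hτ s
      have := h.symm_Γ τ hτ s 1 0 1 0 (by simp [Tangential])
      fin_cases a <;> fin_cases b <;> simp [kron, h.Γ_1000 τ hτ, h.Γ_1001 τ hτ, this]
    have hd : dτ (fun τ s => F.Γ 1 0 1 1 τ s * (kron a 1 * kron b 1)) τ s =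
      dτ (F.Γ 1 0 1 1) τ s * (kron a 1 * kron b 1) := deriv_mul_const_field _
    have e := h.system.ode_γ τ hτ s
    simp only [Fin.mk_one, Fin.zero_eta, h.dτ_Gt hτ 1 0 a b (by simp [Tangential]),
      dτ_congr (u := F.Γ 1 0 a b) hΓ hτ, hd]
    fin_cases a <;> fin_cases b <;>
      simp [Fin.sum_univ_two, Tangential, h.GtUp_01 hτ', h.GtUp_10 hτ', eps, h.Gt_10 hτ', kron,
        phiComp]
    · field_simp
      ring
    · push_cast at e
      refine mul_left_cancel₀ hτc ?_
      rw [mul_zero]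
      linear_combination e + F.Γ 1 0 1 1 τ s * mul_inv_cancel₀ hτc
  · simp [Tangential] at hd

lemma phiEq_eq_zero (hT : 0 < T) (hτ : τ ∈ posRange T) (b c b' : Fin 2) (s : SU2) :
    F.phiEq b c b' τ s = 0 := by
  have hτ' := posRange_subset T hτ
  have hτc : (τ : ℂ) ≠ 0 := by exact_mod_cast hτ.1.ne'
  have e1 := h.system.ode_P τ hτ s
  have e2 := h.system.ode_q τ hτ s
  have e3 := h.system.ode_Q τ hτ s
  have e4 := (h.system.ode_q' hT).conj h.system.smooth_q τ hτ s
  simp only [map_neg, ← Xp_conj] at e4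
  push_cast at e1 e2 e3 e4
  refine mul_left_cancel₀ hτc ?_
  rw [mul_zero, h.phiEq_mul hτ' hτ.1, dτ_congr (h.Φ_eq b c b' 1) hτ,
    Xp_congr (h.Φ_eq b c b' 0 τ hτ'), h.ψ_eq hτ']
  simp only [fun a b a' b' => h.Φ_eq a b a' b' τ hτ' s]
  fin_cases b <;> fin_cases c <;> fin_cases b' <;>
    simp [phiComp, symmComp, kron, dτ_const, Xp_fn_tau (fun _ => 0)]
  · linear_combination -e1
  · linear_combination -e2
  · linear_combination -e2
  · linear_combination -e4
  · linear_combination -e3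

lemma psiEq_eq_zero (hτ : τ ∈ posRange T) (a b c : Fin 2) (s : SU2) : F.psiEq a b c τ s = 0 := by
  have hτ' := posRange_subset T hτ
  have hτc : (τ : ℂ) ≠ 0 := by exact_mod_cast hτ.1.ne'
  have e1 := h.system.ode_ψ₁ τ hτ s
  have e2 := h.system.ode_ψ₂ τ hτ s
  have e3 := h.system.ode_ψ₃ τ hτ s
  have e4 := h.system.ode_ψ₄ τ hτ s
  push_cast at e1 e2 e3 e4
  refine mul_left_cancel₀ hτc ?_
  rw [mul_zero, h.psiEq_mul hτ' hτ.1,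
    dτ_congr (fun τ hτ s => h.ψ_eq hτ s a b c 1) hτ, Xm_congr (fun s => h.ψ_eq hτ' s a b c 0)]
  simp only [h.ψ_eq hτ']
  fin_cases a <;> fin_cases b <;> fin_cases c <;> simp [symmComp, kron]
  · linear_combination -e1
  · linear_combination -e2
  · linear_combination -e2
  · linear_combination -e3
  · linear_combination -e2
  · linear_combination -e3
  · linear_combination -e3
  · linear_combination -e4

lemma transportEqs (hT : 0 < T) : TransportEqs T F where
  omega τ hτ hτ0 s := h.omegaEq_00 ⟨hτ0, hτ.2⟩ s
  sigma τ hτ hτ0 s b b' := h.sigmaEq_00 ⟨hτ0, hτ.2⟩ b b' s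
  pi τ hτ hτ0 s := h.piEq_00 ⟨hτ0, hτ.2⟩ s
  torsion τ hτ hτ0 s a a' ha :=
    ⟨by simp [h.torsCoeff_00 hτ, kron], fun f hf => h.torsionOp_00 ⟨hτ0, hτ.2⟩ a a' ha f hf s⟩
  ricci τ hτ hτ0 s d d' a b hd := h.ricciEq_eq_zero ⟨hτ0, hτ.2⟩ d d' a b hd s
  phi τ hτ hτ0 s b c b' := h.phiEq_eq_zero hT ⟨hτ0, hτ.2⟩ b c b' s
  psi τ hτ hτ0 s a b c := h.psiEq_eq_zero ⟨hτ0, hτ.2⟩ a b c s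

end NormalForm

lemma PiStar_eq : (PiStar : ℂ) = 2 := by simp [PiStar, eta]

/-! ### The inner constraints -/

namespace NormalForm

variable {T : EReal} {F : Fields} (h : NormalForm T F) {τ : ℝ}
include h

lemma torsCoeff_0110 (hτ : τ ∈ genRange T) (e e' : Fin 2) (s : SU2) :
    F.torsCoeff 0 1 1 0 e e' τ s = 0 := by
  simp only [Fields.torsCoeff, Fields.GtVec, Fields.GtUpBar, h.GtUp_01 hτ, h.GtUp_10 hτ]
  fin_cases e <;> fin_cases e' <;> simp [kron]

lemma vertCoeff_eq (hτ : τ ∈ genRange T) (s : SU2) : F.vertCoeff τ s = 1 / (τ : ℂ) ^ 2 := by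
  simp [Fields.vertCoeff, Fields.cP, Fields.cM, kron, h.b_01 τ hτ, h.b_10 τ hτ]
  ring

lemma torsionOp_0110 (hτ : τ ∈ posRange T) (f : Fn) (hf : SmoothOnCone T f) (s : SU2) :
    F.torsionOp 0 1 1 0 f τ s + F.vertCoeff τ s * Svert f τ s = 0 := by
  have hτ' := posRange_subset T hτ
  have f01 : EqOnCone T (F.frame 0 1 f) (fun τ s => -(1 / (τ : ℂ)) * Xp f τ s) :=
    fun τ hτ s => h.frame_01 hτ f s
  have f10 : EqOnCone T (F.frame 1 0 f) (fun τ s => -(1 / (τ : ℂ)) * Xm f τ s) :=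
    fun τ hτ s => h.frame_10 hτ f s
  have e := Xp_Xm_commutator (smoothOnCone_iff.1 hf) hτ' s
  simp only [Fields.torsionOp, F.frame_congr f01 hτ, F.frame_congr f10 hτ, h.frame_01 hτ',
    h.frame_10 hτ', h.torsCoeff_0110 hτ', h.vertCoeff_eq hτ',
    Xp_const_mul (fun τ => -(1 / (τ : ℂ))), Xm_const_mul (fun τ => -(1 / (τ : ℂ)))]
  simp
  linear_combination (1 / (τ : ℂ) ^ 2) * e

lemma sigmaEq_inner (hτ : τ ∈ posRange T) (b b' : Fin 2) (s : SU2) :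
    F.sigmaEq 0 1 b b' τ s = 0 ∧ F.sigmaEq 1 0 b b' τ s = 0 := by
  have hτ' := posRange_subset T hτ
  have hτc : (τ : ℂ) ≠ 0 := by exact_mod_cast hτ.1.ne'
  have hp : Xp (F.Sig b b') τ s = 0 := by
    rw [Xp_congr (g := fun τ _ => τ * 2 * kron b 1 * kron b' 1) (h.Sig_eq b b' τ hτ'),
      Xp_fn_tau (fun τ => τ * 2 * kron b 1 * kron b' 1)]
  have hm : Xm (F.Sig b b') τ s = 0 := by
    rw [Xm_congr (g := fun τ _ => τ * 2 * kron b 1 * kron b' 1) (h.Sig_eq b b' τ hτ'),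
      Xm_fn_tau (fun τ => τ * 2 * kron b 1 * kron b' 1)]
  simp only [Fields.sigmaEq, Fields.nablaSig, h.frame_01 hτ', h.frame_10 hτ', hp, hm,
    Fields.GtUpBar, h.GtUp_01 hτ', h.GtUp_10 hτ', h.Ω_eq τ hτ', h.Pi_eq τ hτ', h.Sig_eq _ _ τ hτ']
  fin_cases b <;> fin_cases b' <;> simp [kron, eps] <;> field_simp <;> simp

lemma piEq_inner (hτ : τ ∈ posRange T) (s : SU2) :
    F.piEq 0 1 τ s = 0 ∧ F.piEq 1 0 τ s = 0 := by
  have hτ' := posRange_subset T hτ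
  have hp : Xp F.Pi τ s = 0 := by
    rw [Xp_congr (g := fun _ _ => 2) (h.Pi_eq τ hτ'), Xp_fn_tau (fun _ => 2)]
  have hm : Xm F.Pi τ s = 0 := by
    rw [Xm_congr (g := fun _ _ => 2) (h.Pi_eq τ hτ'), Xm_fn_tau (fun _ => 2)]
  simp only [Fields.piEq, h.frame_01 hτ', h.frame_10 hτ', hp, hm, Fields.SigUp,
    h.Sig_eq _ _ τ hτ', fun a b a' b' => h.Φ_eq a b a' b' τ hτ' s]
  simp [eps, kron, phiComp]

lemma ricciEq_inner (hT : 0 < T) (hτ : τ ∈ posRange T) (a b : Fin 2) (s : SU2) :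
    F.ricciEq 0 1 1 0 a b τ s - 2 * Complex.I * F.vertCoeff τ s * hLow a b = 0 := by
  have hτ' := posRange_subset T hτ
  have hτc : (τ : ℂ) ≠ 0 := by exact_mod_cast hτ.1.ne'
  have hm : Xm (F.Gt 0 1 a b) τ s = 0 := by
    rw [Xm_congr (g := fun τ _ => -(1 / (τ : ℂ)) * (kron a 1 * kron b 1))
      (fun s => h.Gt_01 hτ' a b s), Xm_fn_tau (fun τ => -(1 / (τ : ℂ)) * (kron a 1 * kron b 1))]
  have hp : Xp (F.Gt 1 0 a b) τ s = kron a 1 * kron b 1 * Xp (F.Γ 1 0 1 1) τ s := by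
    by_cases hab : a = 1 ∧ b = 1
    · obtain ⟨rfl, rfl⟩ := hab
      rw [Xp_congr (g := F.Γ 1 0 1 1) (fun s => by rw [h.Gt_10 hτ']; simp [kron])]
      simp [kron]
    · have hk : kron a 1 * kron b 1 = 0 := by
        simp only [kron, mul_ite, mul_one, mul_zero]
        split_ifs <;> simp_all
      rw [Xp_congr (g := fun τ _ => -(1 / (τ : ℂ)) * (kron a 0 * kron b 0))
        (fun s => by rw [h.Gt_10 hτ', hk]; simp),
        Xp_fn_tau (fun τ => -(1 / (τ : ℂ)) * (kron a 0 * kron b 0)), hk, zero_mul]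
  have e := congrArg (starRingEnd ℂ) (h.system.tau_mul_q hT τ hτ' s)
  simp only [map_mul, map_neg, Complex.conj_ofReal, Complex.conj_conj] at e
  simp only [Fields.ricciEq, h.frame_01 hτ', h.frame_10 hτ', hp, hm, h.torsCoeff_0110 hτ',
    h.Ω_eq τ hτ', h.vertCoeff_eq hτ', h.Φ_eq a b 1 0 τ hτ' s, h.GtUp_01 hτ', h.GtUp_10 hτ',
    h.Gt_01 hτ', h.Gt_10 hτ']
  fin_cases a <;> fin_cases b <;> simp [eps, kron, hLow, genH, phiComp]
  · field_simp
    linear_combination -Complex.I_sq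
  · field_simp
    linear_combination -Complex.I_sq
  · refine mul_left_cancel₀ hτc ?_
    rw [mul_zero]
    linear_combination -e - Xp (F.Γ 1 0 1 1) τ s * mul_inv_cancel₀ hτc

lemma innerConstraints (hT : 0 < T) : InnerConstraints T F where
  omega τ hτ hτ0 s := by
    simp [Fields.omegaEq, h.frame_01 hτ, h.frame_10 hτ, Xp_eq_zero (h.Ω_eq τ hτ),
      Xm_eq_zero (h.Ω_eq τ hτ), h.Sig_eq _ _ τ hτ, kron]
  sigma τ hτ hτ0 s b b' := h.sigmaEq_inner ⟨hτ0, hτ.2⟩ b b' s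
  pi τ hτ hτ0 s := h.piEq_inner ⟨hτ0, hτ.2⟩ s
  torsion τ hτ hτ0 s :=
    ⟨h.torsCoeff_0110 hτ 1 1 s, fun f hf => h.torsionOp_0110 ⟨hτ0, hτ.2⟩ f hf s⟩
  ricci τ hτ hτ0 s a b := h.ricciEq_inner hT ⟨hτ0, hτ.2⟩ a b s

/-! ### Uniqueness -/

lemma sameFields (hT : 0 < T) {G : Fields} (h' : NormalForm T G)
    (h₀ : EqOnCone T (F.ψ 0 0 0 0) (G.ψ 0 0 0 0)) : SameFields T F G := by
  obtain ⟨e₁, e₂, e₃, e₄, eP, eq, eγ, eQ⟩ := h.system.unique hT h'.system h₀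
  refine ⟨?_, ?_, ?_, ?_, ?_, ?_, ?_, ?_⟩
  · intro τ hτ s
    rw [h.Ω_eq τ hτ, h'.Ω_eq τ hτ]
  · intro τ hτ s
    rw [h.Pi_eq τ hτ, h'.Pi_eq τ hτ]
  · intro a a' τ hτ s
    rw [h.Sig_eq a a' τ hτ, h'.Sig_eq a a' τ hτ]
  · intro a b a' b' τ hτ s
    rw [h.Φ_eq a b a' b' τ hτ, h'.Φ_eq a b a' b' τ hτ]
    fin_cases a <;> fin_cases b <;> fin_cases a' <;> fin_cases b' <;>
      simp [phiComp, eP τ hτ s, eq τ hτ s, eQ τ hτ s]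
  · intro a b c d τ hτ s
    rw [h.ψ_eq hτ, h'.ψ_eq hτ]
    fin_cases a <;> fin_cases b <;> fin_cases c <;> fin_cases d <;>
      simp [symmComp, h₀ τ hτ s, e₁ τ hτ s, e₂ τ hτ s, e₃ τ hτ s, e₄ τ hτ s]
  · intro a a' ha τ hτ s
    fin_cases a <;> fin_cases a' <;> simp [Tangential] at ha ⊢
    · rw [h.b_00 τ hτ, h'.b_00 τ hτ]
    · rw [h.b_01 τ hτ, h'.b_01 τ hτ]
    · rw [h.b_10 τ hτ, h'.b_10 τ hτ]
  · intro a a' ha τ hτ s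
    fin_cases a <;> fin_cases a' <;> simp [Tangential] at ha ⊢
    · rw [h.r_00 τ hτ, h'.r_00 τ hτ]
    · rw [h.r_01 τ hτ, h'.r_01 τ hτ]
    · rw [h.r_10 τ hτ, h'.r_10 τ hτ]
  · intro a a' b c ha τ hτ s
    fin_cases a <;> fin_cases a' <;> simp only [Fin.zero_eta, Fin.mk_one]
    · rw [h.Γ_00 τ hτ, h'.Γ_00 τ hτ]
    · rw [h.Γ_01 τ hτ, h'.Γ_01 τ hτ]
    · have e := h.symm_Γ τ hτ s 1 0 1 0 (by simp [Tangential])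
      have e' := h'.symm_Γ τ hτ s 1 0 1 0 (by simp [Tangential])
      fin_cases b <;> fin_cases c <;> simp [e, e', h.Γ_1000 τ hτ, h'.Γ_1000 τ hτ,
        h.Γ_1001 τ hτ, h'.Γ_1001 τ hτ, eγ τ hτ s]
    · simp [Tangential] at ha

/-! ### Explicit expressions -/

lemma explicitForm (hT : 0 < T) {ψ₀ : Fn} (h₀ : EqOnCone T (F.ψ 0 0 0 0) ψ₀) :
    ExplicitForm T ψ₀ F := by
  have sy := h.system
  have hX : ∀ τ ∈ genRange T, ∀ s, Xm (F.ψ 0 0 0 0) τ s = Xm ψ₀ τ s :=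
    fun τ hτ s => Xm_congr (h₀ τ hτ) s
  have iP : ∀ τ ∈ genRange T, ∀ s, (τ : ℂ) * F.Φ 0 0 1 1 τ s =
      -2 * ∫ t in (0 : ℝ)..τ, (t : ℂ) ^ 2 * ψ₀ t s := by
    intro τ hτ s
    have e := sy.ode_P.integral_eq sy.smooth_P sy.smooth_ψ₀.rhs_tau_sq hτ s
    rw [zero_add, pow_one] at e
    rw [e, ← intervalIntegral.integral_const_mul]
    refine intervalIntegral.integral_congr fun t ht => ?_
    rw [uIcc_of_le hτ.1] at ht
    simp only [h₀ t (genRange_of_le hτ ht.1 ht.2) s]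
    ring
  have iXP : ∀ τ ∈ genRange T, ∀ s, (τ : ℂ) * Xm (F.Φ 0 0 1 1) τ s =
      -2 * ∫ t in (0 : ℝ)..τ, (t : ℂ) ^ 2 * Xm ψ₀ t s := by
    intro τ hτ s
    have e := sy.ode_Xm_P.integral_eq sy.smooth_P.Xm sy.smooth_ψ₀.Xm.rhs_tau_sq hτ s
    rw [zero_add, pow_one] at e
    rw [e, ← intervalIntegral.integral_const_mul]
    refine intervalIntegral.integral_congr fun t ht => ?_
    rw [uIcc_of_le hτ.1] at ht
    simp only [hX t (genRange_of_le hτ ht.1 ht.2) s]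
    ring
  have iγ : ∀ τ ∈ genRange T, ∀ s, (τ : ℂ) * F.Γ 1 0 1 1 τ s =
      ∫ t in (0 : ℝ)..τ, (t : ℂ) * conj (F.Φ 0 0 1 1 t s) := by
    intro τ hτ s
    have e := sy.ode_γ.integral_eq sy.smooth_γ ((SmoothOver.tau _).mul sy.smooth_P.conj) hτ s
    simpa using e
  have hne : ∀ {τ : ℝ}, 0 < τ → (τ : ℂ) ≠ 0 := fun h => by exact_mod_cast h.ne'
  refine ⟨h.Ω_eq, ?_, ?_, ?_, ?_, h.Γ_01, h.Γ_1000, h.Γ_1001, ?_, ?_, h.Φ_0001, ?_, h.Φ_0101, ?_,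
    ?_, ?_, ?_⟩
  · intro τ hτ s a a'
    rw [h.Sig_eq a a' τ hτ, PiStar_eq]
  · intro τ hτ s
    rw [h.Pi_eq τ hτ, PiStar_eq]
  · intro τ hτ s a a' ha
    fin_cases a <;> fin_cases a' <;> simp [Tangential] at ha ⊢
    exacts [h.b_00 τ hτ s, h.b_01 τ hτ s, h.b_10 τ hτ s]
  · intro τ hτ s a a' ha
    fin_cases a <;> fin_cases a' <;> simp [Tangential] at ha ⊢
    exacts [h.r_00 τ hτ s, h.r_01 τ hτ s, h.r_10 τ hτ s]
  · intro τ hτ hτ0 s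
    refine mul_left_cancel₀ (hne hτ0) ?_
    rw [iγ τ hτ s, PiStar_eq]
    have e : ∫ t in (0 : ℝ)..τ, (t : ℂ) * conj (F.Φ 0 0 1 1 t s) =
        -2 * ∫ t in (0 : ℝ)..τ, ∫ t₂ in (0 : ℝ)..t, (t₂ : ℂ) ^ 2 * conj (ψ₀ t₂ s) := by
      rw [← intervalIntegral.integral_const_mul]
      refine intervalIntegral.integral_congr fun t ht => ?_
      rw [uIcc_of_le hτ.1] at ht
      have e1 := congrArg (starRingEnd ℂ) (iP t (genRange_of_le hτ ht.1 ht.2) s)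
      rw [map_mul, map_mul, ← intervalIntegral.intervalIntegral_conj] at e1
      simpa [map_ofNat] using e1
    rw [e]
    field_simp [hne hτ0]
  · intro τ hτ hτ0 s
    refine mul_left_cancel₀ (hne hτ0) ?_
    rw [iγ τ hτ s, ← mul_assoc, mul_one_div_cancel (hne hτ0), one_mul]
    refine intervalIntegral.integral_congr fun t ht => ?_
    rw [uIcc_of_le hτ.1] at ht
    simp only [h.real_Φ t (genRange_of_le hτ ht.1 ht.2) s 0 0 1 1]
  · intro τ hτ s
    rw [h.Φ_eq 0 1 0 0 τ hτ]
    simp [phiComp]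
  · intro τ hτ hτ0 s
    refine mul_left_cancel₀ (hne hτ0) ?_
    rw [iP τ hτ s, PiStar_eq]
    field_simp [hne hτ0]
  · intro τ hτ hτ0 s
    refine mul_left_cancel₀ (hne hτ0) ?_
    have e := sy.ode_q.integral_eq sy.smooth_q sy.smooth_ψ₁.rhs_tau_sq hτ s
    rw [zero_add, pow_one] at e
    rw [e, PiStar_eq]
    simp only [pow_zero, one_mul, mul_assoc]
    rw [intervalIntegral.integral_const_mul]
    field_simp [hne hτ0]
  · intro τ hτ hτ0 s
    refine mul_left_cancel₀ (pow_ne_zero 2 (hne hτ0)) ?_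
    have e := (sy.ode_q' hT).integral_eq sy.smooth_q sy.smooth_P.Xm.neg hτ s
    have e' : ∫ t in (0 : ℝ)..τ, (t : ℂ) ^ 1 * -Xm (F.Φ 0 0 1 1) t s =
        2 * ∫ t in (0 : ℝ)..τ, ∫ t₂ in (0 : ℝ)..t, (t₂ : ℂ) ^ 2 * Xm ψ₀ t₂ s := by
      rw [← intervalIntegral.integral_const_mul]
      refine intervalIntegral.integral_congr fun t ht => ?_
      rw [uIcc_of_le hτ.1] at ht
      have e1 := iXP t (genRange_of_le hτ ht.1 ht.2) s
      simp only [pow_one]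
      linear_combination -e1
    rw [e, e', PiStar_eq]
    field_simp [hne hτ0]
  · intro τ hτ hτ0 s
    refine mul_left_cancel₀ (pow_ne_zero 4 (hne hτ0)) ?_
    have e := sy.ode_ψ₁.integral_eq sy.smooth_ψ₁ sy.smooth_ψ₀.Xm.neg hτ s
    have e' : ∫ t in (0 : ℝ)..τ, (t : ℂ) ^ 3 * -Xm (F.ψ 0 0 0 0) t s =
        -∫ t in (0 : ℝ)..τ, (t : ℂ) ^ 3 * Xm ψ₀ t s := by
      rw [← intervalIntegral.integral_neg]
      refine intervalIntegral.integral_congr fun t ht => ?_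
      rw [uIcc_of_le hτ.1] at ht
      simp only [hX t (genRange_of_le hτ ht.1 ht.2) s]
      ring
    rw [e, e']
    field_simp [hne hτ0]

end NormalForm

/-! ### Existence -/

/-- The fields that are built from a solution of the hierarchy of radial equations. -/
def fieldsOf (ψ₀ ψ₁ ψ₂ ψ₃ ψ₄ P q γ Q : Fn) : Fields where
  Ω := fun _ _ => 0
  Pi := fun _ _ => 2
  Sig a a' := fun τ _ => τ * 2 * kron a 1 * kron a' 1
  Φ a b a' b' := phiComp P q Q (a.val + b.val) (a'.val + b'.val)
  ψ a b c d := symmComp ψ₀ ψ₁ ψ₂ ψ₃ ψ₄ a b c d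
  b _ _ := fun _ _ => 0
  r _ _ := fun _ _ => 0
  Γ a a' b c := fun τ s => kron a 1 * kron a' 0 * kron b 1 * kron c 1 * γ τ s

lemma RadialSystem.normalForm {T : EReal} (hT : 0 < T) {ψ₀ ψ₁ ψ₂ ψ₃ ψ₄ P q γ Q : Fn}
    (h : RadialSystem T ψ₀ ψ₁ ψ₂ ψ₃ ψ₄ P q γ Q) :
    NormalForm T (fieldsOf ψ₀ ψ₁ ψ₂ ψ₃ ψ₄ P q γ Q) where
  smooth_Ω := smoothOnCone_iff.2 (SmoothOver.const _ 0)
  smooth_Pi := smoothOnCone_iff.2 (SmoothOver.const _ 2)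
  smooth_Sig a a' := smoothOnCone_iff.2 ((((SmoothOver.tau _).mul (SmoothOver.const _ 2)).mul
    (SmoothOver.const _ _)).mul (SmoothOver.const _ _))
  smooth_Φ a b a' b' := by
    rw [smoothOnCone_iff]
    simp only [fieldsOf]
    unfold phiComp
    split
    exacts [h.smooth_P, h.smooth_P.conj, h.smooth_q, h.smooth_q.conj, h.smooth_Q,
      SmoothOver.const _ 0]
  smooth_ψ a b c d := by
    rw [smoothOnCone_iff]
    simp only [fieldsOf]
    unfold symmComp
    split
    exacts [h.smooth_ψ₀, h.smooth_ψ₁, h.smooth_ψ₂, h.smooth_ψ₃, h.smooth_ψ₄]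
  smooth_b _ _ _ := smoothOnCone_iff.2 (SmoothOver.const _ 0)
  smooth_r _ _ _ := smoothOnCone_iff.2 (SmoothOver.const _ 0)
  smooth_Γ a a' b c _ := smoothOnCone_iff.2 ((SmoothOver.const _ _).mul h.smooth_γ)
  real_Ω := by simp [fieldsOf]
  real_Pi := by simp [fieldsOf, map_ofNat]
  real_Sig τ hτ s a a' := by
    fin_cases a <;> fin_cases a' <;> simp [fieldsOf, kron, map_ofNat]
  real_Φ τ hτ s a b a' b' := by
    fin_cases a <;> fin_cases b <;> fin_cases a' <;> fin_cases b' <;>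
      simp [fieldsOf, phiComp, h.conj_Q hT τ hτ s]
  real_r := by simp [fieldsOf]
  symm_Φ τ hτ s a b a' b' := by
    simp only [fieldsOf, add_comm b.val, add_comm b'.val, and_self]
  symm_ψ τ hτ s a b c d := by
    refine ⟨?_, ?_, ?_⟩ <;> simp only [fieldsOf, symmComp]
    · rw [add_comm a.val]
    · rw [add_right_comm a.val]
    · rw [add_right_comm (a.val + b.val)]
  symm_Γ τ hτ s a a' b c _ := by
    simp only [fieldsOf]
    ring
  b_00 := by simp [fieldsOf]
  r_00 := by simp [fieldsOf]
  Γ_00 := by simp [fieldsOf, kron]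
  b_vertex := by simp [fieldsOf]
  r_vertex := by simp [fieldsOf]
  Γ_vertex := by simp [fieldsOf, h.γ_vertex hT]
  Ω_eq := by simp [fieldsOf]
  Pi_eq := by simp [fieldsOf]
  Sig_eq := by simp [fieldsOf]
  b_01 := by simp [fieldsOf]
  b_10 := by simp [fieldsOf]
  r_01 := by simp [fieldsOf]
  r_10 := by simp [fieldsOf]
  Γ_01 := by simp [fieldsOf, kron]
  Γ_1000 := by simp [fieldsOf, kron]
  Γ_1001 := by simp [fieldsOf, kron]
  Φ_0000 := by simp [fieldsOf, phiComp]
  Φ_0001 := by simp [fieldsOf, phiComp]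
  Φ_0101 := by simp [fieldsOf, phiComp]
  system := by simpa [fieldsOf, phiComp, symmComp, kron] using h

lemma exists_isTransportSolution {T : EReal} (hT : 0 < T) {ψ₀ : Fn}
    (h₀ : SmoothOver (genRange T) ψ₀) : ∃ F, IsTransportSolution T ψ₀ F := by
  obtain ⟨ψ₁, ψ₂, ψ₃, ψ₄, P, q, γ, Q, h⟩ := exists_radialSystem h₀
  have n := h.normalForm hT
  exact ⟨_, n.toIsRegular, ⟨by simp [fieldsOf], by simp [fieldsOf], by simp [fieldsOf, PiStar_eq],
    n.Φ_0000⟩, fun _ _ _ => rfl, n.transportEqs hT⟩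

/-! ### Fibres of the projection to the cone -/

/-- The element `diag(u, ū)` of the subgroup of `SU(2)` that acts on the fibres over the cone. -/
def diagSU2 (u : ℂ) (hu : u * conj u = 1) : SU2 := mkSU2 u 0 (by simpa using hu)

/-- The factor by which `diag(u, ū)` multiplies the frame vector `κ_a`. -/
def diagFactor (u : ℂ) (a : Fin 2) : ℂ := if a = 0 then u else conj u

lemma mul_diagSU2_apply (s : SU2) {u : ℂ} (hu : u * conj u = 1) (A a : Fin 2) :
    (s * diagSU2 u hu).1 A a = s.1 A a * diagFactor u a := by
  fin_cases a <;> simp [diagSU2, mkSU2, diagFactor, Matrix.mul_apply, Fin.sum_univ_two]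

lemma diagFactor_mul_conj {u : ℂ} (hu : u * conj u = 1) (a : Fin 2) :
    diagFactor u a * conj (diagFactor u a) = 1 := by
  fin_cases a <;> simp [diagFactor, hu, mul_comm (conj u)]

lemma xstar_mul_diagSU2 (s : SU2) {u : ℂ} (hu : u * conj u = 1) :
    xstar (s * diagSU2 u hu) = xstar s := by
  funext μ
  unfold xstar
  congr 1
  refine Finset.sum_congr rfl fun E _ => Finset.sum_congr rfl fun E' _ => ?_
  rw [mul_diagSU2_apply, mul_diagSU2_apply, map_mul]
  linear_combination vdW μ E E' * s.1 E 0 * conj (s.1 E' 0) * diagFactor_mul_conj hu 0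

lemma SU2.normSq_col_re (s : SU2) :
    (s.1 0 0).re ^ 2 + (s.1 0 0).im ^ 2 + (s.1 1 0).re ^ 2 + (s.1 1 0).im ^ 2 = 1 := by
  have := congrArg Complex.re (SU2.normSq_col s)
  simp at this
  linear_combination this

lemma xstar_zero (s : SU2) : xstar s 0 = Real.sqrt 2 / 2 := by
  have := SU2.normSq_col_re s
  simp [xstar, vdW, Fin.sum_univ_two]
  linear_combination Real.sqrt 2 / 2 * this

/-- The null vector `x_*(s)` determines the first column of `s` up to a phase. -/
lemma exists_eq_mul_diagSU2 {s s' : SU2} (h : xstar s = xstar s') :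
    ∃ (u : ℂ) (hu : u * conj u = 1), s' = s * diagSU2 u hu := by
  have h2 : (Real.sqrt 2 / 2 : ℝ) ≠ 0 := by positivity
  have n := SU2.normSq_col_re s
  have n' := SU2.normSq_col_re s'
  have e1 := congrFun h 1
  have e2 := congrFun h 2
  have e3 := congrFun h 3
  simp only [xstar, vdW, Fin.sum_univ_two] at e1 e2 e3
  simp at e1 e2 e3
  have f1 := mul_left_cancel₀ h2 (a := Real.sqrt 2 / 2)
    (b := (s.1 0 0).re * (s.1 1 0).re + (s.1 0 0).im * (s.1 1 0).im)
    (c := (s'.1 0 0).re * (s'.1 1 0).re + (s'.1 0 0).im * (s'.1 1 0).im)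
    (by linear_combination e1 / 2)
  have f2 := mul_left_cancel₀ h2 (a := Real.sqrt 2 / 2)
    (b := (s.1 0 0).im * (s.1 1 0).re - (s.1 0 0).re * (s.1 1 0).im)
    (c := (s'.1 0 0).im * (s'.1 1 0).re - (s'.1 0 0).re * (s'.1 1 0).im)
    (by linear_combination e2 / 2)
  have f3 := mul_left_cancel₀ h2 (a := Real.sqrt 2 / 2)
    (b := (s.1 0 0).re ^ 2 + (s.1 0 0).im ^ 2 - (s.1 1 0).re ^ 2 - (s.1 1 0).im ^ 2)
    (c := (s'.1 0 0).re ^ 2 + (s'.1 0 0).im ^ 2 - (s'.1 1 0).re ^ 2 - (s'.1 1 0).im ^ 2)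
    (by linear_combination e3)
  have g : s.1 0 0 * conj (s.1 1 0) = s'.1 0 0 * conj (s'.1 1 0) := by
    apply Complex.ext <;> simp <;> linarith
  have g0 : s.1 0 0 * conj (s.1 0 0) = s'.1 0 0 * conj (s'.1 0 0) := by
    apply Complex.ext <;> simp <;> linarith
  have g1 : s.1 1 0 * conj (s.1 1 0) = s'.1 1 0 * conj (s'.1 1 0) := by
    apply Complex.ext <;> simp <;> linarith
  have g' := congrArg (starRingEnd ℂ) g
  simp only [map_mul, Complex.conj_conj] at g'
  have N := SU2.normSq_col s
  have N' := SU2.normSq_col s'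
  -- the phase is the hermitian product of the first columns
  obtain ⟨u, hu⟩ : ∃ u, u = conj (s.1 0 0) * s'.1 0 0 + conj (s.1 1 0) * s'.1 1 0 := ⟨_, rfl⟩
  have c0 : s'.1 0 0 = s.1 0 0 * u := by
    rw [hu]; linear_combination -s'.1 0 0 * g0 - s'.1 1 0 * g - s'.1 0 0 * N'
  have c1 : s'.1 1 0 = s.1 1 0 * u := by
    rw [hu]; linear_combination -s'.1 1 0 * g1 - s'.1 0 0 * g' - s'.1 1 0 * N'
  have hu1 : u * conj u = 1 := by
    rw [c0, c1] at N'
    simp only [map_mul] at N'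
    linear_combination N' - u * conj u * N
  refine ⟨u, hu1, ?_⟩
  ext i j
  rw [mul_diagSU2_apply]
  fin_cases i <;> fin_cases j <;> simp [diagFactor, SU2.entry_01, SU2.entry_11, ← c0, ← c1, ← map_mul]

lemma eq_of_smul_xstar_eq {τ τ' : ℝ} {s s' : SU2} (h : τ • xstar s = τ' • xstar s') :
    τ = τ' ∧ (τ = 0 ∨ xstar s = xstar s') := by
  have h2 : (Real.sqrt 2 : ℝ) ≠ 0 := by positivity
  have e : τ = τ' := by
    have := congrFun h 0
    simp only [Pi.smul_apply, xstar_zero, smul_eq_mul] at this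
    field_simp at this
    exact this
  subst e
  refine ⟨rfl, or_iff_not_imp_left.2 fun h0 => ?_⟩
  exact smul_right_injective _ h0 h

/-- A function of `(τ, s)`, `τ > 0`, that is constant on the fibres is a function on the cone; its
value at the vertex can be prescribed. -/
lemma exists_descend {α : Type*} {T : EReal} {G : ℝ → SU2 → α}
    (hG : ∀ τ ∈ posRange T, ∀ s u (hu : u * conj u = 1), G τ (s * diagSU2 u hu) = G τ s) (g₀ : α) :
    ∃ g : (Fin 4 → ℝ) → α, g 0 = g₀ ∧ ∀ τ ∈ posRange T, ∀ s, g (τ • xstar s) = G τ s := by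
  classical
  refine ⟨fun x => if h : ∃ p : ℝ × SU2, p.1 ∈ posRange T ∧ p.1 • xstar p.2 = x then
    G h.choose.1 h.choose.2 else g₀, ?_, ?_⟩
  · refine dif_neg ?_
    rintro ⟨p, hp, h⟩
    have := (eq_of_smul_xstar_eq (h.trans (zero_smul ℝ (xstar 1)).symm)).1
    exact hp.1.ne' this
  · intro τ hτ s
    have hex : ∃ p : ℝ × SU2, p.1 ∈ posRange T ∧ p.1 • xstar p.2 = τ • xstar s := ⟨(τ, s), hτ, rfl⟩
    simp only [dif_pos hex]
    obtain ⟨e1, e2⟩ := eq_of_smul_xstar_eq hex.choose_spec.2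
    obtain ⟨u, hu, e3⟩ := exists_eq_mul_diagSU2 (e2.resolve_left hex.choose_spec.1.1.ne')
    rw [← hG _ hex.choose_spec.1 _ u hu, ← e3, e1]

/-! ### Spinor components -/

lemma SU2.sum_mul_conj (s : SU2) (a b : Fin 2) : ∑ A, s.1 A a * conj (s.1 A b) = kron a b := by
  have h := congrFun (congrFun ((Matrix.mem_unitaryGroup_iff').1
    (Matrix.mem_specialUnitaryGroup_iff.1 s.2).1) b) a
  simp only [Matrix.mul_apply, Matrix.star_apply, Matrix.one_apply] at h
  simp only [kron, eq_comm (a := a), ← h]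
  exact Finset.sum_congr rfl fun A _ => mul_comm _ _

/-- Contraction with the columns of a unitary matrix inverts contraction with their conjugates. -/
lemma sum_mul_sum_conj {M : Matrix (Fin 2) (Fin 2) ℂ}
    (hM : ∀ a b, ∑ A, M A a * conj (M A b) = kron a b) (f : Fin 2 → ℂ) (a : Fin 2) :
    ∑ A, M A a * ∑ b, conj (M A b) * f b = f a := by
  simp only [Finset.mul_sum, ← mul_assoc]
  rw [Finset.sum_comm]
  simp only [← Finset.sum_mul, hM]
  simp [kron]

/-- The transformation of spinor components from the frame given by the columns of the unitary matrices
`M₁, …, M₄` to the standard frame. -/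
def toStandard (M₁ M₂ M₃ M₄ : Matrix (Fin 2) (Fin 2) ℂ)
    (f : Fin 2 → Fin 2 → Fin 2 → Fin 2 → ℂ) (A B C D : Fin 2) : ℂ :=
  ∑ d, conj (M₄ D d) * ∑ c, conj (M₃ C c) * ∑ b, conj (M₂ B b) * ∑ a, conj (M₁ A a) * f a b c d

lemma sum_toStandard {M₁ M₂ M₃ M₄ : Matrix (Fin 2) (Fin 2) ℂ}
    (h₁ : ∀ a b, ∑ A, M₁ A a * conj (M₁ A b) = kron a b)
    (h₂ : ∀ a b, ∑ A, M₂ A a * conj (M₂ A b) = kron a b)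
    (h₃ : ∀ a b, ∑ A, M₃ A a * conj (M₃ A b) = kron a b)
    (h₄ : ∀ a b, ∑ A, M₄ A a * conj (M₄ A b) = kron a b)
    (f : Fin 2 → Fin 2 → Fin 2 → Fin 2 → ℂ) (a b c d : Fin 2) :
    ∑ A, ∑ B, ∑ C, ∑ D, M₁ A a * M₂ B b * M₃ C c * M₄ D d * toStandard M₁ M₂ M₃ M₄ f A B C D =
      f a b c d := by
  simp only [mul_assoc, ← Finset.mul_sum]
  simp only [toStandard, sum_mul_sum_conj h₄, sum_mul_sum_conj h₃, sum_mul_sum_conj h₂,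
    sum_mul_sum_conj h₁]

lemma toStandard_mul {M₁ M₂ M₃ M₄ M₁' M₂' M₃' M₄' : Matrix (Fin 2) (Fin 2) ℂ}
    {χ₁ χ₂ χ₃ χ₄ : Fin 2 → ℂ} (h₁ : ∀ A a, M₁' A a = M₁ A a * χ₁ a)
    (h₂ : ∀ A a, M₂' A a = M₂ A a * χ₂ a) (h₃ : ∀ A a, M₃' A a = M₃ A a * χ₃ a)
    (h₄ : ∀ A a, M₄' A a = M₄ A a * χ₄ a) (k₁ : ∀ a, χ₁ a * conj (χ₁ a) = 1)
    (k₂ : ∀ a, χ₂ a * conj (χ₂ a) = 1) (k₃ : ∀ a, χ₃ a * conj (χ₃ a) = 1)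
    (k₄ : ∀ a, χ₄ a * conj (χ₄ a) = 1) {f f' : Fin 2 → Fin 2 → Fin 2 → Fin 2 → ℂ}
    (hf : ∀ a b c d, f' a b c d = χ₁ a * χ₂ b * χ₃ c * χ₄ d * f a b c d) :
    toStandard M₁' M₂' M₃' M₄' f' = toStandard M₁ M₂ M₃ M₄ f := by
  funext A B C D
  simp only [toStandard, Finset.mul_sum]
  refine Finset.sum_congr rfl fun d _ => Finset.sum_congr rfl fun c _ =>
    Finset.sum_congr rfl fun b _ => Finset.sum_congr rfl fun a _ => ?_
  simp only [h₁, h₂, h₃, h₄, hf, map_mul]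
  have k : (χ₁ a * conj (χ₁ a)) * (χ₂ b * conj (χ₂ b)) * (χ₃ c * conj (χ₃ c))
      * (χ₄ d * conj (χ₄ d)) = 1 := by rw [k₁, k₂, k₃, k₄]; norm_num
  linear_combination conj (M₄ D d) * conj (M₃ C c) * conj (M₂ B b) * conj (M₁ A a) * f a b c d * k

/-! ### Equivariance along the fibres -/

/-- Under the action of `diag(u, ū)` on the fibres the function `f` is multiplied by `c`. -/
def Equivariant (T : EReal) (u : ℂ) (hu : u * conj u = 1) (c : ℂ) (f : Fn) : Prop :=
  ∀ τ ∈ genRange T, ∀ s, f τ (s * diagSU2 u hu) = c * f τ s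

section

variable {T : EReal} {u : ℂ} {hu : u * conj u = 1} {c d : ℂ} {f g : Fn}

lemma Equivariant.congr (hf : Equivariant T u hu c f) (h : EqOnCone T g f) : Equivariant T u hu c g :=
  fun τ hτ s => by rw [h τ hτ, h τ hτ, hf τ hτ s]

lemma Equivariant.conj (hf : Equivariant T u hu c f) :
    Equivariant T u hu (starRingEnd ℂ c) (fun τ s => starRingEnd ℂ (f τ s)) :=
  fun τ hτ s => by simp only [hf τ hτ s, map_mul]

lemma Equivariant.mul (hf : Equivariant T u hu c f) (hg : Equivariant T u hu d g) :
    Equivariant T u hu (c * d) (fun τ s => f τ s * g τ s) :=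
  fun τ hτ s => by simp only [hf τ hτ s, hg τ hτ s]; ring

lemma Equivariant.fn_tau_mul (a : ℝ → ℂ) (hf : Equivariant T u hu c f) :
    Equivariant T u hu c (fun τ s => a τ * f τ s) :=
  fun τ hτ s => by simp only [hf τ hτ s]; ring

lemma Equivariant.radialMean (hf : Equivariant T u hu c f) (m : ℕ) :
    Equivariant T u hu c (radialMean m f) := by
  intro τ hτ s
  unfold ConformalCone.radialMean
  rw [← intervalIntegral.integral_const_mul]
  refine intervalIntegral.integral_congr fun t ht => ?_
  rw [uIcc_of_le zero_le_one] at ht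
  rw [hf (t * τ) (genRange_of_le hτ (mul_nonneg ht.1 hτ.1) (mul_le_of_le_one_left hτ.1 ht.2)) s]
  ring

/-- `X_-` multiplies the factor by `ū²`, since `diag(u, ū)` acts on `u₂ - i u₁` in this way. -/
lemma Equivariant.Xm (hf : Equivariant T u hu c f) (hs : SmoothOver (genRange T) f) :
    Equivariant T u hu (c * starRingEnd ℂ u ^ 2) (Xm f) := by
  intro τ hτ s
  obtain ⟨W, F, h⟩ := hs
  set k := diagSU2 u hu
  have key : ∀ {γ : ℝ → SU2} {q : ℂ}, HasVelocity γ 0 q →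
      leftInv γ (f τ) (s * k) = c * fderiv ℝ F (conePt τ s)
        (rightMul 0 (starRingEnd ℂ u ^ 2 * q) (conePt τ s)) := by
    intro γ q hγ
    have e00 : ∀ t, (k * γ t * k⁻¹).1 0 0 = (γ t).1 0 0 := fun t => by
      change (k.1 * (γ t).1 * star k.1) 0 0 = _
      simp only [k, Matrix.mul_apply, Fin.sum_univ_two, Matrix.star_apply]
      simp [diagSU2, mkSU2]
      linear_combination (γ t).1 0 0 * hu
    have e10 : ∀ t, (k * γ t * k⁻¹).1 1 0 = starRingEnd ℂ u ^ 2 * (γ t).1 1 0 := fun t => by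
      change (k.1 * (γ t).1 * star k.1) 1 0 = _
      simp only [k, Matrix.mul_apply, Fin.sum_univ_two, Matrix.star_apply]
      simp [diagSU2, mkSU2]
      ring
    have hγ' : HasVelocity (fun t => k * γ t * k⁻¹) 0 (starRingEnd ℂ u ^ 2 * q) :=
      ⟨by simp [hγ.zero], by simpa only [e00] using hγ.deriv0,
        by simpa only [e10] using hγ.deriv1.const_mul _⟩
    rw [← h.leftInv_eq hγ' hτ s]
    have : ∀ t, f τ (s * k * γ t) = c * f τ (s * (k * γ t * k⁻¹)) := fun t => by
      rw [← hf τ hτ]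
      congr 1
      simp only [mul_assoc]
      rw [show k⁻¹ * diagSU2 u hu = 1 from inv_mul_cancel k, mul_one]
    simp only [leftInv, this]
    exact deriv_const_mul_field _
  have lin : ∀ q : ℂ, fderiv ℝ F (conePt τ s) (rightMul 0 q (conePt τ s)) =
      q.re * fderiv ℝ F (conePt τ s) (rightMul 0 1 (conePt τ s))
        + q.im * fderiv ℝ F (conePt τ s) (rightMul 0 Complex.I (conePt τ s)) := by
    intro q
    have : rightMul 0 q (conePt τ s) = q.re • rightMul 0 1 (conePt τ s)
        + q.im • rightMul 0 Complex.I (conePt τ s) := by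
      have hq := (Complex.re_add_im q).symm
      simp only [rightMul_apply, Prod.smul_mk, Prod.mk_add_mk, smul_zero, add_zero,
        Complex.real_smul, Prod.mk.injEq, true_and]
      constructor
      · linear_combination (-starRingEnd ℂ (conePt τ s).2.2) * hq
      · linear_combination (starRingEnd ℂ (conePt τ s).2.1) * hq
    rw [this, map_add, map_smul, map_smul, Complex.real_smul, Complex.real_smul]
  simp only [ConformalCone.Xm, Zm, key hasVelocity_expU1, key hasVelocity_expU2,
    h.leftInv_eq hasVelocity_expU1 hτ, h.leftInv_eq hasVelocity_expU2 hτ]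
  rw [lin (starRingEnd ℂ u ^ 2 * (1 / 2)), lin (starRingEnd ℂ u ^ 2 * (Complex.I / 2)), lin (1 / 2),
    lin (Complex.I / 2)]
  obtain ⟨w, hw⟩ : ∃ w, w = starRingEnd ℂ u ^ 2 := ⟨_, rfl⟩
  rw [← hw]
  have e1 : (w * (1 / 2)).re = w.re / 2 ∧ (w * (1 / 2)).im = w.im / 2 := by
    constructor <;> simp <;> ring
  have e2 : (w * (Complex.I / 2)).re = -w.im / 2 ∧ (w * (Complex.I / 2)).im = w.re / 2 := by
    constructor <;> simp <;> ring
  rw [e1.1, e1.2, e2.1, e2.2]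
  simp
  have hw' := Complex.re_add_im w
  set L₁ := fderiv ℝ F (conePt τ s) (0, -starRingEnd ℂ (conePt τ s).2.2,
    starRingEnd ℂ (conePt τ s).2.1)
  set L₂ := fderiv ℝ F (conePt τ s) (0, -(Complex.I * starRingEnd ℂ (conePt τ s).2.2),
    Complex.I * starRingEnd ℂ (conePt τ s).2.1)
  linear_combination c / 2 * (Complex.I * L₂ - L₁) * hw' - c / 2 * w.im * L₂ * Complex.I_sq

lemma Equivariant.Xp (hf : Equivariant T u hu c f) (hs : SmoothOver (genRange T) f) :
    Equivariant T u hu (c * u ^ 2) (Xp f) := by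
  have h := (hf.conj.Xm hs.conj).conj
  simpa only [Xm_conj, Complex.conj_conj, map_mul, map_pow] using h

end

section

variable {T : EReal} {u : ℂ} {hu : u * conj u = 1} {c d : ℂ} {f g : Fn}

lemma Equivariant.cast (hf : Equivariant T u hu c f) (h : c = d) : Equivariant T u hu d f := h ▸ hf

lemma Equivariant.neg (hf : Equivariant T u hu c f) :
    Equivariant T u hu c (fun τ s => -f τ s) :=
  fun τ hτ s => by simp only [hf τ hτ s]; ring

lemma Equivariant.sub (hf : Equivariant T u hu c f) (hg : Equivariant T u hu c g) :
    Equivariant T u hu c (fun τ s => f τ s - g τ s) :=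
  fun τ hτ s => by simp only [hf τ hτ s, hg τ hτ s]; ring

lemma RadialODE.equivariant (hT : 0 < T) {m : ℕ} (h : RadialODE T m f g)
    (hf : SmoothOver (genRange T) f) (hg : SmoothOver (genRange T) g)
    (e : Equivariant T u hu c g) : Equivariant T u hu c f :=
  (e.radialMean m).congr (h.eq_radialMean hT hf hg)

/-- The behaviour of the radiation field along the fibres is passed on to all fields of the
hierarchy: a component with `n` frame vectors `κ_0` or `κ̄_{1'}` and `m` frame vectors `κ_1` or `κ̄_{0'}`
is multiplied by `u^n ū^m`. -/
lemma RadialSystem.equivariant (hT : 0 < T) {ψ₀ ψ₁ ψ₂ ψ₃ ψ₄ P q γ Q : Fn}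
    (h : RadialSystem T ψ₀ ψ₁ ψ₂ ψ₃ ψ₄ P q γ Q) (e₀ : Equivariant T u hu (u ^ 4) ψ₀) :
    Equivariant T u hu (u ^ 3 * conj u) ψ₁ ∧ Equivariant T u hu (u ^ 2 * conj u ^ 2) ψ₂ ∧
    Equivariant T u hu (u * conj u ^ 3) ψ₃ ∧ Equivariant T u hu (conj u ^ 4) ψ₄ ∧
    Equivariant T u hu (u ^ 4) P ∧ Equivariant T u hu (u ^ 3 * conj u) q ∧
    Equivariant T u hu (u ^ 2 * conj u ^ 2) Q := by
  have s₂ := smooth_rhs_ψ h.smooth_ψ₁ h.smooth_γ h.smooth_ψ₀ 1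
  simp only [one_mul] at s₂
  have eP : Equivariant T u hu (u ^ 4) P :=
    h.ode_P.equivariant hT h.smooth_P h.smooth_ψ₀.rhs_tau_sq
      (e₀.fn_tau_mul fun τ => -2 * (τ : ℂ) ^ 2)
  have eγ : Equivariant T u hu (conj u ^ 4) γ :=
    h.ode_γ.equivariant hT h.smooth_γ ((SmoothOver.tau _).mul h.smooth_P.conj)
      ((eP.conj.fn_tau_mul fun τ => (τ : ℂ)).cast (by rw [map_pow]))
  have eτγ := eγ.fn_tau_mul fun τ => (τ : ℂ)
  have e₁ : Equivariant T u hu (u ^ 3 * conj u) ψ₁ :=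
    h.ode_ψ₁.equivariant hT h.smooth_ψ₁ h.smooth_ψ₀.Xm.neg
      ((e₀.Xm h.smooth_ψ₀).neg.cast (by linear_combination u ^ 3 * conj u * hu))
  have e₂ : Equivariant T u hu (u ^ 2 * conj u ^ 2) ψ₂ :=
    h.ode_ψ₂.equivariant hT h.smooth_ψ₂ s₂
      (((e₁.Xm h.smooth_ψ₁).neg.cast (by linear_combination u ^ 2 * conj u ^ 2 * hu)).sub
        ((eτγ.mul e₀).cast
          (by linear_combination u ^ 2 * conj u ^ 2 * (u * conj u + 1) * hu)))
  have e₃ : Equivariant T u hu (u * conj u ^ 3) ψ₃ :=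
    h.ode_ψ₃.equivariant hT h.smooth_ψ₃ (smooth_rhs_ψ h.smooth_ψ₂ h.smooth_γ h.smooth_ψ₁ 2)
      (((e₂.Xm h.smooth_ψ₂).neg.cast (by linear_combination u * conj u ^ 3 * hu)).sub
        (((eτγ.mul e₁).fn_tau_mul fun _ => 2).cast
          (by linear_combination u * conj u ^ 3 * (u * conj u + 1) * hu)))
  have e₄ : Equivariant T u hu (conj u ^ 4) ψ₄ :=
    h.ode_ψ₄.equivariant hT h.smooth_ψ₄ (smooth_rhs_ψ h.smooth_ψ₃ h.smooth_γ h.smooth_ψ₂ 3)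
      (((e₃.Xm h.smooth_ψ₃).neg.cast (by linear_combination conj u ^ 4 * hu)).sub
        (((eτγ.mul e₂).fn_tau_mul fun _ => 3).cast
          (by linear_combination conj u ^ 4 * (u * conj u + 1) * hu)))
  have eq : Equivariant T u hu (u ^ 3 * conj u) q :=
    h.ode_q.equivariant hT h.smooth_q h.smooth_ψ₁.rhs_tau_sq
      (e₁.fn_tau_mul fun τ => -2 * (τ : ℂ) ^ 2)
  have eQ : Equivariant T u hu (u ^ 2 * conj u ^ 2) Q := by
    refine h.ode_Q.equivariant hT h.smooth_Q
      (smooth_rhs_Q h.smooth_q h.smooth_γ h.smooth_P h.smooth_ψ₂)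
      ((((eq.conj.Xp h.smooth_q.conj).neg.cast ?_).sub
        (((eγ.conj.fn_tau_mul fun τ => (τ : ℂ)).mul eP.conj).cast ?_)).sub
        (e₂.fn_tau_mul fun τ => 2 * (τ : ℂ) ^ 2))
    · simp only [map_mul, map_pow, Complex.conj_conj]
      linear_combination u ^ 2 * conj u ^ 2 * hu
    · simp only [map_pow, Complex.conj_conj]
      linear_combination u ^ 2 * conj u ^ 2 * (u * conj u + 1) * hu
  exact ⟨e₁, e₂, e₃, e₄, eP, eq, eQ⟩

end

/-! ### The fields at the vertex -/

lemma RadialODE.vertex {T : EReal} (hT : 0 < T) {m : ℕ} {f g : Fn} (h : RadialODE T m f g)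
    (hf : SmoothOver (genRange T) f) (hg : SmoothOver (genRange T) g) (s : SU2) :
    f 0 s = g 0 s / (m + 1) := by
  rw [h.eq_radialMean hT hf hg 0 (zero_mem_genRange hT), radialMean_zero]

lemma RadialSystem.vertex {T : EReal} (hT : 0 < T) {ψ₀ ψ₁ ψ₂ ψ₃ ψ₄ P q γ Q : Fn}
    (h : RadialSystem T ψ₀ ψ₁ ψ₂ ψ₃ ψ₄ P q γ Q) (s : SU2) :
    P 0 s = 0 ∧ q 0 s = 0 ∧ Q 0 s = 0 := by
  have eq : ∀ s, q 0 s = 0 := fun s => by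
    rw [h.ode_q.vertex hT h.smooth_q h.smooth_ψ₁.rhs_tau_sq]; simp
  refine ⟨?_, eq s, ?_⟩
  · rw [h.ode_P.vertex hT h.smooth_P h.smooth_ψ₀.rhs_tau_sq]; simp
  · rw [h.ode_Q.vertex hT h.smooth_Q
      (smooth_rhs_Q h.smooth_q h.smooth_γ h.smooth_P h.smooth_ψ₂),
      Xp_eq_zero (f := fun τ s => conj (q τ s)) (fun s => by rw [eq s, map_zero])]
    simp

lemma RadialSystem.ψ_vertex {T : EReal} (hT : 0 < T) {ψ₀ ψ₁ ψ₂ ψ₃ ψ₄ P q γ Q : Fn}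
    (h : RadialSystem T ψ₀ ψ₁ ψ₂ ψ₃ ψ₄ P q γ Q) (s : SU2) :
    ψ₁ 0 s = -Xm ψ₀ 0 s / 4 ∧ ψ₂ 0 s = -Xm ψ₁ 0 s / 3 ∧ ψ₃ 0 s = -Xm ψ₂ 0 s / 2 ∧
      ψ₄ 0 s = -Xm ψ₃ 0 s := by
  have s₂ := smooth_rhs_ψ h.smooth_ψ₁ h.smooth_γ h.smooth_ψ₀ 1
  simp only [one_mul] at s₂
  refine ⟨?_, ?_, ?_, ?_⟩
  · rw [h.ode_ψ₁.vertex hT h.smooth_ψ₁ h.smooth_ψ₀.Xm.neg]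
    norm_num
  · rw [h.ode_ψ₂.vertex hT h.smooth_ψ₂ s₂]
    norm_num
  · rw [h.ode_ψ₃.vertex hT h.smooth_ψ₃ (smooth_rhs_ψ h.smooth_ψ₂ h.smooth_γ h.smooth_ψ₁ 2)]
    norm_num
  · rw [h.ode_ψ₄.vertex hT h.smooth_ψ₄ (smooth_rhs_ψ h.smooth_ψ₃ h.smooth_γ h.smooth_ψ₂ 3)]
    norm_num

lemma Xm_col (A a : Fin 2) (τ : ℝ) (s : SU2) :
    Xm (fun _ s => s.1 A a) τ s = -(kron a 0 * s.1 A 1) := by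
  fin_cases a
  · simp [Xm_col0, kron]
  · simp [Xm_col1, kron]

lemma SmoothOver.col (R : Set ℝ) (A a : Fin 2) : SmoothOver R (fun _ s => s.1 A a) := by
  fin_cases a
  exacts [SmoothOver.col0 R A, SmoothOver.col1 R A]

/-- Contraction of one spinor index with the frame vector `κ_a`. -/
def contract (f : Fin 2 → Fn) (a : Fin 2) : Fn := fun τ s => ∑ A, s.1 A a * f A τ s

lemma SmoothOver.contract {R : Set ℝ} {f : Fin 2 → Fn} (hf : ∀ A, SmoothOver R (f A)) (a : Fin 2) :
    SmoothOver R (contract f a) := by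
  unfold ConformalCone.contract
  simp only [Fin.sum_univ_two]
  exact ((SmoothOver.col R 0 a).mul (hf 0)).add ((SmoothOver.col R 1 a).mul (hf 1))

/-- The derivative `X_-` replaces `κ_0` by `-κ_1` and annihilates `κ_1`. -/
lemma Xm_contract {R : Set ℝ} {f : Fin 2 → Fn} (hf : ∀ A, SmoothOver R (f A)) (a : Fin 2) {τ : ℝ}
    (hτ : τ ∈ R) (s : SU2) :
    Xm (contract f a) τ s = contract (fun A => Xm (f A)) a τ s - kron a 0 * contract f 1 τ s := by
  unfold contract
  simp only [Fin.sum_univ_two]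
  rw [Xm_add ((SmoothOver.col R 0 a).mul (hf 0)) ((SmoothOver.col R 1 a).mul (hf 1)) hτ,
    Xm_mul (SmoothOver.col R 0 a) (hf 0) hτ, Xm_mul (SmoothOver.col R 1 a) (hf 1) hτ, Xm_col,
    Xm_col]
  ring

/-- The components in the frame `κ` of a constant spinor with four indices. -/
def frameComp (p : Fin 2 → Fin 2 → Fin 2 → Fin 2 → ℂ) (a b c d : Fin 2) : Fn :=
  contract (fun A => contract (fun B => contract (fun C => contract (fun D _ _ => p A B C D) d) c) b) a

lemma frameComp_apply (p : Fin 2 → Fin 2 → Fin 2 → Fin 2 → ℂ) (a b c d : Fin 2) (τ : ℝ) (s : SU2) :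
    frameComp p a b c d τ s =
      ∑ A, ∑ B, ∑ C, ∑ D, s.1 A a * s.1 B b * s.1 C c * s.1 D d * p A B C D := by
  simp only [frameComp, contract, Finset.mul_sum, mul_assoc]

lemma symm4_frameComp {p : Fin 2 → Fin 2 → Fin 2 → Fin 2 → ℂ} (hp : Symm4 p) (τ : ℝ) (s : SU2) :
    Symm4 fun a b c d => frameComp p a b c d τ s := by
  intro a b c d
  simp only [frameComp_apply]
  refine ⟨?_, ?_, ?_⟩
  · rw [Finset.sum_comm]
    refine Finset.sum_congr rfl fun B _ => Finset.sum_congr rfl fun A _ =>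
      Finset.sum_congr rfl fun C _ => Finset.sum_congr rfl fun D _ => ?_
    rw [(hp A B C D).1]; ring
  · refine Finset.sum_congr rfl fun A _ => ?_
    rw [Finset.sum_comm]
    refine Finset.sum_congr rfl fun C _ => Finset.sum_congr rfl fun B _ =>
      Finset.sum_congr rfl fun D _ => ?_
    rw [(hp A B C D).2.1]; ring
  · refine Finset.sum_congr rfl fun A _ => Finset.sum_congr rfl fun B _ => ?_
    rw [Finset.sum_comm]
    refine Finset.sum_congr rfl fun D _ => Finset.sum_congr rfl fun C _ => ?_
    rw [(hp A B C D).2.2]; ring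

lemma Xm_frameComp (p : Fin 2 → Fin 2 → Fin 2 → Fin 2 → ℂ) (a b c d : Fin 2) (τ : ℝ) (s : SU2) :
    Xm (frameComp p a b c d) τ s = -(kron a 0 * frameComp p 1 b c d τ s
      + kron b 0 * frameComp p a 1 c d τ s + kron c 0 * frameComp p a b 1 d τ s
      + kron d 0 * frameComp p a b c 1 τ s) := by
  have h4 : ∀ A B C D, SmoothOver univ (fun _ _ => p A B C D) := fun _ _ _ _ => SmoothOver.const _ _
  have h3 := fun A B C => SmoothOver.contract (h4 A B C) d
  have h2 := fun A B => SmoothOver.contract (h3 A B) c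
  have h1 := fun A => SmoothOver.contract (h2 A) b
  have e4 : ∀ A B C τ s, Xm (contract (fun D _ _ => p A B C D) d) τ s =
      -(kron d 0 * contract (fun D _ _ => p A B C D) 1 τ s) := fun A B C τ s => by
    rw [Xm_contract (h4 A B C) d (mem_univ τ)]
    simp [contract, Xm_fn_tau (fun _ => p A B C _)]
  have e3 := fun A B τ s => Xm_contract (h3 A B) c (mem_univ τ) s
  have e2 := fun A τ s => Xm_contract (h2 A) b (mem_univ τ) s
  have e1 := fun τ s => Xm_contract h1 a (mem_univ τ) s
  unfold frameComp
  rw [e1]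
  simp only [contract, Fin.sum_univ_two] at e2 e3 e4 ⊢
  simp only [e2, e3, e4]
  ring

lemma Symm4.apply {α β : Type*} {f : Fin 2 → Fin 2 → Fin 2 → Fin 2 → α → β} (hf : Symm4 f) (x : α) :
    Symm4 fun a b c d => f a b c d x := fun a b c d =>
  ⟨congrFun (hf a b c d).1 x, congrFun (hf a b c d).2.1 x, congrFun (hf a b c d).2.2 x⟩

lemma NormalForm.ψ_vertex {T : EReal} (hT : 0 < T) {F : Fields} (h : NormalForm T F)
    {p : Fin 2 → Fin 2 → Fin 2 → Fin 2 → ℂ} (hp : Symm4 p)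
    (h₀ : ∀ s, F.ψ 0 0 0 0 0 s = frameComp p 0 0 0 0 0 s) (a b c d : Fin 2) (s : SU2) :
    F.ψ a b c d 0 s = frameComp p a b c d 0 s := by
  have hz := zero_mem_genRange hT
  have v := h.system.ψ_vertex hT
  have sy := fun s => symm4_frameComp hp 0 s
  have e₁ : ∀ s, F.ψ 0 0 0 1 0 s = frameComp p 0 0 0 1 0 s := fun s => by
    rw [(v s).1, Xm_congr h₀, Xm_frameComp]
    simp only [(sy s).eq_symmComp 1 0 0 0, (sy s).eq_symmComp 0 1 0 0, (sy s).eq_symmComp 0 0 1 0]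
    simp [symmComp, kron]
    ring
  have e₂ : ∀ s, F.ψ 0 0 1 1 0 s = frameComp p 0 0 1 1 0 s := fun s => by
    rw [(v s).2.1, Xm_congr e₁, Xm_frameComp]
    simp only [(sy s).eq_symmComp 1 0 0 1, (sy s).eq_symmComp 0 1 0 1]
    simp [symmComp, kron]
    ring
  have e₃ : ∀ s, F.ψ 0 1 1 1 0 s = frameComp p 0 1 1 1 0 s := fun s => by
    rw [(v s).2.2.1, Xm_congr e₂, Xm_frameComp]
    simp only [(sy s).eq_symmComp 1 0 1 1]
    simp [symmComp, kron]
  have e₄ : ∀ s, F.ψ 1 1 1 1 0 s = frameComp p 1 1 1 1 0 s := fun s => by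
    rw [(v s).2.2.2, Xm_congr e₃, Xm_frameComp]
    simp [kron]
  rw [h.ψ_eq hz, (sy s).eq_symmComp a b c d]
  fin_cases a <;> fin_cases b <;> fin_cases c <;> fin_cases d <;>
    simp [symmComp, h₀, e₁, e₂, e₃, e₄]

/-! ### The lift property -/

lemma mem_posRange_or_eq_zero {T : EReal} {τ : ℝ} (hτ : τ ∈ genRange T) : τ = 0 ∨ τ ∈ posRange T :=
  hτ.1.eq_or_lt.imp Eq.symm fun h => ⟨h, hτ.2⟩

lemma SU2.sum_conj_mul (s : SU2) (a b : Fin 2) :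
    ∑ A, s.1.map (starRingEnd ℂ) A a * conj (s.1.map (starRingEnd ℂ) A b) = kron a b := by
  have h := congrArg (starRingEnd ℂ) (SU2.sum_mul_conj s a b)
  rw [map_sum] at h
  simpa [kron, apply_ite] using h

lemma equivariant_radiationField (T : EReal) {u : ℂ} (hu : u * conj u = 1)
    (ψs : Fin 2 → Fin 2 → Fin 2 → Fin 2 → (Fin 4 → ℝ) → ℂ) :
    Equivariant T u hu (u ^ 4) (radiationField ψs) := by
  intro τ _ s
  simp only [radiationField, Finset.mul_sum, xstar_mul_diagSU2, mul_diagSU2_apply]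
  refine Finset.sum_congr rfl fun A _ => Finset.sum_congr rfl fun B _ =>
    Finset.sum_congr rfl fun C _ => Finset.sum_congr rfl fun D _ => ?_
  simp only [diagFactor, if_true]
  ring

namespace NormalForm

variable {T : EReal} {F : Fields} (h : NormalForm T F)
include h

lemma ψ_mul_diagSU2 (hT : 0 < T) {u : ℂ} (hu : u * conj u = 1)
    (e₀ : Equivariant T u hu (u ^ 4) (F.ψ 0 0 0 0)) {τ : ℝ} (hτ : τ ∈ genRange T) (s : SU2)
    (a b c d : Fin 2) : F.ψ a b c d τ (s * diagSU2 u hu) =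
      diagFactor u a * diagFactor u b * diagFactor u c * diagFactor u d * F.ψ a b c d τ s := by
  obtain ⟨e₁, e₂, e₃, e₄, -⟩ := h.system.equivariant hT e₀
  rw [h.ψ_eq hτ, h.ψ_eq hτ]
  fin_cases a <;> fin_cases b <;> fin_cases c <;> fin_cases d <;>
    simp [-mul_eq_mul_right_iff, -mul_eq_mul_left_iff, symmComp, diagFactor, e₀ τ hτ, e₁ τ hτ,
      e₂ τ hτ, e₃ τ hτ, e₄ τ hτ] <;> ring

lemma Φ_mul_diagSU2 (hT : 0 < T) {u : ℂ} (hu : u * conj u = 1)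
    (e₀ : Equivariant T u hu (u ^ 4) (F.ψ 0 0 0 0)) {τ : ℝ} (hτ : τ ∈ genRange T) (s : SU2)
    (a b a' b' : Fin 2) : F.Φ a b a' b' τ (s * diagSU2 u hu) =
      diagFactor u a * diagFactor u b * conj (diagFactor u a') * conj (diagFactor u b')
        * F.Φ a b a' b' τ s := by
  obtain ⟨-, -, -, -, eP, eq, eQ⟩ := h.system.equivariant hT e₀
  rw [h.Φ_eq a b a' b' τ hτ, h.Φ_eq a b a' b' τ hτ]
  fin_cases a <;> fin_cases b <;> fin_cases a' <;> fin_cases b' <;>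
    simp [-mul_eq_mul_right_iff, -mul_eq_mul_left_iff, phiComp, diagFactor, eP τ hτ, eq τ hτ,
      eQ τ hτ] <;> ring

lemma Φ_vertex (hT : 0 < T) (a b a' b' : Fin 2) (s : SU2) : F.Φ a b a' b' 0 s = 0 := by
  obtain ⟨eP, eq, eQ⟩ := h.system.vertex hT s
  rw [h.Φ_eq a b a' b' 0 (zero_mem_genRange hT)]
  fin_cases a <;> fin_cases b <;> fin_cases a' <;> fin_cases b' <;> simp [phiComp, eP, eq, eQ]

lemma isLift (hT : 0 < T) {ψs : Fin 2 → Fin 2 → Fin 2 → Fin 2 → (Fin 4 → ℝ) → ℂ}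
    (hψs : Symm4 ψs) (h₀ : EqOnCone T (F.ψ 0 0 0 0) (radiationField ψs)) : IsLift T F := by
  have e₀ : ∀ {u : ℂ} (hu : u * conj u = 1), Equivariant T u hu (u ^ 4) (F.ψ 0 0 0 0) :=
    fun hu => (equivariant_radiationField T hu ψs).congr h₀
  refine ⟨⟨fun _ => 0, h.Ω_eq⟩, ⟨fun _ => 2, h.Pi_eq⟩, ?_, ?_, ?_⟩
  · obtain ⟨g, g0, hg⟩ := exists_descend (T := T)
      (G := fun τ s A A' => (τ : ℂ) * 2 * (conj (s.1 A 1) * s.1 A' 1)) (fun τ hτ s u hu => by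
        funext A A'
        simp only [mul_diagSU2_apply, map_mul]
        linear_combination (τ : ℂ) * 2 * (conj (s.1 A 1) * s.1 A' 1) * diagFactor_mul_conj hu 1) 0
    refine ⟨fun A A' x => g x A A', fun τ hτ s a a' => ?_⟩
    beta_reduce
    rcases mem_posRange_or_eq_zero hτ with rfl | hτ0
    · rw [h.Sig_eq a a' 0 hτ, zero_smul, g0]
      simp
    · rw [h.Sig_eq a a' τ hτ, hg τ hτ0, ← SU2.sum_mul_conj s a 1, ← SU2.sum_conj_mul s a' 1]
      simp only [Fin.sum_univ_two, Matrix.map_apply, Complex.conj_conj]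
      ring
  · obtain ⟨g, g0, hg⟩ := exists_descend (T := T)
      (G := fun τ s => toStandard s.1 s.1 (s.1.map (starRingEnd ℂ)) (s.1.map (starRingEnd ℂ))
        fun a b a' b' => F.Φ a b a' b' τ s) (fun τ hτ s u hu => by
          have k' : ∀ a, conj (diagFactor u a) * conj (conj (diagFactor u a)) = 1 := fun a => by
            rw [Complex.conj_conj, mul_comm, diagFactor_mul_conj hu]
          have m' : ∀ A a, (s * diagSU2 u hu).1.map (starRingEnd ℂ) A a =
              s.1.map (starRingEnd ℂ) A a * conj (diagFactor u a) := fun A a => by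
            rw [Matrix.map_apply, mul_diagSU2_apply, map_mul, Matrix.map_apply]
          exact toStandard_mul (mul_diagSU2_apply s hu) (mul_diagSU2_apply s hu) m' m'
            (diagFactor_mul_conj hu) (diagFactor_mul_conj hu) k' k'
            (h.Φ_mul_diagSU2 hT hu (e₀ hu) (posRange_subset T hτ) s)) 0
    refine ⟨fun A B A' B' x => g x A B A' B', fun τ hτ s a b a' b' => ?_⟩
    beta_reduce
    rcases mem_posRange_or_eq_zero hτ with rfl | hτ0
    · rw [h.Φ_vertex hT, zero_smul, g0]
      simp
    · rw [hg τ hτ0]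
      exact (sum_toStandard (SU2.sum_mul_conj s) (SU2.sum_mul_conj s) (SU2.sum_conj_mul s) (SU2.sum_conj_mul s)
        (fun a b a' b' => F.Φ a b a' b' τ s) a b a' b').symm
  · obtain ⟨g, g0, hg⟩ := exists_descend (T := T)
      (G := fun τ s => toStandard s.1 s.1 s.1 s.1 fun a b c d => F.ψ a b c d τ s)
      (fun τ hτ s u hu => toStandard_mul (mul_diagSU2_apply s hu) (mul_diagSU2_apply s hu)
        (mul_diagSU2_apply s hu) (mul_diagSU2_apply s hu) (diagFactor_mul_conj hu)
        (diagFactor_mul_conj hu) (diagFactor_mul_conj hu) (diagFactor_mul_conj hu)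
        (h.ψ_mul_diagSU2 hT hu (e₀ hu) (posRange_subset T hτ) s)) (fun A B C D => ψs A B C D 0)
    refine ⟨fun A B C D x => g x A B C D, fun τ hτ s a b c d => ?_⟩
    beta_reduce
    rcases mem_posRange_or_eq_zero hτ with rfl | hτ0
    · rw [zero_smul, g0, h.ψ_vertex hT (hψs.apply 0) (fun s => ?_), frameComp_apply]
      rw [h₀ 0 hτ, frameComp_apply]
      simp only [radiationField, zero_smul]
    · rw [hg τ hτ0]
      exact (sum_toStandard (SU2.sum_mul_conj s) (SU2.sum_mul_conj s) (SU2.sum_mul_conj s) (SU2.sum_mul_conj s)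
        (fun a b c d => F.ψ a b c d τ s) a b c d).symm

end NormalForm

/-! ### Smoothness of the radiation field -/

/-- The null vector `x_*` as a quadratic map of the first column of `s`. -/
def nullVector (y : ℂ × ℂ) (μ : Fin 4) : ℝ :=
  (∑ E, ∑ E', vdW μ E E' * ![y.1, y.2] E * conj (![y.1, y.2] E')).re

lemma contDiff_nullVector : ContDiff ℝ ∞ nullVector := by
  have hc : ∀ E : Fin 2, ContDiff ℝ ∞ fun y : ℂ × ℂ => ![y.1, y.2] E := fun E => by
    fin_cases E
    exacts [contDiff_fst, contDiff_snd]
  have hsum : ∀ μ, ContDiff ℝ ∞ fun y : ℂ × ℂ =>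
      ∑ E, ∑ E', vdW μ E E' * ![y.1, y.2] E * conj (![y.1, y.2] E') := fun μ =>
    ContDiff.sum fun E _ => ContDiff.sum fun E' _ => (contDiff_const.mul (hc E)).mul
      (Complex.conjCLE.toContinuousLinearMap.contDiff.comp (hc E'))
  exact contDiff_pi.2 fun μ => Complex.reCLM.contDiff.comp (hsum μ)

lemma nullVector_col (s : SU2) : nullVector (s.1 0 0, s.1 1 0) = xstar s := by
  funext μ
  simp [nullVector, xstar, Fin.sum_univ_two]

lemma smoothOver_radiationField {R : Set ℝ} {U : Set (Fin 4 → ℝ)} (hU : IsOpen U)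
    (hcone : ∀ τ ∈ R, ∀ s : SU2, τ • xstar s ∈ U)
    {ψs : Fin 2 → Fin 2 → Fin 2 → Fin 2 → (Fin 4 → ℝ) → ℂ}
    (hψs : ∀ A B C D, ContDiffOn ℝ ∞ (ψs A B C D) U) : SmoothOver R (radiationField ψs) := by
  have hX : ContDiff ℝ ∞ fun p : ℝ × ℂ × ℂ => p.1 • nullVector p.2 :=
    contDiff_fst.smul (contDiff_nullVector.comp contDiff_snd)
  have hs : ∀ A B C D, SmoothOver R fun τ s => ψs A B C D (τ • xstar s) := fun A B C D =>
    ⟨_, fun p => ψs A B C D (p.1 • nullVector p.2), hU.preimage hX.continuous,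
      (hψs A B C D).comp hX.contDiffOn fun _ hp => hp,
      fun τ hτ s => by
        change τ • nullVector (s.1 0 0, s.1 1 0) ∈ U
        rw [nullVector_col]
        exact hcone τ hτ s,
      fun τ _ s => by
        change ψs A B C D (τ • nullVector (s.1 0 0, s.1 1 0)) = _
        rw [nullVector_col]⟩
  exact SmoothOver.sum _ fun A _ => SmoothOver.sum _ fun B _ => SmoothOver.sum _ fun C _ =>
    SmoothOver.sum _ fun D _ => ((((SmoothOver.col0 R A).mul (SmoothOver.col0 R B)).mul
      (SmoothOver.col0 R C)).mul (SmoothOver.col0 R D)).mul (hs A B C D)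

end ConformalCone

end

theorem proposition2 (T : EReal) (hT : 0 < T)
    (U : Set (Fin 4 → ℝ)) (hU : IsOpen U)
    (hcone : ∀ τ ∈ ConformalCone.genRange T, ∀ s : ConformalCone.SU2,
      τ • ConformalCone.xstar s ∈ U)
    (ψs : Fin 2 → Fin 2 → Fin 2 → Fin 2 → (Fin 4 → ℝ) → ℂ)
    (hsmooth : ∀ A B C D, ContDiffOn ℝ ∞ (ψs A B C D) U)
    (hsymm : ConformalCone.Symm4 ψs) :
    -- existence
    (∃ F, ConformalCone.IsTransportSolution T (ConformalCone.radiationField ψs) F) ∧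
    -- uniqueness
    (∀ F G, ConformalCone.IsTransportSolution T (ConformalCone.radiationField ψs) F →
      ConformalCone.IsTransportSolution T (ConformalCone.radiationField ψs) G →
      ConformalCone.SameFields T F G) ∧
    -- explicit form, lift property and inner constraints
    (∀ F, ConformalCone.IsTransportSolution T (ConformalCone.radiationField ψs) F →
      ConformalCone.ExplicitForm T (ConformalCone.radiationField ψs) F ∧
      ConformalCone.IsLift T F ∧
      ConformalCone.InnerConstraints T F) := by
  have hsol := ConformalCone.smoothOver_radiationField hU hcone hsmooth
  refine ⟨ConformalCone.exists_isTransportSolution hT hsol, fun F G hF hG => ?_, fun F hF => ?_⟩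
  · exact (hF.normalForm hT).sameFields hT (hG.normalForm hT) fun τ hτ s =>
      (hF.radiation τ hτ s).trans (hG.radiation τ hτ s).symm
  · have h := hF.normalForm hT
    exact ⟨h.explicitForm hT hF.radiation, h.isLift hT hsymm hF.radiation, h.innerConstraints hT⟩
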